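/- Let $k$ be a commutative semiring, $V$ a countably infinite set of variables and $\mathcal A$ a set of atoms, each equipped with an involution $x\mapsto\bar x$ without fixed points. **Types.** $A::=\alpha\mid A\otimes B\mid A⅋B\mid\,!A\mid\,?A$ ($\alpha\in\mathcal A$), with $\alpha^\perp=\bar\alpha$, $(A\otimes B)^\perp=A^\perp⅋B^\perp$, $(A⅋B)^\perp=A^\perp\otimes B^\perp$, $(!A)^\perp=\,?A^\perp$, $(?A)^\perp=\,!A^\perp$. A typing context is a finite partial function $\Phi$ from $V$ to types with $\Phi(\bar x)=\Phi(x)^\perp$ whenever both are defined. **Proof-structures.** By mutual recursion: constructors are $\otimes,⅋,\mathsf c_?,\mathsf c_!$ (arity 2; contraction, cocontraction), $\mathsf d_?,\mathsf d_!$ (arity 1; dereliction, codereliction), $\mathsf w_?,\mathsf w_!$ (arity 0; weakening, coweakening) and, for each $n$ and each proof-structure $P$ of width $n+1$, the promotion box $P^{!n}$ of arity $n$; a tree is a variable or $\phi(t_1,\dots,t_n)$ with $\phi$ of arity $n$; a cut is an unordered pair $\langle t\,|\,t'\rangle$ of trees; a simple proof-structure $p=(\vec t\,;\vec c)$ of width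 $n$ consists of a list $\vec t$ of $n$ trees and a list $\vec c$ of cuts. No variable may occur twice in $p$, where the content of boxes does not count. Simple proof-structures are considered up to the order of the cuts and up to renaming of bound variables (an occurring $x$ is bound if $\bar x$ occurs too; $x$ and $\bar x$ are renamed together). A proof-structure (of width $n$) is a finite $k$-linear combination $P=\sum_pP_p\,p$ of simple proof-structures (of width $n$). **Proof-nets.** $\Phi\vdash p:\Gamma$ ($p$ is a proof-net of the list of types $\Gamma$ under $\Phi$) is inductively defined by the following rules, in which the premises of a rule other than the contents of boxes have disjoint sets of variables. - Axiom: $\Phi\vdash(x,\bar x\,;):A,A^\perp$ if $\Phi(x)=A$, $\Phi(\bar x)=A^\perp$. Exchange: simultaneous permutation of the trees and of $\Gamma$. - Cut: from $(\vec s,s;\vec c):\Gamma,A$ and $(\vec t,t;\vec d):\Delta,A^\perp$ infer $(\vec s,\vec t;\vec c,\vec d,\langle s|t\rangle):\Gamma,\Delta$. Mix: from $(\vec s;\vec c):\Gamma$ and $(\vec t;\vec d):\Delta$ infer $(\vec s,\vec t;\vec c,\vec d):\Gamma,\Delta$. - From $(\vec t,s,t;\vec c):\Gamma,A,B$ infer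 $(\vec t,s⅋t;\vec c):\Gamma,A⅋B$; from $(\vec s,s;\vec c):\Gamma,A$ and $(\vec t,t;\vec d):\Delta,B$ infer $(\vec s,\vec t,s\otimes t;\vec c,\vec d):\Gamma,\Delta,A\otimes B$. - From $(\vec s;\vec c):\Gamma$ infer $(\vec s,\mathsf w_?;\vec c):\Gamma,?A$; infer $(\mathsf w_!\,;):\,!A$; from $(\vec s,s;\vec c):\Gamma,A$ infer $(\vec s,\mathsf d_?(s);\vec c):\Gamma,?A$ and also $(\vec s,\mathsf d_!(s);\vec c):\Gamma,!A$; from $(\vec s,s_1,s_2;\vec c):\Gamma,?A,?A$ infer $(\vec s,\mathsf c_?(s_1,s_2);\vec c):\Gamma,?A$; from $(\vec s,s;\vec c):\Gamma,!A$ and $(\vec t,t;\vec d):\Delta,!A$ infer $(\vec s,\vec t,\mathsf c_!(s,t);\vec c,\vec d):\Gamma,\Delta,!A$. - Promotion: from $\Phi\vdash P:\,?A_1^\perp,\dots,?A_n^\perp,B$ and $(\vec t_i,t_i;\vec c_i):\Gamma_i,!A_i$ ($1\le i\le n$) infer $(\vec t_1,\dots,\vec t_n,P^{!n}(t_1,\dots,t_n);\vec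 c_1,\dots,\vec c_n):\Gamma_1,\dots,\Gamma_n,!B$. - Sum: from $\Phi\vdash p_i:\Gamma$ for $1\le i\le m$ infer $\Phi\vdash\sum_{i=1}^m\mu_ip_i:\Gamma$ (any $m\ge0$, $\mu_i\in k$). For simple proof-structures considered up to renaming, the judgment means that some representative is derivable. **Cut reduction.** Variables introduced by a reduction are pairwise distinct (together with their covariables) and fresh, and box contents that are opened are first renamed so as to avoid clashes. Basic rules: $\langle s_1⅋s_2|t_1\otimes t_2\rangle\to(;\langle s_1|t_1\rangle,\langle s_2|t_2\rangle)$; $\langle\mathsf w_?|\mathsf w_!\rangle\to(;)$; $\langle\mathsf d_?(s)|\mathsf w_!\rangle\to0$; $\langle\mathsf w_?|\mathsf d_!(t)\rangle\to0$; $\langle\mathsf c_?(s_1,s_2)|\mathsf w_!\rangle\to(;\langle s_1|\mathsf w_!\rangle,\langle s_2|\mathsf w_!\rangle)$; $\langle\mathsf w_?|\mathsf c_!(t_1,t_2)\rangle\to(;\langle\mathsf w_?|t_1\rangle,\langle\mathsf w_?|t_2\rangle)$; $\langle\mathsf d_?(s)|\mathsf d_!(t)\rangle\to(;\langle s|t\rangle)$;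 $\langle\mathsf c_?(s_1,s_2)|\mathsf d_!(t)\rangle\to(;\langle s_1|\mathsf d_!(t)\rangle,\langle s_2|\mathsf w_!\rangle)+(;\langle s_1|\mathsf w_!\rangle,\langle s_2|\mathsf d_!(t)\rangle)$; $\langle\mathsf d_?(s)|\mathsf c_!(t_1,t_2)\rangle\to(;\langle\mathsf d_?(s)|t_1\rangle,\langle\mathsf w_?|t_2\rangle)+(;\langle\mathsf w_?|t_1\rangle,\langle\mathsf d_?(s)|t_2\rangle)$; $\langle\mathsf c_?(s_1,s_2)|\mathsf c_!(t_1,t_2)\rangle\to(;\langle s_1|\mathsf c_!(x_{11},x_{12})\rangle,\langle s_2|\mathsf c_!(x_{21},x_{22})\rangle,\langle\mathsf c_?(\bar x_{11},\bar x_{21})|t_1\rangle,\langle\mathsf c_?(\bar x_{12},\bar x_{22})|t_2\rangle)$; $\langle P^{!n}(\vec t)|\mathsf w_?\rangle\to(;\langle t_1|\mathsf w_?\rangle,\dots,\langle t_n|\mathsf w_?\rangle)$; $\langle P^{!n}(\vec t)|\mathsf d_?(s)\rangle\to\sum_{p=(\vec s,s';\vec c)}P_p\,(;\vec c,\langle s_1|t_1\rangle,\dots,\langle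 s_n|t_n\rangle,\langle s'|s\rangle)$; $\langle P^{!n}(\vec t)|\mathsf c_?(s_1,s_2)\rangle\to(;\langle P^{!n}(\vec x)|s_1\rangle,\langle P^{!n}(\vec y)|s_2\rangle,\langle t_1|\mathsf c_?(\bar x_1,\bar y_1)\rangle,\dots,\langle t_n|\mathsf c_?(\bar x_n,\bar y_n)\rangle)$. If $c\to P$ by a basic rule then $(\vec s;c,\vec b)\to\sum_{p=(\vec t;\vec d)}P_p\,(\vec s,\vec t;\vec d,\vec b)$. Moreover $(\vec t;\langle x|s\rangle,\vec c)\to(\vec t;\vec c)[s/\bar x]$ if $\bar x$ does not occur in $s$. **Commutative reduction.** For trees, with $P$ of width $n+2$, $1\le i\le n+1$, and each $p$ in $P$ written $(s_1,\dots,s_{n+1},s;\vec c)$: $P^{!n+1}(\dots,t_{i-1},Q^{!k}(\vec u),t_{i+1},\dots)\to R^{!n+k}(\dots,t_{i-1},\vec u,t_{i+1},\dots)$ with $R=\sum_pP_p(\dots,s_{i-1},\bar x_1,\dots,\bar x_k,s_{i+1},\dots,s;\vec c,\langle s_i|Q^{!k}(\vec x)\rangle)$; $P^{!n+1}(\dots,t_{i-1},\mathsf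 w_!,t_{i+1},\dots)\to R^{!n}(\dots,t_{i-1},t_{i+1},\dots)$ with $R=\sum_pP_p(\dots,s_{i-1},s_{i+1},\dots,s;\vec c,\langle s_i|\mathsf w_!\rangle)$; $P^{!n+1}(\dots,t_{i-1},\mathsf c_!(u,v),t_{i+1},\dots)\to R^{!n+2}(\dots,t_{i-1},u,v,t_{i+1},\dots)$ with $R=\sum_pP_p(\dots,s_{i-1},\bar x,\bar y,s_{i+1},\dots,s;\vec c,\langle s_i|\mathsf c_!(x,y)\rangle)$; $P^{!n+1}(\dots,t_{i-1},\mathsf d_!(u),t_{i+1},\dots)\to\sum_pP_p\,(\mathsf c_!(P^{!n+1}(\dots,x_{i-1},\mathsf w_!,x_{i+1},\dots),\mathsf d_!(s));\vec c,\langle s_i|\mathsf d_!(u)\rangle,(\langle\mathsf c_?(\bar x_j,s_j)|t_j\rangle)_{j\ne i})$. If $t\to P$ then $\phi(\vec u,t,\vec v)\to\sum_{p=(w;\vec c)}P_p\,(\phi(\vec u,w,\vec v);\vec c)$ for every constructor $\phi$; and for simple proof-structures $(\vec u,t,\vec v;\vec c)\to\sum_{p=(w;\vec d)}P_p\,(\vec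 u,w,\vec v;\vec c,\vec d)$ and $(\vec t;\langle t|t'\rangle,\vec c)\to\sum_{p=(w;\vec d)}P_p\,(\vec t;\vec c,\vec d,\langle w|t'\rangle)$. **Theorem (subject reduction).** Let $p$ be a simple proof-structure and $P$ a proof-structure. If $\Phi\vdash p:\Gamma$ and $p\to P$ by one step of cut reduction or of commutative reduction, then $\Phi'\vdash P:\Gamma$ for some typing context $\Phi'$ that extends $\Phi$. -/

import Mathlib

namespace DiLL

universe u v w

/-- A set equipped with an involution without fixed points (used for variables and for atoms). -/
class CoInvol (α : Type u) where
  co : α → α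
  co_co : ∀ x, co (co x) = x
  co_ne : ∀ x, co x ≠ x

/-! ### Types -/

/-- Types of linear logic over a set of atoms: `bang A` is `!A` and `quest A` is `?A`. -/
inductive Formula (Atom : Type u) : Type u
  | atom (a : Atom) : Formula Atom
  | tens (A B : Formula Atom) : Formula Atom
  | par (A B : Formula Atom) : Formula Atom
  | bang (A : Formula Atom) : Formula Atom
  | quest (A : Formula Atom) : Formula Atom

/-- Linear negation. -/
def Formula.orth {Atom : Type u} [CoInvol Atom] : Formula Atom → Formula Atom
  | .atom a => .atom (CoInvol.co a)
  | .tens A B => .par A.orth B.orth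
  | .par A B => .tens A.orth B.orth
  | .bang A => .quest A.orth
  | .quest A => .bang A.orth

/-- Typing contexts: finite partial functions from variables to types, compatible with duality. -/
structure TypingContext (Var : Type u) (Atom : Type v) [CoInvol Var] [CoInvol Atom] where
  toFun : Var → Option (Formula Atom)
  finite_dom : {x | toFun x ≠ none}.Finite
  compat : ∀ x A B, toFun x = some A → toFun (CoInvol.co x) = some B → B = A.orth

/-- `Φ'` extends `Φ`. -/
def TypingContext.Extends {Var : Type u} {Atom : Type v} [CoInvol Var] [CoInvol Atom]
    (Φ' Φ : TypingContext Var Atom) : Prop :=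
  ∀ x A, Φ.toFun x = some A → Φ'.toFun x = some A

/-! ### Raw syntax

The constructors, the trees and the nets are mutually recursive, since a promotion box `prom n P` is
a constructor of arity `n` that is labelled by a formal linear combination `P` of nets.  A formal
linear combination is written as a list of pairs (coefficient, net); lists that denote the same
element of the free module are identified below, together with nets that differ only by
α-conversion or by the presentation of their cuts. -/

mutual

/-- Tree constructors. -/
inductive Con (k : Type u) (Var : Type v) : Type (max u v)
  | tens : Con k Var
  | par : Con k Var
  | weak : Con k Var
  | coweak : Con k Var
  | der : Con k Var
  | coder : Con k Var
  | contr : Con k Var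
  | cocontr : Con k Var
  | prom (n : ℕ) (P : List (k × Net k Var)) : Con k Var

/-- Proof trees. -/
inductive Tree (k : Type u) (Var : Type v) : Type (max u v)
  | var (x : Var) : Tree k Var
  | node (φ : Con k Var) (ts : List (Tree k Var)) : Tree k Var

/-- Nets: a list of trees and a list of cuts. -/
inductive Net (k : Type u) (Var : Type v) : Type (max u v)
  | mk (trees : List (Tree k Var)) (cuts : List (Tree k Var × Tree k Var)) : Net k Var

end

/-- A cut `⟨t | t'⟩`. -/
abbrev Cut (k : Type u) (Var : Type v) := Tree k Var × Tree k Var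

/-- A formal linear combination of nets. -/
abbrev FSum (k : Type u) (Var : Type v) := List (k × Net k Var)

section Syntax_basics

variable {k : Type u} {Var : Type v}

/-- The arity of a constructor. -/
def Con.arity : Con k Var → ℕ
  | .tens => 2
  | .par => 2
  | .weak => 0
  | .coweak => 0
  | .der => 1
  | .coder => 1
  | .contr => 2
  | .cocontr => 2
  | .prom n _ => n

def Net.trees : Net k Var → List (Tree k Var)
  | .mk ts _ => ts

def Net.cuts : Net k Var → List (Cut k Var)
  | .mk _ cs => cs

/-- The width of a net is the number of its trees. -/
def Net.width (p : Net k Var) : ℕ := p.trees.length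

abbrev Tree.tens (s t : Tree k Var) : Tree k Var := .node .tens [s, t]
abbrev Tree.par (s t : Tree k Var) : Tree k Var := .node .par [s, t]
abbrev Tree.weak : Tree k Var := .node .weak []
abbrev Tree.coweak : Tree k Var := .node .coweak []
abbrev Tree.der (s : Tree k Var) : Tree k Var := .node .der [s]
abbrev Tree.coder (s : Tree k Var) : Tree k Var := .node .coder [s]
abbrev Tree.contr (s t : Tree k Var) : Tree k Var := .node .contr [s, t]
abbrev Tree.cocontr (s t : Tree k Var) : Tree k Var := .node .cocontr [s, t]
/-- The promotion box `P^{!n}(t₁, …, tₙ)`. -/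
abbrev Tree.prom (n : ℕ) (P : FSum k Var) (ts : List (Tree k Var)) : Tree k Var :=
  .node (.prom n P) ts

mutual

/-- The list of the occurrences of variables in a tree.  The content of a promotion box belongs to
the constructor, so it does not contribute. -/
def Tree.vars : Tree k Var → List Var
  | .var x => [x]
  | .node _ ts => Tree.varsList ts

def Tree.varsList : List (Tree k Var) → List Var
  | [] => []
  | t :: ts => Tree.vars t ++ Tree.varsList ts

end

mutual

/-- Replace each variable `x` of a tree by the tree `f x` (not inside boxes). -/
def Tree.bind (f : Var → Tree k Var) : Tree k Var → Tree k Var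
  | .var x => f x
  | .node φ ts => .node φ (Tree.bindList f ts)

def Tree.bindList (f : Var → Tree k Var) : List (Tree k Var) → List (Tree k Var)
  | [] => []
  | t :: ts => Tree.bind f t :: Tree.bindList f ts

end

/-- The list of the occurrences of variables in a net. -/
def Net.vars (p : Net k Var) : List Var :=
  p.trees.flatMap Tree.vars ++ p.cuts.flatMap (fun c => c.1.vars ++ c.2.vars)

def Net.bind (f : Var → Tree k Var) (p : Net k Var) : Net k Var :=
  .mk (p.trees.map (Tree.bind f)) (p.cuts.map (fun c => (c.1.bind f, c.2.bind f)))

/-- Renaming of the variables of a net along `σ`. -/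
def Net.rename (σ : Var → Var) (p : Net k Var) : Net k Var := p.bind (fun x => .var (σ x))

open Classical in
/-- `p.subst y s` is `p[s / y]`. -/
noncomputable def Net.subst (y : Var) (s : Tree k Var) (p : Net k Var) : Net k Var :=
  p.bind (fun z => if z = y then s else .var z)

end Syntax_basics

/-! ### Simple proof-structures -/

section Simple

variable {k : Type u} {Var : Type v}

mutual

/-- The label of a promotion box of arity `n` is a linear combination of simple proof-structures of
width `n + 1`. -/
inductive Con.IsCon : Con k Var → Prop
  | mk (φ : Con k Var)
      (simple : ∀ n P, φ = .prom n P → ∀ a ∈ P, Net.IsSimple a.2)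
      (width : ∀ n P, φ = .prom n P → ∀ a ∈ P, a.2.width = n + 1) : Con.IsCon φ

/-- Arities are respected, and the subtrees of a node have pairwise disjoint sets of variables:
no variable occurs twice. -/
inductive Tree.IsTree : Tree k Var → Prop
  | var (x : Var) : Tree.IsTree (.var x)
  | node (φ : Con k Var) (ts : List (Tree k Var)) (con : Con.IsCon φ)
      (arity : ts.length = φ.arity) (sub : ∀ t ∈ ts, Tree.IsTree t)
      (linear : (Tree.node φ ts).vars.Nodup) : Tree.IsTree (.node φ ts)

/-- Simple proof-structures: the trees and the cuts (and the two sides of each cut) have pairwise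
disjoint sets of variables. -/
inductive Net.IsSimple : Net k Var → Prop
  | mk (ts : List (Tree k Var)) (cs : List (Cut k Var))
      (trees : ∀ t ∈ ts, Tree.IsTree t)
      (left : ∀ c ∈ cs, Tree.IsTree c.1) (right : ∀ c ∈ cs, Tree.IsTree c.2)
      (linear : (Net.mk ts cs).vars.Nodup) : Net.IsSimple (.mk ts cs)

end

end Simple

/-! ### Identifications -/

section Equivalence

variable {k : Type u} {Var : Type v} [CommSemiring k] [CoInvol Var]

mutual

/-- Change of the label of one promotion box of a tree. -/
inductive TreeStep : Tree k Var → Tree k Var → Prop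
  | box (n : ℕ) (P Q : FSum k Var) (ts : List (Tree k Var)) :
      SumEq P Q → TreeStep (.prom n P ts) (.prom n Q ts)
  | sub (φ : Con k Var) (us vs : List (Tree k Var)) (t t' : Tree k Var) :
      TreeStep t t' → TreeStep (.node φ (us ++ t :: vs)) (.node φ (us ++ t' :: vs))

/-- Identification of nets: cuts are unordered pairs, the order of the cuts is irrelevant, and bound
variables (those `x` such that `x` and its covariable both occur) can be renamed. -/
inductive NetEq : Net k Var → Net k Var → Prop
  | refl (p) : NetEq p p
  | symm (p q) : NetEq p q → NetEq q p
  | trans (p q r) : NetEq p q → NetEq q r → NetEq p r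
  | alpha (p : Net k Var) (σ : Equiv.Perm Var)
      (hσ : ∀ x, σ (CoInvol.co x) = CoInvol.co (σ x))
      (hfree : ∀ x ∈ p.vars, CoInvol.co x ∉ p.vars → σ x = x) : NetEq p (p.rename σ)
  | perm (ts : List (Tree k Var)) (cs ds : List (Cut k Var)) :
      cs.Perm ds → NetEq (.mk ts cs) (.mk ts ds)
  | swap (ts : List (Tree k Var)) (t t' : Tree k Var) (cs : List (Cut k Var)) :
      NetEq (.mk ts ((t, t') :: cs)) (.mk ts ((t', t) :: cs))
  | tree (us vs : List (Tree k Var)) (t t' : Tree k Var) (cs : List (Cut k Var)) :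
      TreeStep t t' → NetEq (.mk (us ++ t :: vs) cs) (.mk (us ++ t' :: vs) cs)
  | cut (ts : List (Tree k Var)) (t t' u : Tree k Var) (cs : List (Cut k Var)) :
      TreeStep t t' → NetEq (.mk ts ((t, u) :: cs)) (.mk ts ((t', u) :: cs))

/-- Equality of the linear combinations denoted by two formal sums. -/
inductive SumEq : FSum k Var → FSum k Var → Prop
  | refl (P) : SumEq P P
  | symm (P Q) : SumEq P Q → SumEq Q P
  | trans (P Q R) : SumEq P Q → SumEq Q R → SumEq P R
  | perm (P Q : FSum k Var) : P.Perm Q → SumEq P Q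
  | cons (a : k × Net k Var) (P Q : FSum k Var) : SumEq P Q → SumEq (a :: P) (a :: Q)
  | net (μ : k) (p q : Net k Var) (P : FSum k Var) :
      NetEq p q → SumEq ((μ, p) :: P) ((μ, q) :: P)
  | add (μ ν : k) (p : Net k Var) (P : FSum k Var) :
      SumEq ((μ, p) :: (ν, p) :: P) ((μ + ν, p) :: P)
  | zero (p : Net k Var) (P : FSum k Var) : SumEq ((0, p) :: P) P

end

variable (k Var)

/-- Representatives of simple proof-structures. -/
abbrev RawSimple := {p : Net k Var // p.IsSimple}

instance netSetoid : Setoid (RawSimple k Var) where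
  r p q := NetEq p.1 q.1
  iseqv := ⟨fun p => .refl p.1, fun h => .symm _ _ h, fun h h' => .trans _ _ _ h h'⟩

/-- Simple proof-structures, up to the identifications above. -/
abbrev Simple := Quotient (netSetoid k Var)

/-- Proof-structures: linear combinations of simple proof-structures. -/
abbrev ProofStructure := Simple k Var →₀ k

end Equivalence

/-! ### Logical judgments -/

section Logic

variable {k : Type u} {Var : Type v} {Atom : Type w} [CoInvol Var] [CoInvol Atom]

/-- The logical rules, on representatives.  The disjointness conditions say that the conclusion of a
rule with several premises is a simple proof-structure. -/
inductive Logic (Φ : TypingContext Var Atom) : Net k Var → List (Formula Atom) → Prop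
  | ax (x : Var) (A : Formula Atom) :
      Φ.toFun x = some A → Φ.toFun (CoInvol.co x) = some A.orth →
      Logic Φ (.mk [.var x, .var (CoInvol.co x)] []) [A, A.orth]
  | perm {n : ℕ} (t : Fin n → Tree k Var) (cs : List (Cut k Var)) (A : Fin n → Formula Atom)
      (σ : Equiv.Perm (Fin n)) :
      Logic Φ (.mk (List.ofFn t) cs) (List.ofFn A) →
      Logic Φ (.mk (List.ofFn fun i => t (σ i)) cs) (List.ofFn fun i => A (σ i))
  | cut (ss ts : List (Tree k Var)) (s t : Tree k Var) (cs ds : List (Cut k Var))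
      (Γ Δ : List (Formula Atom)) (A : Formula Atom) :
      Logic Φ (.mk (ss ++ [s]) cs) (Γ ++ [A]) →
      Logic Φ (.mk (ts ++ [t]) ds) (Δ ++ [A.orth]) →
      (Net.mk (ss ++ [s]) cs).vars.Disjoint (Net.mk (ts ++ [t]) ds).vars →
      Logic Φ (.mk (ss ++ ts) (cs ++ ds ++ [(s, t)])) (Γ ++ Δ)
  | par (ts : List (Tree k Var)) (s t : Tree k Var) (cs : List (Cut k Var))
      (Γ : List (Formula Atom)) (A B : Formula Atom) :
      Logic Φ (.mk (ts ++ [s, t]) cs) (Γ ++ [A, B]) →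
      Logic Φ (.mk (ts ++ [.par s t]) cs) (Γ ++ [.par A B])
  | tens (ss ts : List (Tree k Var)) (s t : Tree k Var) (cs ds : List (Cut k Var))
      (Γ Δ : List (Formula Atom)) (A B : Formula Atom) :
      Logic Φ (.mk (ss ++ [s]) cs) (Γ ++ [A]) →
      Logic Φ (.mk (ts ++ [t]) ds) (Δ ++ [B]) →
      (Net.mk (ss ++ [s]) cs).vars.Disjoint (Net.mk (ts ++ [t]) ds).vars →
      Logic Φ (.mk (ss ++ ts ++ [.tens s t]) (cs ++ ds)) (Γ ++ Δ ++ [.tens A B])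
  | mix (ss ts : List (Tree k Var)) (cs ds : List (Cut k Var)) (Γ Δ : List (Formula Atom)) :
      Logic Φ (.mk ss cs) Γ → Logic Φ (.mk ts ds) Δ →
      (Net.mk ss cs).vars.Disjoint (Net.mk ts ds).vars →
      Logic Φ (.mk (ss ++ ts) (cs ++ ds)) (Γ ++ Δ)
  | weak (ss : List (Tree k Var)) (cs : List (Cut k Var)) (Γ : List (Formula Atom))
      (A : Formula Atom) :
      Logic Φ (.mk ss cs) Γ → Logic Φ (.mk (ss ++ [.weak]) cs) (Γ ++ [.quest A])
  | coweak (A : Formula Atom) : Logic Φ (.mk [.coweak] []) [.bang A]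
  | der (ss : List (Tree k Var)) (s : Tree k Var) (cs : List (Cut k Var))
      (Γ : List (Formula Atom)) (A : Formula Atom) :
      Logic Φ (.mk (ss ++ [s]) cs) (Γ ++ [A]) →
      Logic Φ (.mk (ss ++ [.der s]) cs) (Γ ++ [.quest A])
  | coder (ss : List (Tree k Var)) (s : Tree k Var) (cs : List (Cut k Var))
      (Γ : List (Formula Atom)) (A : Formula Atom) :
      Logic Φ (.mk (ss ++ [s]) cs) (Γ ++ [A]) →
      Logic Φ (.mk (ss ++ [.coder s]) cs) (Γ ++ [.bang A])
  | contr (ss : List (Tree k Var)) (s₁ s₂ : Tree k Var) (cs : List (Cut k Var))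
      (Γ : List (Formula Atom)) (A : Formula Atom) :
      Logic Φ (.mk (ss ++ [s₁, s₂]) cs) (Γ ++ [.quest A, .quest A]) →
      Logic Φ (.mk (ss ++ [.contr s₁ s₂]) cs) (Γ ++ [.quest A])
  | cocontr (ss ts : List (Tree k Var)) (s t : Tree k Var) (cs ds : List (Cut k Var))
      (Γ Δ : List (Formula Atom)) (A : Formula Atom) :
      Logic Φ (.mk (ss ++ [s]) cs) (Γ ++ [.bang A]) →
      Logic Φ (.mk (ts ++ [t]) ds) (Δ ++ [.bang A]) →
      (Net.mk (ss ++ [s]) cs).vars.Disjoint (Net.mk (ts ++ [t]) ds).vars →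
      Logic Φ (.mk (ss ++ ts ++ [.cocontr s t]) (cs ++ ds)) (Γ ++ Δ ++ [.bang A])
  | prom {n : ℕ} (P : FSum k Var) (ts : Fin n → List (Tree k Var)) (t : Fin n → Tree k Var)
      (cs : Fin n → List (Cut k Var)) (Γ : Fin n → List (Formula Atom)) (A : Fin n → Formula Atom)
      (B : Formula Atom) :
      (∀ a ∈ P, Logic Φ a.2 (List.ofFn (fun i => (A i).orth.quest) ++ [B])) →
      (∀ i, Logic Φ (.mk (ts i ++ [t i]) (cs i)) (Γ i ++ [.bang (A i)])) →
      (∀ i j, i ≠ j →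
        (Net.mk (ts i ++ [t i]) (cs i)).vars.Disjoint (Net.mk (ts j ++ [t j]) (cs j)).vars) →
      Logic Φ (.mk ((List.ofFn ts).flatten ++ [.prom n P (List.ofFn t)]) (List.ofFn cs).flatten)
        ((List.ofFn Γ).flatten ++ [.bang B])

variable [CommSemiring k]

/-- The simple proof-structure `p` is a proof-net of `Γ` in the context `Φ`. -/
def IsProofNet (Φ : TypingContext Var Atom) (p : Simple k Var) (Γ : List (Formula Atom)) : Prop :=
  ∃ q : RawSimple k Var, (Quotient.mk _ q : Simple k Var) = p ∧ Logic Φ q.1 Γ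

/-- The proof-structure `P` is a proof-net of `Γ` in the context `Φ` (the sum rule). -/
def IsProofNetSum (Φ : TypingContext Var Atom) (P : ProofStructure k Var)
    (Γ : List (Formula Atom)) : Prop :=
  ∃ (n : ℕ) (μ : Fin n → k) (p : Fin n → Simple k Var),
    (∀ i, IsProofNet Φ (p i) Γ) ∧ P = ∑ i, Finsupp.single (p i) (μ i)

end Logic

/-! ### Reduction -/

section Reduction

variable {k : Type u} {Var : Type v} [CommSemiring k] [CoInvol Var]

/-- A simple proof-structure `(before, port, after, main ; cuts)` inside a box, with one of its
auxiliary ports singled out. -/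
structure Ported (k : Type u) (Var : Type v) where
  before : List (Tree k Var)
  port : Tree k Var
  after : List (Tree k Var)
  main : Tree k Var
  cuts : List (Cut k Var)

def Ported.net (e : Ported k Var) : Net k Var :=
  .mk (e.before ++ e.port :: e.after ++ [e.main]) e.cuts

/-- The covariable of `x`, as a tree. -/
abbrev Tree.covar (x : Var) : Tree k Var := .var (CoInvol.co x)

/-- The basic cut reductions.  The freshness of the introduced variables is not repeated in each
rule: it is the requirement, made in `Reduces`, that source and target are simple
proof-structures, in which no variable occurs twice. -/
inductive CutRed : Cut k Var → FSum k Var → Prop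
  | par_tens (s₁ s₂ t₁ t₂ : Tree k Var) :
      CutRed (.par s₁ s₂, .tens t₁ t₂) [(1, .mk [] [(s₁, t₁), (s₂, t₂)])]
  | weak_coweak : CutRed (.weak, .coweak) [(1, .mk [] [])]
  | der_coweak (s : Tree k Var) : CutRed (.der s, .coweak) []
  | weak_coder (t : Tree k Var) : CutRed (.weak, .coder t) []
  | contr_coweak (s₁ s₂ : Tree k Var) :
      CutRed (.contr s₁ s₂, .coweak) [(1, .mk [] [(s₁, .coweak), (s₂, .coweak)])]
  | weak_cocontr (t₁ t₂ : Tree k Var) :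
      CutRed (.weak, .cocontr t₁ t₂) [(1, .mk [] [(.weak, t₁), (.weak, t₂)])]
  | der_coder (s t : Tree k Var) : CutRed (.der s, .coder t) [(1, .mk [] [(s, t)])]
  | contr_coder (s₁ s₂ t : Tree k Var) :
      CutRed (.contr s₁ s₂, .coder t)
        [(1, .mk [] [(s₁, .coder t), (s₂, .coweak)]), (1, .mk [] [(s₁, .coweak), (s₂, .coder t)])]
  | der_cocontr (s t₁ t₂ : Tree k Var) :
      CutRed (.der s, .cocontr t₁ t₂)
        [(1, .mk [] [(.der s, t₁), (.weak, t₂)]), (1, .mk [] [(.weak, t₁), (.der s, t₂)])]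
  | contr_cocontr (s₁ s₂ t₁ t₂ : Tree k Var) (x₁₁ x₁₂ x₂₁ x₂₂ : Var) :
      CutRed (.contr s₁ s₂, .cocontr t₁ t₂)
        [(1, .mk [] [(s₁, .cocontr (.var x₁₁) (.var x₁₂)), (s₂, .cocontr (.var x₂₁) (.var x₂₂)),
          (.contr (.covar x₁₁) (.covar x₂₁), t₁), (.contr (.covar x₁₂) (.covar x₂₂), t₂)])]
  | prom_weak (P : FSum k Var) (ts : List (Tree k Var)) :
      CutRed (.prom ts.length P ts, .weak) [(1, .mk [] (ts.map fun t => (t, .weak)))]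
  /- `P` is the sum of the `μ • (ss, s' ; cs)`, for `(μ, ss, s', cs)` in the list `L`. -/
  | prom_der (L : List (k × List (Tree k Var) × Tree k Var × List (Cut k Var)))
      (ts : List (Tree k Var)) (s : Tree k Var) (hL : ∀ e ∈ L, e.2.1.length = ts.length) :
      CutRed
        (.prom ts.length (L.map fun (μ, ss, s', cs) => (μ, .mk (ss ++ [s']) cs)) ts, .der s)
        (L.map fun (μ, ss, s', cs) => (μ, .mk [] (cs ++ List.zip ss ts ++ [(s', s)])))
  | prom_contr (P : FSum k Var) (ts : List (Tree k Var)) (s₁ s₂ : Tree k Var) (xs ys : List Var)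
      (hx : xs.length = ts.length) (hy : ys.length = ts.length) :
      CutRed (.prom ts.length P ts, .contr s₁ s₂)
        [(1, .mk [] ((.prom ts.length P (xs.map .var), s₁) :: (.prom ts.length P (ys.map .var), s₂) ::
          List.zip ts (List.zipWith (fun x y => .contr (.covar x) (.covar y)) xs ys)))]

/-- Cut reduction of nets. -/
inductive NetRedCut : Net k Var → FSum k Var → Prop
  | context (ss : List (Tree k Var)) (c : Cut k Var) (bs : List (Cut k Var)) (P : FSum k Var) :
      CutRed c P →
      NetRedCut (.mk ss (c :: bs)) (P.map fun a => (a.1, .mk (ss ++ a.2.trees) (a.2.cuts ++ bs)))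
  | var_cut (ts : List (Tree k Var)) (x : Var) (s : Tree k Var) (cs : List (Cut k Var)) :
      CoInvol.co x ∉ s.vars →
      NetRedCut (.mk ts ((.var x, s) :: cs)) [(1, (Net.mk ts cs).subst (CoInvol.co x) s)]

/-- Commutative reduction `t ⇝ P` of trees, closed under constructors.  Since `P` has width one, it
is given as a list of triples: coefficient, tree, cuts.  In the first four rules the content of the
outer box is the sum of the `μ • e.net`, for `(μ, e)` in the list `L`. -/
inductive TreeRedCom : Tree k Var → List (k × Tree k Var × List (Cut k Var)) → Prop
  | prom_prom (L : List (k × Ported k Var)) (Q : FSum k Var) (ls us rs : List (Tree k Var))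
      (xs : List Var) (hx : xs.length = us.length)
      (hl : ∀ a ∈ L, a.2.before.length = ls.length)
      (hr : ∀ a ∈ L, a.2.after.length = rs.length) :
      TreeRedCom
        (.prom (ls.length + rs.length + 1) (L.map fun (μ, e) => (μ, e.net))
          (ls ++ .prom us.length Q us :: rs))
        [(1, .prom (ls.length + us.length + rs.length)
          (L.map fun (μ, e) => (μ, .mk (e.before ++ xs.map .covar ++ e.after ++ [e.main])
            (e.cuts ++ [(e.port, .prom us.length Q (xs.map .var))])))
          (ls ++ us ++ rs), [])]
  | prom_coweak (L : List (k × Ported k Var)) (ls rs : List (Tree k Var))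
      (hl : ∀ a ∈ L, a.2.before.length = ls.length)
      (hr : ∀ a ∈ L, a.2.after.length = rs.length) :
      TreeRedCom
        (.prom (ls.length + rs.length + 1) (L.map fun (μ, e) => (μ, e.net)) (ls ++ .coweak :: rs))
        [(1, .prom (ls.length + rs.length)
          (L.map fun (μ, e) => (μ, .mk (e.before ++ e.after ++ [e.main])
            (e.cuts ++ [(e.port, .coweak)])))
          (ls ++ rs), [])]
  | prom_cocontr (L : List (k × Ported k Var)) (ls rs : List (Tree k Var)) (u₁ u₂ : Tree k Var)
      (x y : Var)
      (hl : ∀ a ∈ L, a.2.before.length = ls.length)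
      (hr : ∀ a ∈ L, a.2.after.length = rs.length) :
      TreeRedCom
        (.prom (ls.length + rs.length + 1) (L.map fun (μ, e) => (μ, e.net))
          (ls ++ .cocontr u₁ u₂ :: rs))
        [(1, .prom (ls.length + rs.length + 2)
          (L.map fun (μ, e) => (μ, .mk (e.before ++ [.covar x, .covar y] ++ e.after ++ [e.main])
            (e.cuts ++ [(e.port, .cocontr (.var x) (.var y))])))
          (ls ++ [u₁, u₂] ++ rs), [])]
  | prom_coder (L : List (k × Ported k Var)) (ls rs : List (Tree k Var)) (u : Tree k Var)
      (xs ys : List Var) (hx : xs.length = ls.length) (hy : ys.length = rs.length)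
      (hl : ∀ a ∈ L, a.2.before.length = ls.length)
      (hr : ∀ a ∈ L, a.2.after.length = rs.length) :
      TreeRedCom
        (.prom (ls.length + rs.length + 1) (L.map fun (μ, e) => (μ, e.net)) (ls ++ .coder u :: rs))
        (L.map fun (μ, e) =>
          (μ,
            .cocontr
              (.prom (ls.length + rs.length + 1) (L.map fun (ν, e') => (ν, e'.net))
                (xs.map .var ++ .coweak :: ys.map .var))
              (.coder e.main),
            e.cuts ++ [(e.port, .coder u)]
              ++ List.zip (List.zipWith (fun x s => .contr (.covar x) s) xs e.before) ls
              ++ List.zip (List.zipWith (fun x s => .contr (.covar x) s) ys e.after) rs))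
  | node (φ : Con k Var) (us vs : List (Tree k Var)) (t : Tree k Var)
      (P : List (k × Tree k Var × List (Cut k Var))) :
      TreeRedCom t P →
      TreeRedCom (.node φ (us ++ t :: vs))
        (P.map fun (μ, w, cs) => (μ, .node φ (us ++ w :: vs), cs))

/-- Commutative reduction of nets. -/
inductive NetRedCom : Net k Var → FSum k Var → Prop
  | tree (us vs : List (Tree k Var)) (t : Tree k Var) (cs : List (Cut k Var))
      (P : List (k × Tree k Var × List (Cut k Var))) :
      TreeRedCom t P →
      NetRedCom (.mk (us ++ t :: vs) cs)
        (P.map fun (μ, w, ds) => (μ, .mk (us ++ w :: vs) (cs ++ ds)))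
  | cut (ts : List (Tree k Var)) (t t' : Tree k Var) (cs : List (Cut k Var))
      (P : List (k × Tree k Var × List (Cut k Var))) :
      TreeRedCom t P →
      NetRedCom (.mk ts ((t, t') :: cs))
        (P.map fun (μ, w, ds) => (μ, .mk ts (cs ++ ds ++ [(w, t')])))

/-- The proof-structure denoted by a list of coefficients and representatives. -/
noncomputable def denote (L : List (k × RawSimple k Var)) : ProofStructure k Var :=
  (L.map fun a => Finsupp.single (Quotient.mk _ a.2 : Simple k Var) a.1).sum

/-- One-step reduction (cut or commutative) from a simple proof-structure to a proof-structure: some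
representative of the source reduces to a formal sum of simple proof-structures that denotes the
target. -/
def Reduces (p : Simple k Var) (P : ProofStructure k Var) : Prop :=
  ∃ (q : RawSimple k Var) (L : List (k × RawSimple k Var)),
    (Quotient.mk _ q : Simple k Var) = p ∧ denote L = P ∧
    (NetRedCut q.1 (L.map fun a => (a.1, a.2.1)) ∨ NetRedCom q.1 (L.map fun a => (a.1, a.2.1)))

end Reduction

end DiLL

namespace DiLL

universe u v w

-- Variables, substitution and renaming in trees, cuts and nets.

section SyntaxLemmas

variable {k : Type u} {Var : Type v}

-- Derivations in `Logic` are awkward to transform: they order the trees, they live in a typing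
-- context that a reduction has to extend, and every rule with several premises has a disjointness
-- condition. The system `Seq` drops all three: it derives multisets of typed trees and of cuts, and
-- its axioms are restricted only by a predicate `T`. `Net.HasType` is derivability when `T` is
-- always true.
--
-- `Logic.hasType` passes from `Logic` to `Seq` by forgetting. Conversely, by
-- `Net.HasType.isNetClass`, a typable net in which no variable occurs twice is derivable, up to
-- identification, in an extension of any given context. Axioms introduce a variable together with
-- its covariable, so every variable of a typable net is bound. All of them can therefore be renamed
-- off the domain of the context, where each axiom can receive its type. Linearity gives back the
-- disjointness conditions, and reducts are linear because `Reduces` asks that they be simple.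
--
-- It remains to see that reduction preserves `Net.HasType`, for every class that has a nonzero
-- coefficient in the reduct. The rule that introduces a given tree or cut may sit anywhere in a
-- derivation. `Seq.exists_rule` and `Seq.exists_cut` isolate it, and `Frame` records that the rest
-- of the derivation can be replayed after the isolated part has changed. Most reductions then
-- amount to a short local derivation. A cut on a variable is different: a derivation is substituted
-- for an axiom, which uses linearity (`Seq.subst_cut`).
--
-- The delicate point is the content of boxes. It is a formal sum taken up to equality in the free
-- module, so it may contain summands that cancel or have coefficient zero, and these need not be
-- typable. A box is therefore typed by `IsNetSum`, which sees only the classes with nonzero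
-- coefficient. When contents are modified summand by summand, a class with nonzero coefficient in
-- the result must come from such a class in the content. By `FSum.exists_of_value_map_ne_zero` this
-- holds as soon as identified contents have identified results. `NetEq.of_context` provides that:
-- the renaming between two contents, restricted to their bound variables and extended by the
-- identity to the surrounding net, is injective because both results are linear.

theorem Tree.varsList_eq (ts : List (Tree k Var)) : Tree.varsList ts = ts.flatMap Tree.vars := by
  induction ts with
  | nil => simp [Tree.varsList]
  | cons t ts ih => simp [Tree.varsList, ih]

theorem Tree.bindList_eq (f : Var → Tree k Var) (ts : List (Tree k Var)) :
    Tree.bindList f ts = ts.map (Tree.bind f) := by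
  induction ts with
  | nil => simp [Tree.bindList]
  | cons t ts ih => simp [Tree.bindList, ih]

@[simp] theorem Tree.vars_var (x : Var) : (Tree.var x : Tree k Var).vars = [x] := by
  simp [Tree.vars]

@[simp] theorem Tree.vars_node (φ : Con k Var) (ts : List (Tree k Var)) :
    (Tree.node φ ts).vars = ts.flatMap Tree.vars := by
  simp [Tree.vars, Tree.varsList_eq]

@[simp] theorem Tree.bind_var (f : Var → Tree k Var) (x : Var) : (Tree.var x).bind f = f x := by
  simp [Tree.bind]

@[simp] theorem Tree.bind_node (f : Var → Tree k Var) (φ : Con k Var) (ts : List (Tree k Var)) :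
    (Tree.node φ ts).bind f = .node φ (ts.map (Tree.bind f)) := by
  simp [Tree.bind, Tree.bindList_eq]

/-- Box contents are part of the constructor, and substitution and the list of variables never enter
them. Induction over subtrees alone is therefore enough, instead of the recursor of the whole mutual
syntax. -/
theorem Tree.induct {p : Tree k Var → Prop} (var : ∀ x, p (.var x))
    (node : ∀ φ ts, (∀ t ∈ ts, p t) → p (.node φ ts)) : ∀ t, p t
  | .var x => var x
  | .node φ ts => node φ ts fun t _ => Tree.induct var node t

theorem Tree.bind_congr {f g : Var → Tree k Var} :
    ∀ t : Tree k Var, (∀ x ∈ t.vars, f x = g x) → t.bind f = t.bind g := by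
  refine Tree.induct (fun x h => by simpa using h) fun φ ts ih h => ?_
  simp only [Tree.bind_node, Tree.node.injEq, true_and]
  refine List.map_congr_left fun t ht => ih t ht fun x hx => h x ?_
  simpa using ⟨t, ht, hx⟩

theorem Tree.bind_id : ∀ t : Tree k Var, t.bind .var = t := by
  refine Tree.induct (fun x => by simp) fun φ ts ih => ?_
  simp only [Tree.bind_node, Tree.node.injEq, true_and]
  exact (List.map_congr_left ih).trans (by simp)

theorem Tree.bind_eq_self {f : Var → Tree k Var} (t : Tree k Var)
    (h : ∀ x ∈ t.vars, f x = .var x) : t.bind f = t :=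
  (Tree.bind_congr t h).trans t.bind_id

theorem Tree.bind_bind (f g : Var → Tree k Var) :
    ∀ t : Tree k Var, (t.bind f).bind g = t.bind fun x => (f x).bind g := by
  refine Tree.induct (fun x => by simp) fun φ ts ih => ?_
  simp only [Tree.bind_node, List.map_map, Tree.node.injEq, true_and]
  exact List.map_congr_left ih

/-- Renaming of the variables of a tree. -/
def Tree.rename (σ : Var → Var) (t : Tree k Var) : Tree k Var := t.bind fun x => .var (σ x)

@[simp] theorem Tree.rename_var (σ : Var → Var) (x : Var) :
    (Tree.var x : Tree k Var).rename σ = .var (σ x) := by simp [Tree.rename]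

@[simp] theorem Tree.rename_node (σ : Var → Var) (φ : Con k Var) (ts : List (Tree k Var)) :
    (Tree.node φ ts).rename σ = .node φ (ts.map (Tree.rename σ)) := by
  simp [Tree.rename]

theorem Tree.vars_rename (σ : Var → Var) : ∀ t : Tree k Var, (t.rename σ).vars = t.vars.map σ := by
  refine Tree.induct (fun x => by simp) fun φ ts ih => ?_
  simp only [Tree.rename_node, Tree.vars_node, List.flatMap_map, List.map_flatMap]
  exact List.flatMap_congr ih

theorem Tree.rename_rename (σ τ : Var → Var) (t : Tree k Var) :
    (t.rename σ).rename τ = t.rename (τ ∘ σ) := by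
  simp [Tree.rename, Tree.bind_bind]

theorem Tree.rename_eq_self {σ : Var → Var} (t : Tree k Var) (h : ∀ x ∈ t.vars, σ x = x) :
    t.rename σ = t :=
  Tree.bind_eq_self t fun x hx => by rw [h x hx]

theorem Tree.rename_congr {σ τ : Var → Var} (t : Tree k Var) (h : ∀ x ∈ t.vars, σ x = τ x) :
    t.rename σ = t.rename τ :=
  Tree.bind_congr t fun x hx => by rw [h x hx]

theorem Tree.map_rename_eq_self {σ : Var → Var} (ts : List (Tree k Var))
    (h : ∀ x ∈ ts.flatMap Tree.vars, σ x = x) : ts.map (Tree.rename σ) = ts := by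
  refine (List.map_congr_left fun t ht => ?_).trans (List.map_id _)
  exact t.rename_eq_self fun x hx => h x (List.mem_flatMap.2 ⟨t, ht, hx⟩)

/-- Renaming of the variables of a cut. -/
def Cut.rename (σ : Var → Var) (c : Cut k Var) : Cut k Var := (c.1.rename σ, c.2.rename σ)

/-- The list of the occurrences of variables in a cut. -/
def Cut.vars (c : Cut k Var) : List Var := c.1.vars ++ c.2.vars

theorem Cut.rename_rename (σ τ : Var → Var) (c : Cut k Var) :
    Cut.rename τ (Cut.rename σ c) = Cut.rename (τ ∘ σ) c := by
  simp [Cut.rename, Tree.rename_rename]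

theorem Cut.vars_rename (σ : Var → Var) (c : Cut k Var) :
    Cut.vars (Cut.rename σ c) = (Cut.vars c).map σ := by
  simp [Cut.rename, Cut.vars, Tree.vars_rename]

theorem Cut.rename_eq_self {σ : Var → Var} (c : Cut k Var) (h : ∀ x ∈ Cut.vars c, σ x = x) :
    Cut.rename σ c = c :=
  Prod.ext (Tree.rename_eq_self _ fun x hx => h x (by simp [Cut.vars, hx]))
    (Tree.rename_eq_self _ fun x hx => h x (by simp [Cut.vars, hx]))

theorem Cut.map_rename_eq_self {σ : Var → Var} (cs : List (Cut k Var))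
    (h : ∀ x ∈ cs.flatMap Cut.vars, σ x = x) : cs.map (Cut.rename σ) = cs := by
  refine (List.map_congr_left fun t ht => ?_).trans (List.map_id _)
  exact Cut.rename_eq_self t fun x hx => h x (List.mem_flatMap.2 ⟨t, ht, hx⟩)

theorem Net.vars_mk (ts : List (Tree k Var)) (cs : List (Cut k Var)) :
    (Net.mk ts cs).vars = ts.flatMap Tree.vars ++ cs.flatMap Cut.vars := rfl

theorem Net.rename_mk (σ : Var → Var) (ts : List (Tree k Var)) (cs : List (Cut k Var)) :
    (Net.mk ts cs).rename σ = .mk (ts.map (Tree.rename σ)) (cs.map (Cut.rename σ)) := rfl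

@[simp] theorem Net.trees_rename (σ : Var → Var) (p : Net k Var) :
    (p.rename σ).trees = p.trees.map (Tree.rename σ) := rfl

@[simp] theorem Net.cuts_rename (σ : Var → Var) (p : Net k Var) :
    (p.rename σ).cuts = p.cuts.map (Cut.rename σ) := rfl

theorem Net.vars_rename (σ : Var → Var) (p : Net k Var) :
    (p.rename σ).vars = p.vars.map σ := by
  cases p with | mk ts cs =>
  simp only [Net.rename_mk, Net.vars_mk, List.map_append, List.flatMap_map, List.map_flatMap]
  exact congrArg₂ _ (List.flatMap_congr fun t _ => t.vars_rename σ)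
    (List.flatMap_congr fun c _ => Cut.vars_rename σ c)

theorem Net.rename_rename (σ τ : Var → Var) (p : Net k Var) :
    (p.rename σ).rename τ = p.rename (τ ∘ σ) := by
  cases p with | mk ts cs =>
  simp only [Net.rename_mk, List.map_map]
  congr 1
  · exact List.map_congr_left fun t _ => t.rename_rename σ τ
  · exact List.map_congr_left fun c _ => Cut.rename_rename σ τ c

theorem Net.rename_congr {σ τ : Var → Var} (p : Net k Var) (h : ∀ x ∈ p.vars, σ x = τ x) :
    p.rename σ = p.rename τ := by
  cases p with | mk ts cs =>
  simp only [Net.vars_mk, List.mem_append, List.mem_flatMap, Cut.vars] at h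
  simp only [Net.rename_mk]
  congr 1
  · exact List.map_congr_left fun t ht => t.rename_congr fun x hx => h x (.inl ⟨t, ht, hx⟩)
  · exact List.map_congr_left fun c hc => Prod.ext
      (c.1.rename_congr fun x hx => h x (.inr ⟨c, hc, .inl hx⟩))
      (c.2.rename_congr fun x hx => h x (.inr ⟨c, hc, .inr hx⟩))

theorem Net.rename_id (p : Net k Var) : p.rename id = p := by
  cases p with | mk ts cs =>
  rw [Net.rename_mk, Tree.map_rename_eq_self _ (by simp), Cut.map_rename_eq_self _ (by simp)]

theorem Net.IsSimple.nodup {p : Net k Var} (h : p.IsSimple) : p.vars.Nodup := by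
  cases h with | mk _ _ _ _ _ h => exact h

theorem Net.IsSimple.isTree {p : Net k Var} (h : p.IsSimple) {t : Tree k Var} (ht : t ∈ p.trees) :
    t.IsTree := by
  cases h with | mk _ _ h _ _ _ => exact h t ht

theorem Net.IsSimple.isTree_left {p : Net k Var} (h : p.IsSimple) {c : Cut k Var}
    (hc : c ∈ p.cuts) : c.1.IsTree := by
  cases h with | mk _ _ _ h _ _ => exact h c hc

/-- A commutative reduction builds new box contents. The freshness of the variables introduced there
is only known through the simplicity of the reduct, from which it is extracted here. -/
theorem Tree.IsTree.isSimple_of_prom {n : ℕ} {P : FSum k Var} {ts : List (Tree k Var)}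
    (h : (Tree.prom n P ts).IsTree) {a : k × Net k Var} (ha : a ∈ P) : a.2.IsSimple := by
  cases h with | node _ _ h => cases h with | mk _ h _ => exact h n P rfl a ha

theorem Tree.IsTree.sub_mem {φ : Con k Var} {ts : List (Tree k Var)}
    (h : (Tree.node φ ts).IsTree) {t : Tree k Var} (ht : t ∈ ts) : t.IsTree := by
  cases h with | node _ _ _ _ h => exact h t ht

end SyntaxLemmas

-- Renamings compatible with the involution.

section Involution

variable {α : Type u} [CoInvol α]

attribute [simp] CoInvol.co_co

theorem CoInvol.co_injective : Function.Injective (CoInvol.co : α → α) := fun x y h => by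
  rw [← CoInvol.co_co x, h, CoInvol.co_co]

@[simp] theorem CoInvol.co_inj {x y : α} : CoInvol.co x = CoInvol.co y ↔ x = y :=
  CoInvol.co_injective.eq_iff

theorem CoInvol.co_eq_comm {x y : α} : CoInvol.co x = y ↔ x = CoInvol.co y :=
  ⟨fun h => by rw [← h, CoInvol.co_co], fun h => by rw [h, CoInvol.co_co]⟩

@[simp] theorem Formula.orth_orth (A : Formula α) : A.orth.orth = A := by
  induction A <;> simp_all [Formula.orth]

/-- Permutations of the variables that are compatible with the involution. -/
def Compatible (σ : Equiv.Perm α) : Prop := ∀ x, σ (CoInvol.co x) = CoInvol.co (σ x)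

theorem Compatible.mul {σ τ : Equiv.Perm α} (hσ : Compatible σ) (hτ : Compatible τ) :
    Compatible (σ * τ) := fun x => by
  rw [Equiv.Perm.mul_apply, hτ, hσ, Equiv.Perm.mul_apply]

theorem Compatible.symm {σ : Equiv.Perm α} (hσ : Compatible σ) : Compatible σ.symm := fun x => by
  rw [Equiv.symm_apply_eq, hσ, Equiv.apply_symm_apply]

open Classical in
/-- A compatible transposition: it exchanges `a` and `b`, fixes everything but `a`, `b` and their
covariables. -/
theorem exists_compatible_swap (a b : α) : ∃ σ : Equiv.Perm α, Compatible σ ∧ σ a = b ∧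
    ∀ x, x ≠ a → x ≠ b → x ≠ CoInvol.co a → x ≠ CoInvol.co b → σ x = x := by
  -- In general the product of the transpositions of `a`, `b` and of their covariables works. When
  -- `b` is the covariable of `a` that product is the identity, and one transposition suffices.
  by_cases hab : b = CoInvol.co a
  · subst hab
    refine ⟨Equiv.swap a (CoInvol.co a), fun x => ?_, by simp, fun x h1 h2 _ _ => ?_⟩
    · by_cases h1 : x = a
      · subst h1; simp
      · by_cases h2 : x = CoInvol.co a
        · subst h2; simp
        · rw [Equiv.swap_apply_of_ne_of_ne h1 h2, Equiv.swap_apply_of_ne_of_ne]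
          · rwa [Ne, CoInvol.co_eq_comm]
          · rwa [Ne, CoInvol.co_inj]
    · exact Equiv.swap_apply_of_ne_of_ne h1 h2
  · have hba : a ≠ CoInvol.co b := fun h => hab (by rw [h, CoInvol.co_co])
    have ha := CoInvol.co_ne a
    have hb := CoInvol.co_ne b
    have key : ∀ x, x ≠ a → x ≠ b → x ≠ CoInvol.co a → x ≠ CoInvol.co b →
        (Equiv.swap a b * Equiv.swap (CoInvol.co a) (CoInvol.co b)) x = x := fun x h1 h2 h3 h4 => by
      rw [Equiv.Perm.mul_apply, Equiv.swap_apply_of_ne_of_ne h3 h4,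
        Equiv.swap_apply_of_ne_of_ne h1 h2]
    have va : (Equiv.swap a b * Equiv.swap (CoInvol.co a) (CoInvol.co b)) a = b := by
      rw [Equiv.Perm.mul_apply, Equiv.swap_apply_of_ne_of_ne ha.symm hba, Equiv.swap_apply_left]
    have vb : (Equiv.swap a b * Equiv.swap (CoInvol.co a) (CoInvol.co b)) b = a := by
      rw [Equiv.Perm.mul_apply, Equiv.swap_apply_of_ne_of_ne hab hb.symm, Equiv.swap_apply_right]
    have vca : (Equiv.swap a b * Equiv.swap (CoInvol.co a) (CoInvol.co b)) (CoInvol.co a) =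
        CoInvol.co b := by
      rw [Equiv.Perm.mul_apply, Equiv.swap_apply_left, Equiv.swap_apply_of_ne_of_ne hba.symm hb]
    have vcb : (Equiv.swap a b * Equiv.swap (CoInvol.co a) (CoInvol.co b)) (CoInvol.co b) =
        CoInvol.co a := by
      rw [Equiv.Perm.mul_apply, Equiv.swap_apply_right,
        Equiv.swap_apply_of_ne_of_ne ha (Ne.symm hab)]
    refine ⟨_, fun x => ?_, va, key⟩
    by_cases h1 : x = a
    · rw [h1, vca, va]
    by_cases h2 : x = b
    · rw [h2, vcb, vb]
    by_cases h3 : x = CoInvol.co a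
    · rw [h3, vca, CoInvol.co_co, CoInvol.co_co, va]
    by_cases h4 : x = CoInvol.co b
    · rw [h4, vcb, CoInvol.co_co, CoInvol.co_co, vb]
    rw [key x h1 h2 h3 h4, key _ (by rwa [Ne, CoInvol.co_eq_comm])
      (by rwa [Ne, CoInvol.co_eq_comm]) (by rwa [Ne, CoInvol.co_inj]) (by rwa [Ne, CoInvol.co_inj])]

/-- A finite injection that is compatible with the involution extends to a permutation. -/
theorem exists_compatible_extension (f : α → α) (hf : ∀ x, f (CoInvol.co x) = CoInvol.co (f x))
    (l : List α)
    (hinj : ∀ x ∈ l, ∀ y ∈ l, (f x = f y → x = y) ∧ (f x = CoInvol.co (f y) → x = CoInvol.co y)) :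
    ∃ σ : Equiv.Perm α, Compatible σ ∧ ∀ x ∈ l, σ x = f x := by
  induction l with
  | nil => exact ⟨1, fun x => rfl, by simp⟩
  | cons y l ih =>
    obtain ⟨τ, hτ, hl⟩ := ih fun x hx z hz =>
      hinj x (List.mem_cons_of_mem _ hx) z (List.mem_cons_of_mem _ hz)
    by_cases hy : y ∈ l
    · refine ⟨τ, hτ, fun x hx => ?_⟩
      rcases List.mem_cons.1 hx with rfl | hx
      exacts [hl _ hy, hl _ hx]
    -- The value at `y` is then already forced by compatibility.
    by_cases hy' : CoInvol.co y ∈ l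
    · refine ⟨τ, hτ, fun x hx => ?_⟩
      rcases List.mem_cons.1 hx with rfl | hx
      · rw [← CoInvol.co_inj, ← hτ, hl _ hy', hf]
      · exact hl _ hx
    -- The image of `y` is corrected after the fact. The images already fixed differ from `τ y` and
    -- `f y` and from their covariables, so `ρ` leaves them in place.
    obtain ⟨ρ, hρ, hρy, hfix⟩ := exists_compatible_swap (τ y) (f y)
    refine ⟨ρ * τ, hρ.mul hτ, fun x hx => ?_⟩
    rcases List.mem_cons.1 hx with rfl | hx
    · simpa using hρy
    · have hxy : x ≠ y := fun h => hy (h ▸ hx)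
      have hxy' : x ≠ CoInvol.co y := fun h => hy' (h ▸ hx)
      have := hinj x (List.mem_cons_of_mem _ hx) y List.mem_cons_self
      rw [Equiv.Perm.mul_apply, hl x hx]
      refine hfix _ ?_ (fun h => hxy (this.1 h)) ?_ (fun h => hxy' (this.2 h))
      · rw [← hl x hx]; exact fun h => hxy (τ.injective h)
      · rw [← hl x hx, ← hτ]; exact fun h => hxy' (τ.injective h)

/-- Finitely many elements can be moved away from a finite set. -/
theorem exists_compatible_avoiding [Infinite α] (l : List α) (X : Set α) (hX : X.Finite) :
    ∃ σ : Equiv.Perm α, Compatible σ ∧ ∀ x ∈ l, σ x ∉ X ∧ CoInvol.co (σ x) ∉ X := by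
  induction l with
  | nil => exact ⟨1, fun x => rfl, by simp⟩
  | cons y l ih =>
    obtain ⟨τ, hτ, hl⟩ := ih
    by_cases hy : y ∈ l
    · refine ⟨τ, hτ, fun x hx => ?_⟩
      rcases List.mem_cons.1 hx with rfl | hx
      exacts [hl _ hy, hl _ hx]
    by_cases hy' : CoInvol.co y ∈ l
    · refine ⟨τ, hτ, fun x hx => ?_⟩
      rcases List.mem_cons.1 hx with rfl | hx
      · have := hl _ hy'
        rw [hτ, CoInvol.co_co] at this
        exact this.symm
      · exact hl _ hx
    -- The target `b` has to avoid `X` up to the involution, and also the images chosen so far, so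
    -- that the exchange of `τ y` and `b` does not move them.
    have hfin : (X ∪ CoInvol.co '' X ∪ {z | z ∈ l.map τ} ∪
        CoInvol.co '' {z | z ∈ l.map τ}).Finite :=
      (((hX.union (hX.image _)).union (List.finite_toSet _)).union
        ((List.finite_toSet _).image _))
    obtain ⟨b, hb⟩ := hfin.exists_notMem
    simp only [Set.mem_union, not_or, List.mem_map, Set.mem_image] at hb
    obtain ⟨ρ, hρ, hρy, hfix⟩ := exists_compatible_swap (τ y) b
    refine ⟨ρ * τ, hρ.mul hτ, fun x hx => ?_⟩
    rcases List.mem_cons.1 hx with rfl | hx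
    · rw [Equiv.Perm.mul_apply, hρy]
      exact ⟨hb.1.1.1, fun h => hb.1.1.2 ⟨_, h, by simp⟩⟩
    · have hxy : x ≠ y := fun h => hy (h ▸ hx)
      have hxy' : x ≠ CoInvol.co y := fun h => hy' (h ▸ hx)
      have h1 : ρ (τ x) = τ x := by
        refine hfix _ (fun h => hxy (τ.injective h)) (fun h => hb.1.2 ⟨x, hx, h⟩) ?_ ?_
        · rw [← hτ]; exact fun h => hxy' (τ.injective h)
        · exact fun h => hb.2 ⟨τ x, ⟨x, hx, rfl⟩, by rw [h]; simp⟩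
      rw [Equiv.Perm.mul_apply, h1]
      exact hl x hx

end Involution

-- Formal sums as elements of a free module.

section Classes

variable {k : Type u} {Var : Type v} [CommSemiring k] [CoInvol Var]

/-- Identification of nets, as a setoid on all nets. -/
def netEqSetoid (k : Type u) (Var : Type v) [CommSemiring k] [CoInvol Var] :
    Setoid (Net k Var) where
  r := NetEq
  iseqv := ⟨.refl, .symm _ _, .trans _ _ _⟩

/-- Nets up to identification. -/
abbrev NetClass (k : Type u) (Var : Type v) [CommSemiring k] [CoInvol Var] :=
  Quotient (netEqSetoid k Var)

/-- The class of a net. -/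
def Net.toClass (p : Net k Var) : NetClass k Var := Quotient.mk (netEqSetoid k Var) p

theorem Net.toClass_eq {p q : Net k Var} : p.toClass = q.toClass ↔ NetEq p q :=
  Quotient.eq (r := netEqSetoid k Var)

/-- The linear combination of classes of nets denoted by a formal sum. -/
noncomputable def FSum.value (P : FSum k Var) : NetClass k Var →₀ k :=
  (P.map fun a => Finsupp.single a.2.toClass a.1).sum

@[simp] theorem FSum.value_nil : FSum.value ([] : FSum k Var) = 0 := rfl

@[simp] theorem FSum.value_cons (a : k × Net k Var) (P : FSum k Var) :
    FSum.value (a :: P) = Finsupp.single a.2.toClass a.1 + FSum.value P := by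
  simp [FSum.value]

/-- Each generator of `SumEq` preserves all coefficients. With the converse `SumEq.of_value_eq`,
this replaces an inductive relation by an equality in the free module on classes of nets. -/
theorem SumEq.value_eq {P Q : FSum k Var} (h : SumEq P Q) : FSum.value P = FSum.value Q := by
  -- The three identification relations are mutually inductive. Trivial motives for two of them
  -- leave only the cases of the third.
  refine SumEq.rec (motive_1 := fun _ _ _ => True) (motive_2 := fun _ _ _ => True)
    (motive_3 := fun P Q _ => FSum.value P = FSum.value Q)
    ?_ ?_ ?_ ?_ ?_ ?_ ?_ ?_ ?_ ?_ ?_ ?_ ?_ ?_ ?_ ?_ ?_ ?_ h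
  any_goals intros; trivial
  · intro P Q _ h; exact h.symm
  · intro P Q R _ _ h h'; exact h.trans h'
  · intro P Q h; exact List.Perm.sum_eq (h.map _)
  · intro a P Q _ h; simp [h]
  · intro μ p q P h _; simp [Net.toClass_eq.2 h]
  · intro μ ν p P; simp [Finsupp.single_add, add_assoc]
  · intro p P; simp

theorem SumEq.append_left (R : FSum k Var) {P Q : FSum k Var} (h : SumEq P Q) :
    SumEq (R ++ P) (R ++ Q) := by
  induction R with
  | nil => exact h
  | cons a R ih => exact .cons _ _ _ ih

theorem SumEq.append {P P' Q Q' : FSum k Var} (h : SumEq P P') (h' : SumEq Q Q') :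
    SumEq (P ++ Q) (P' ++ Q') :=
  .trans _ _ _ (h'.append_left P) <| .trans _ _ _ (.perm _ _ List.perm_append_comm) <|
    .trans _ _ _ (h.append_left Q') (.perm _ _ List.perm_append_comm)

/-- Formal sums up to equality of the linear combinations that they denote. -/
def sumEqSetoid (k : Type u) (Var : Type v) [CommSemiring k] [CoInvol Var] :
    Setoid (FSum k Var) where
  r := SumEq
  iseqv := ⟨.refl, .symm _ _, .trans _ _ _⟩

/-- The commutative monoid of formal sums up to identification. -/
@[reducible] def sumMonoid (k : Type u) (Var : Type v) [CommSemiring k] [CoInvol Var] :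
    AddCommMonoid (Quotient (sumEqSetoid k Var)) where
  add := Quotient.map₂ (· ++ ·) fun _ _ h _ _ h' => SumEq.append h h'
  zero := Quotient.mk _ []
  nsmul := @nsmulRec _ ⟨Quotient.mk _ []⟩
    ⟨Quotient.map₂ (· ++ ·) fun _ _ h _ _ h' => SumEq.append h h'⟩
  add_assoc := by
    rintro ⟨a⟩ ⟨b⟩ ⟨c⟩
    exact congrArg (Quotient.mk (sumEqSetoid k Var)) (List.append_assoc a b c)
  zero_add := by rintro ⟨a⟩; rfl
  add_zero := by rintro ⟨a⟩; exact congrArg (Quotient.mk (sumEqSetoid k Var)) (List.append_nil a)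
  add_comm := by
    rintro ⟨a⟩ ⟨b⟩
    exact Quotient.sound (s := sumEqSetoid k Var) (.perm _ _ List.perm_append_comm)

/-- The map `μ ↦ [(μ, p)]` into formal sums modulo `SumEq` is additive and depends only on the class
of `p`. The universal property of the free module extends it to an additive map that sends the value
of each `R` to the class of `R`, so the value determines the class. -/
theorem SumEq.of_value_eq {P Q : FSum k Var} (h : FSum.value P = FSum.value Q) : SumEq P Q := by
  let _ := sumMonoid k Var
  let g : NetClass k Var → k →+ Quotient (sumEqSetoid k Var) := fun c =>
    Quotient.liftOn c
      (fun p =>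
        { toFun := fun μ => Quotient.mk _ [(μ, p)]
          map_zero' := Quotient.sound (s := sumEqSetoid k Var) (.zero p [])
          map_add' := fun μ ν =>
            Quotient.sound (s := sumEqSetoid k Var) (.symm _ _ (.add μ ν p [])) })
      fun p q hpq => by
        ext μ
        exact Quotient.sound (s := sumEqSetoid k Var) (.net μ p q [] hpq)
  have key : ∀ R : FSum k Var, Finsupp.liftAddHom g (FSum.value R) = Quotient.mk _ R := by
    intro R
    induction R with
    | nil => exact map_zero _
    | cons a R ih =>
      rw [FSum.value_cons, map_add, ih, Finsupp.liftAddHom_apply_single]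
      rfl
  exact Quotient.exact (s := sumEqSetoid k Var) (by rw [← key, ← key, h])

theorem FSum.mem_of_value_ne_zero {P : FSum k Var} {c : NetClass k Var}
    (h : FSum.value P c ≠ 0) : ∃ a ∈ P, a.2.toClass = c := by
  induction P with
  | nil => simp at h
  | cons a P ih =>
    by_cases ha : a.2.toClass = c
    · exact ⟨a, by simp, ha⟩
    · obtain ⟨b, hb, hc⟩ := ih (by simpa [Finsupp.single_apply, ha] using h)
      exact ⟨b, by simp [hb], hc⟩

/-- If the class of `g e` is determined by the class of `f e`, then every class that occurs in
`∑ μ • g e` comes from a class that occurs in `∑ μ • f e`. -/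
theorem FSum.exists_of_value_map_ne_zero {X : Type w} (L : List (k × X)) (f g : X → Net k Var)
    (hfg : ∀ a ∈ L, ∀ b ∈ L, NetEq (f a.2) (f b.2) → NetEq (g a.2) (g b.2)) {d : NetClass k Var}
    (hd : FSum.value (L.map fun a => (a.1, g a.2)) d ≠ 0) :
    ∃ a ∈ L, (g a.2).toClass = d ∧
      FSum.value (L.map fun a => (a.1, f a.2)) (f a.2).toClass ≠ 0 := by
  classical
  -- The induced map on classes. By `hfg` the choice of a representative does not matter; outside
  -- the classes of the `f e`, the value `c` is a default. The second sum is the pushforward of the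
  -- first along `h`.
  let h : NetClass k Var → NetClass k Var := fun c =>
    if hc : ∃ a ∈ L, (f a.2).toClass = c then (g hc.choose.2).toClass else c
  have hh : ∀ a ∈ L, h (f a.2).toClass = (g a.2).toClass := fun a ha => by
    have hc : ∃ b ∈ L, (f b.2).toClass = (f a.2).toClass := ⟨a, ha, rfl⟩
    simp only [h, dif_pos hc]
    exact Net.toClass_eq.2
      (hfg _ hc.choose_spec.1 _ ha (Net.toClass_eq.1 hc.choose_spec.2))
  have key : ∀ L' : List (k × X), (∀ a ∈ L', a ∈ L) →
      FSum.value (L'.map fun a => (a.1, g a.2)) =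
        Finsupp.mapDomain h (FSum.value (L'.map fun a => (a.1, f a.2))) := by
    intro L' hL'
    induction L' with
    | nil => simp
    | cons a L' ih =>
      simp only [List.map_cons, FSum.value_cons, Finsupp.mapDomain_add, Finsupp.mapDomain_single]
      rw [hh a (hL' a (by simp)), ih fun b hb => hL' b (by simp [hb])]
  rw [key L fun _ h => h, ← Finsupp.mem_support_iff] at hd
  -- A pushforward can cancel coefficients but not create any, so the support lies in the image of
  -- the support.
  obtain ⟨c, hc, rfl⟩ := Finset.mem_image.1 (Finsupp.mapDomain_support hd)
  rw [Finsupp.mem_support_iff] at hc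
  obtain ⟨a, ha, rfl⟩ := FSum.mem_of_value_ne_zero hc
  obtain ⟨b, hb, rfl⟩ := List.mem_map.1 ha
  exact ⟨b, hb, (hh b hb).symm, hc⟩

end Classes

-- Normal form of the identification of nets: one renaming, then a structural identification.

section Structural

variable {k : Type u} {Var : Type v} [CommSemiring k] [CoInvol Var]

/-- Equality of trees up to identification of the contents of boxes. -/
def TreeEq : Tree k Var → Tree k Var → Prop := Relation.EqvGen TreeStep

theorem TreeEq.refl (t : Tree k Var) : TreeEq t t := Relation.EqvGen.refl t

theorem TreeEq.symm {t t' : Tree k Var} (h : TreeEq t t') : TreeEq t' t :=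
  Relation.EqvGen.symm _ _ h

theorem TreeEq.trans {t t' t'' : Tree k Var} (h : TreeEq t t') (h' : TreeEq t' t'') :
    TreeEq t t'' :=
  Relation.EqvGen.trans _ _ _ h h'

theorem TreeEq.map {f : Tree k Var → Tree k Var}
    (hf : ∀ t t', TreeStep t t' → TreeStep (f t) (f t')) {t t' : Tree k Var} (h : TreeEq t t') :
    TreeEq (f t) (f t') := by
  induction h with
  | rel _ _ h => exact .rel _ _ (hf _ _ h)
  | refl => exact .refl _
  | symm _ _ _ ih => exact ih.symm
  | trans _ _ _ _ _ ih ih' => exact ih.trans ih'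

/-- `TreeStep` changes one argument at a time; `us` collects the arguments already replaced. -/
theorem TreeEq.node_append (φ : Con k Var) (us : List (Tree k Var)) {ts ts' : List (Tree k Var)}
    (h : List.Forall₂ TreeEq ts ts') : TreeEq (.node φ (us ++ ts)) (.node φ (us ++ ts')) := by
  induction h generalizing us with
  | nil => exact .refl _
  | @cons t t' ts ts' h _ ih =>
    have h1 : TreeEq (.node φ (us ++ t :: ts)) (.node φ (us ++ t' :: ts)) :=
      h.map (f := fun t => .node φ (us ++ t :: ts)) fun t t' => .sub φ us ts t t'
    have h2 := ih (us ++ [t'])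
    simp only [List.append_assoc, List.singleton_append] at h2
    exact h1.trans h2

theorem TreeEq.node (φ : Con k Var) {ts ts' : List (Tree k Var)}
    (h : List.Forall₂ TreeEq ts ts') : TreeEq (.node φ ts) (.node φ ts') :=
  TreeEq.node_append φ [] h

theorem TreeStep.vars_eq {t t' : Tree k Var} (h : TreeStep t t') : t.vars = t'.vars := by
  refine TreeStep.rec (motive_1 := fun t t' _ => t.vars = t'.vars) (motive_2 := fun _ _ _ => True)
    (motive_3 := fun _ _ _ => True)
    ?_ ?_ ?_ ?_ ?_ ?_ ?_ ?_ ?_ ?_ ?_ ?_ ?_ ?_ ?_ ?_ ?_ ?_ h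
  any_goals intros; trivial
  · intro φ us vs t t' _ (ih : t.vars = t'.vars); simp [ih]

theorem TreeStep.rename (σ : Var → Var) {t t' : Tree k Var} (h : TreeStep t t') :
    TreeStep (t.rename σ) (t'.rename σ) := by
  refine TreeStep.rec (motive_1 := fun t t' _ => TreeStep (t.rename σ) (t'.rename σ))
    (motive_2 := fun _ _ _ => True) (motive_3 := fun _ _ _ => True)
    ?_ ?_ ?_ ?_ ?_ ?_ ?_ ?_ ?_ ?_ ?_ ?_ ?_ ?_ ?_ ?_ ?_ ?_ h
  any_goals intros; trivial
  · intro n P Q ts h _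
    rw [Tree.rename_node, Tree.rename_node]
    exact .box n P Q _ h
  · intro φ us vs t t' _ ih
    simp only [Tree.rename_node, List.map_append, List.map_cons]
    exact .sub _ _ _ _ _ ih

theorem TreeEq.vars_eq {t t' : Tree k Var} (h : TreeEq t t') : t.vars = t'.vars := by
  induction h with
  | rel _ _ h => exact h.vars_eq
  | refl => rfl
  | symm _ _ _ ih => exact ih.symm
  | trans _ _ _ _ _ ih ih' => exact ih.trans ih'

theorem TreeEq.rename (σ : Var → Var) {t t' : Tree k Var} (h : TreeEq t t') :
    TreeEq (t.rename σ) (t'.rename σ) :=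
  h.map fun _ _ h => h.rename σ

/-- Equality of cuts, as unordered pairs, up to identification of the contents of boxes. -/
def CutEq (c d : Cut k Var) : Prop :=
  TreeEq c.1 d.1 ∧ TreeEq c.2 d.2 ∨ TreeEq c.1 d.2 ∧ TreeEq c.2 d.1

theorem CutEq.refl (c : Cut k Var) : CutEq c c := .inl ⟨.refl _, .refl _⟩

theorem CutEq.symm {c d : Cut k Var} (h : CutEq c d) : CutEq d c := by
  rcases h with ⟨h, h'⟩ | ⟨h, h'⟩
  exacts [.inl ⟨h.symm, h'.symm⟩, .inr ⟨h'.symm, h.symm⟩]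

theorem CutEq.trans {c d e : Cut k Var} (h : CutEq c d) (h' : CutEq d e) : CutEq c e := by
  rcases h with ⟨h1, h2⟩ | ⟨h1, h2⟩ <;> rcases h' with ⟨h3, h4⟩ | ⟨h3, h4⟩
  exacts [.inl ⟨h1.trans h3, h2.trans h4⟩, .inr ⟨h1.trans h3, h2.trans h4⟩,
    .inr ⟨h1.trans h4, h2.trans h3⟩, .inl ⟨h1.trans h4, h2.trans h3⟩]

theorem CutEq.rename (σ : Var → Var) {c d : Cut k Var} (h : CutEq c d) :
    CutEq (Cut.rename σ c) (Cut.rename σ d) := by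
  rcases h with ⟨h, h'⟩ | ⟨h, h'⟩
  exacts [.inl ⟨h.rename σ, h'.rename σ⟩, .inr ⟨h.rename σ, h'.rename σ⟩]

theorem CutEq.vars_perm {c d : Cut k Var} (h : CutEq c d) : (Cut.vars c).Perm (Cut.vars d) := by
  rcases h with ⟨h, h'⟩ | ⟨h, h'⟩
  · rw [Cut.vars, h.vars_eq, h'.vars_eq, Cut.vars]
  · rw [Cut.vars, h.vars_eq, h'.vars_eq, Cut.vars]
    exact List.perm_append_comm

instance : IsTrans (Cut k Var) CutEq := ⟨fun _ _ _ => CutEq.trans⟩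

/-- Identification of nets without renaming of bound variables. -/
def Net.StructEq (p q : Net k Var) : Prop :=
  List.Forall₂ TreeEq p.trees q.trees ∧
    Multiset.Rel CutEq (p.cuts : Multiset (Cut k Var)) (q.cuts : Multiset (Cut k Var))

theorem forall₂_treeEq_refl (ts : List (Tree k Var)) : List.Forall₂ TreeEq ts ts :=
  List.forall₂_same.2 fun t _ => .refl t

theorem rel_cutEq_refl (C : Multiset (Cut k Var)) : Multiset.Rel CutEq C C :=
  Multiset.rel_refl_of_refl_on fun c _ => .refl c

theorem Net.StructEq.refl (p : Net k Var) : p.StructEq p :=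
  ⟨forall₂_treeEq_refl _, rel_cutEq_refl _⟩

theorem Net.StructEq.symm {p q : Net k Var} (h : p.StructEq q) : q.StructEq p :=
  ⟨h.1.flip.imp fun _ _ h => TreeEq.symm h,
    (Multiset.rel_flip.2 h.2).mono fun _ _ _ _ h => CutEq.symm h⟩

theorem Net.StructEq.trans {p q r : Net k Var} (h : p.StructEq q) (h' : q.StructEq r) :
    p.StructEq r := by
  refine ⟨?_, Multiset.Rel.trans _ h.2 h'.2⟩
  have trans : ∀ {l l' : List (Tree k Var)}, List.Forall₂ TreeEq l l' →
      ∀ {l''}, List.Forall₂ TreeEq l' l'' → List.Forall₂ TreeEq l l'' := by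
    intro l l' h
    induction h with
    | nil => exact fun h => h
    | cons h _ ih =>
      intro l'' h'
      cases h' with | cons h1 h2 => exact .cons (h.trans h1) (ih h2)
  exact trans h.1 h'.1

theorem Net.StructEq.rename (σ : Var → Var) {p q : Net k Var} (h : p.StructEq q) :
    (p.rename σ).StructEq (q.rename σ) := by
  refine ⟨?_, ?_⟩
  · simp only [Net.trees_rename, List.forall₂_map_left_iff, List.forall₂_map_right_iff]
    exact h.1.imp fun _ _ h => h.rename σ
  · simp only [Net.cuts_rename, ← Multiset.map_coe, Multiset.rel_map]
    exact h.2.mono fun _ _ _ _ h => h.rename σ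

theorem flatMap_vars_eq {ts ts' : List (Tree k Var)} (h : List.Forall₂ TreeEq ts ts') :
    ts.flatMap Tree.vars = ts'.flatMap Tree.vars := by
  induction h with
  | nil => rfl
  | cons h _ ih => simp [h.vars_eq, ih]

theorem Net.StructEq.vars_perm {p q : Net k Var} (h : p.StructEq q) : p.vars.Perm q.vars := by
  obtain ⟨ts, cs⟩ := p
  obtain ⟨ts', cs'⟩ := q
  rw [Net.vars_mk, Net.vars_mk, flatMap_vars_eq (ts := ts) (ts' := ts') h.1]
  refine List.Perm.append_left _ ?_
  have key : ∀ {C D : Multiset (Cut k Var)}, Multiset.Rel CutEq C D →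
      C.bind (fun c => (Cut.vars c : Multiset Var)) = D.bind fun c => (Cut.vars c : Multiset Var) := by
    intro C D h
    induction h with
    | zero => rfl
    | cons h _ ih => rw [Multiset.cons_bind, Multiset.cons_bind, ih, Multiset.coe_eq_coe.2 h.vars_perm]
  have := key h.2
  simp only [Multiset.coe_bind, Multiset.coe_eq_coe] at this
  exact this

theorem NetEq.of_treeEq (us vs : List (Tree k Var)) {t t' : Tree k Var} (cs : List (Cut k Var))
    (h : TreeEq t t') : NetEq (.mk (us ++ t :: vs) cs) (.mk (us ++ t' :: vs) cs) := by
  induction h with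
  | rel _ _ h => exact .tree _ _ _ _ _ h
  | refl => exact .refl _
  | symm _ _ _ ih => exact .symm _ _ ih
  | trans _ _ _ _ _ ih ih' => exact .trans _ _ _ ih ih'

theorem NetEq.of_forall₂_treeEq (us : List (Tree k Var)) {ts ts' : List (Tree k Var)}
    (cs : List (Cut k Var)) (h : List.Forall₂ TreeEq ts ts') :
    NetEq (.mk (us ++ ts) cs) (.mk (us ++ ts') cs) := by
  induction h generalizing us with
  | nil => exact .refl _
  | @cons t t' ts ts' h _ ih =>
    have h2 := ih (us ++ [t'])
    simp only [List.append_assoc, List.singleton_append] at h2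
    exact .trans _ _ _ (NetEq.of_treeEq us ts cs h) h2

theorem NetEq.of_cutEq (ts : List (Tree k Var)) {c d : Cut k Var} (cs : List (Cut k Var))
    (h : CutEq c d) : NetEq (.mk ts (c :: cs)) (.mk ts (d :: cs)) := by
  have left : ∀ {t t' : Tree k Var} (u : Tree k Var), TreeEq t t' →
      NetEq (.mk ts ((t, u) :: cs)) (.mk ts ((t', u) :: cs)) := by
    intro t t' u h
    induction h with
    | rel _ _ h => exact .cut _ _ _ _ _ h
    | refl => exact .refl _
    | symm _ _ _ ih => exact .symm _ _ ih
    | trans _ _ _ _ _ ih ih' => exact .trans _ _ _ ih ih'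
  have both : ∀ {t t' u u' : Tree k Var}, TreeEq t t' → TreeEq u u' →
      NetEq (.mk ts ((t, u) :: cs)) (.mk ts ((t', u') :: cs)) := fun h h' =>
    .trans _ _ _ (left _ h) <| .trans _ _ _ (.swap _ _ _ _) <|
      .trans _ _ _ (left _ h') (.swap _ _ _ _)
  obtain ⟨t, u⟩ := c
  obtain ⟨t', u'⟩ := d
  rcases h with ⟨h, h'⟩ | ⟨h, h'⟩
  · exact both h h'
  · exact .trans _ _ _ (both h h') (.swap _ _ _ _)

/-- `NetEq.of_cutEq` acts on the head of the list of cuts. Related cuts are treated one by one, each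
brought to the head by a permutation, and `bs` collects those already replaced. -/
theorem NetEq.of_rel_cutEq (ts : List (Tree k Var)) {C D : Multiset (Cut k Var)}
    (h : Multiset.Rel CutEq C D) : ∀ (bs cs ds : List (Cut k Var)),
    (cs : Multiset (Cut k Var)) = bs + C → (ds : Multiset (Cut k Var)) = bs + D →
    NetEq (.mk ts cs) (.mk ts ds) := by
  induction h with
  | zero =>
    intro bs cs ds hc hd
    exact .perm _ _ _ (Multiset.coe_eq_coe.1 (hc.trans hd.symm))
  | @cons c d C D h _ ih =>
    intro bs cs ds hc hd
    induction C using Quotient.inductionOn with | _ C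
    have h1 : NetEq (.mk ts cs) (.mk ts (c :: (bs ++ C))) :=
      .perm _ _ _ (Multiset.coe_eq_coe.1 (hc.trans (by simp)))
    refine .trans _ _ _ h1 (.trans _ _ _ (NetEq.of_cutEq ts _ h) ?_)
    refine ih (d :: bs) _ _ (by simp)
      (hd.trans (by rw [Multiset.add_cons, ← Multiset.cons_coe, Multiset.cons_add]))

theorem Net.StructEq.netEq {p q : Net k Var} (h : p.StructEq q) : NetEq p q := by
  obtain ⟨ts, cs⟩ := p
  obtain ⟨ts', cs'⟩ := q
  exact .trans _ _ _ (NetEq.of_forall₂_treeEq [] cs h.1)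
    (NetEq.of_rel_cutEq ts' h.2 [] _ _ (by simp [Net.cuts]) (by simp [Net.cuts]))

/-- Identified nets differ by a renaming of bound variables and a structural identification. -/
theorem NetEq.exists_rename {p q : Net k Var} (h : NetEq p q) :
    ∃ σ : Equiv.Perm Var, Compatible σ ∧ (∀ x ∈ p.vars, CoInvol.co x ∉ p.vars → σ x = x) ∧
      (p.rename σ).StructEq q := by
  have of_struct : ∀ {p q : Net k Var}, p.StructEq q →
      ∃ σ : Equiv.Perm Var, Compatible σ ∧ (∀ x ∈ p.vars, CoInvol.co x ∉ p.vars → σ x = x) ∧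
        (p.rename σ).StructEq q := fun {p q} h =>
    ⟨1, fun _ => rfl, fun _ _ _ => rfl, by
      rw [show ((1 : Equiv.Perm Var) : Var → Var) = id from rfl, Net.rename_id]; exact h⟩
  refine NetEq.rec (motive_1 := fun _ _ _ => True) (motive_2 := fun p q _ =>
      ∃ σ : Equiv.Perm Var, Compatible σ ∧ (∀ x ∈ p.vars, CoInvol.co x ∉ p.vars → σ x = x) ∧
        (p.rename σ).StructEq q)
    (motive_3 := fun _ _ _ => True)
    ?_ ?_ ?_ ?_ ?_ ?_ ?_ ?_ ?_ ?_ ?_ ?_ ?_ ?_ ?_ ?_ ?_ ?_ h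
  any_goals intros; trivial
  · intro p; exact of_struct (.refl p)
  · rintro p q _ ⟨σ, hσ, hfix, hs⟩
    -- The variables of `q` are the images under `σ` of those of `p`. A free one is the image of a
    -- free one, which `σ` fixes, so the inverse fixes it too.
    refine ⟨σ.symm, hσ.symm, fun x hx hx' => ?_, ?_⟩
    · have hq : ∀ y, y ∈ q.vars ↔ ∃ z ∈ p.vars, σ z = y := fun y => by
        rw [← hs.vars_perm.mem_iff, Net.vars_rename, List.mem_map]
      obtain ⟨z, hz, rfl⟩ := (hq x).1 hx
      rw [Equiv.symm_apply_apply]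
      exact (hfix z hz fun hz' => hx' ((hq _).2 ⟨_, hz', hσ z⟩)).symm
    · have := (hs.rename σ.symm).symm
      rw [Net.rename_rename, show σ.symm ∘ σ = id from funext σ.symm_apply_apply,
        Net.rename_id] at this
      exact this
  · rintro p q r _ _ ⟨σ, hσ, hfix, hs⟩ ⟨τ, hτ, hfix', hs'⟩
    refine ⟨τ * σ, hτ.mul hσ, fun x hx hx' => ?_, ?_⟩
    · have hq : ∀ y, y ∈ q.vars ↔ ∃ z ∈ p.vars, σ z = y := fun y => by
        rw [← hs.vars_perm.mem_iff, Net.vars_rename, List.mem_map]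
      have h1 := hfix x hx hx'
      rw [Equiv.Perm.mul_apply, h1]
      -- A variable that is free in `p`, hence fixed by `σ`, is still free in `q`, because `σ` is
      -- injective and also fixes its covariable.
      refine hfix' x ((hq x).2 ⟨x, hx, h1⟩) fun h => ?_
      obtain ⟨z, hz, hzx⟩ := (hq _).1 h
      have : σ (CoInvol.co x) = CoInvol.co x := by rw [hσ, h1]
      rw [← this] at hzx
      exact hx' (σ.injective hzx ▸ hz)
    · have := (hs.rename τ).trans hs'
      rwa [Net.rename_rename] at this
  · intro p σ hσ hfix
    exact ⟨σ, hσ, hfix, .refl _⟩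
  · intro ts cs ds h
    refine of_struct ⟨forall₂_treeEq_refl _, ?_⟩
    simp only [Net.cuts, Multiset.coe_eq_coe.2 h]
    exact rel_cutEq_refl _
  · intro ts t t' cs
    refine of_struct ⟨forall₂_treeEq_refl _, ?_⟩
    exact Multiset.Rel.cons (a := (t, t')) (b := (t', t)) (as := cs) (bs := cs)
      (.inr ⟨.refl _, .refl _⟩) (rel_cutEq_refl _)
  · intro us vs t t' cs h _
    refine of_struct ⟨?_, rel_cutEq_refl _⟩
    exact List.rel_append (forall₂_treeEq_refl us) (.cons (.rel _ _ h) (forall₂_treeEq_refl vs))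
  · intro ts t t' u cs h _
    refine of_struct ⟨forall₂_treeEq_refl _, ?_⟩
    exact Multiset.Rel.cons (a := (t, u)) (b := (t', u)) (as := cs) (bs := cs)
      (.inl ⟨.rel _ _ h, .refl _⟩) (rel_cutEq_refl _)

/-- Nets that are built in the same way from identified nets, with a common context whose variables
are listed in `M`, are identified. -/
theorem NetEq.of_context {a a' b b' : Net k Var} (M : Multiset Var) (h : NetEq a a')
    (hb : (b.vars : Multiset Var) = a.vars + M) (hb' : (b'.vars : Multiset Var) = a'.vars + M)
    (hn : b.vars.Nodup) (hn' : b'.vars.Nodup)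
    (hctx : ∀ σ : Equiv.Perm Var, (∀ x ∈ M, σ x = x) → (a.rename σ).StructEq a' →
      (b.rename σ).StructEq b') : NetEq b b' := by
  classical
  obtain ⟨σ, hσ, hfix, hs⟩ := h.exists_rename
  have memb : ∀ x, x ∈ b.vars ↔ x ∈ a.vars ∨ x ∈ M := fun x => by
    rw [← Multiset.mem_coe, hb, Multiset.mem_add, Multiset.mem_coe]
  have disj : ∀ x ∈ a.vars, x ∉ M := by
    have : ((a.vars : Multiset Var) + M).Nodup := hb ▸ Multiset.coe_nodup.2 hn
    exact fun x hx => Multiset.disjoint_left.1 (Multiset.nodup_add.1 this).2.2 (by simpa using hx)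
  -- The linearity of `b'` enters here: the variables of `a'`, which are the images under `σ`, avoid
  -- the context.
  have disj' : ∀ x ∈ a.vars, σ x ∉ M := by
    have : ((a'.vars : Multiset Var) + M).Nodup := hb' ▸ Multiset.coe_nodup.2 hn'
    intro x hx
    refine Multiset.disjoint_left.1 (Multiset.nodup_add.1 this).2.2 ?_
    rw [Multiset.mem_coe, ← hs.vars_perm.mem_iff, Net.vars_rename]
    exact List.mem_map_of_mem hx
  let bd : Var → Prop := fun x => x ∈ a.vars ∧ CoInvol.co x ∈ a.vars
  have hbd : ∀ x, bd (CoInvol.co x) ↔ bd x := fun x => by simp [bd, and_comm]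
  -- Outside `a` the permutation `σ` is arbitrary and may move variables of the context. Only its
  -- action on the bound variables of `a` is kept.
  let f : Var → Var := fun x => if bd x then σ x else x
  have hf : ∀ x, f (CoInvol.co x) = CoInvol.co (f x) := fun x => by
    simp only [f, hbd]
    split
    · exact hσ x
    · rfl
  have fpos : ∀ x, bd x → f x = σ x := fun x hx => if_pos hx
  have fneg : ∀ x, ¬ bd x → f x = x := fun x hx => if_neg hx
  have fa : ∀ x ∈ a.vars, f x = σ x := fun x hx => by
    by_cases h : bd x
    · exact fpos x h
    · rw [fneg x h, hfix x hx fun h' => h ⟨hx, h'⟩]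
  -- No capture: a free variable of `a` is fixed by `σ`, so injectivity applies, and a variable of
  -- the context is excluded by `disj'`.
  have sep : ∀ x, bd x → ∀ y ∈ b.vars, ¬ bd y → σ x ≠ y := fun x hx y hy hy' h => by
    rcases (memb y).1 hy with hy | hy
    · have := hfix y hy fun h' => hy' ⟨hy, h'⟩
      rw [← this] at h
      exact hy' (σ.injective h ▸ hx)
    · exact disj' x hx.1 (h ▸ hy)
  have inj : ∀ x ∈ b.vars, ∀ y, (y ∈ b.vars ∨ CoInvol.co y ∈ b.vars) → f x = f y → x = y := by
    intro x hx y hy hxy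
    by_cases h1 : bd x <;> by_cases h2 : bd y
    · rw [fpos x h1, fpos y h2] at hxy
      exact σ.injective hxy
    · rw [fpos x h1, fneg y h2] at hxy
      rcases hy with hy | hy
      · exact absurd hxy (sep x h1 y hy h2)
      · refine absurd ?_ (sep _ ((hbd x).2 h1) _ hy (by rwa [hbd]))
        rw [hσ, hxy]
    · rw [fneg x h1, fpos y h2] at hxy
      exact absurd hxy.symm (sep y h2 x hx h1)
    · rwa [fneg x h1, fneg y h2] at hxy
  obtain ⟨τ, hτ, hτf⟩ := exists_compatible_extension f hf b.vars fun x hx y hy =>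
    ⟨inj x hx y (.inl hy), fun h => inj x hx _ (.inr (by simpa using hy)) (by rw [h, hf])⟩
  have τM : ∀ x ∈ M, τ x = x := fun x hx => by
    rw [hτf x ((memb x).2 (.inr hx)), fneg x fun h => disj x h.1 hx]
  -- The renaming is an α-conversion of `b`, since a variable bound in `a` is also bound in `b`.
  refine .trans _ _ _ (.alpha b τ hτ fun x hx hx' => ?_) (hctx τ τM ?_).netEq
  · rw [hτf x hx]
    exact fneg x fun h => hx' ((memb _).2 (.inl h.2))
  · rwa [Net.rename_congr a (τ := σ) fun x hx => by rw [hτf x ((memb x).2 (.inl hx)), fa x hx]]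

end Structural

-- The sequent system on multisets, and isolation of a rule inside a derivation.

section Judgment

variable {k : Type u} {Var : Type v} {Atom : Type w} [CoInvol Var] [CoInvol Atom]

theorem TypingContext.Extends.refl (Φ : TypingContext Var Atom) : Φ.Extends Φ := fun _ _ h => h

theorem TypingContext.Extends.trans {Φ Φ' Φ'' : TypingContext Var Atom} (h : Φ''.Extends Φ')
    (h' : Φ'.Extends Φ) : Φ''.Extends Φ := fun x A hx => h x A (h' x A hx)

variable [CommSemiring k]

/-- A class of nets is typable by `Γ` when every context has an extension in which some
representative is derivable. -/
def IsNetClass (Γ : List (Formula Atom)) (c : NetClass k Var) : Prop :=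
  ∀ Φ : TypingContext Var Atom, ∃ Φ' : TypingContext Var Atom, Φ'.Extends Φ ∧
    ∃ p : Net k Var, p.toClass = c ∧ Logic Φ' p Γ

/-- The classes of nets that occur in the value of a formal sum are typable by `Γ`. -/
def IsNetSum (Γ : List (Formula Atom)) (P : FSum k Var) : Prop :=
  ∀ c, FSum.value P c ≠ 0 → IsNetClass Γ c

/-- Constructors whose arguments belong to one premise. -/
inductive NegRule : Con k Var → List (Formula Atom) → Formula Atom → Prop
  | par (A B : Formula Atom) : NegRule .par [A, B] (.par A B)
  | weak (A : Formula Atom) : NegRule .weak [] (.quest A)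
  | der (A : Formula Atom) : NegRule .der [A] (.quest A)
  | coder (A : Formula Atom) : NegRule .coder [A] (.bang A)
  | contr (A : Formula Atom) : NegRule .contr [.quest A, .quest A] (.quest A)

/-- Constructors whose arguments belong to distinct premises. -/
inductive PosRule : Con k Var → List (Formula Atom) → Formula Atom → Prop
  | tens (A B : Formula Atom) : PosRule .tens [A, B] (.tens A B)
  | coweak (A : Formula Atom) : PosRule .coweak [] (.bang A)
  | cocontr (A : Formula Atom) : PosRule .cocontr [.bang A, .bang A] (.bang A)
  | prom (As : List (Formula Atom)) (B : Formula Atom) (P : FSum k Var) :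
      IsNetSum (As.map (fun A => A.orth.quest) ++ [B]) P →
      PosRule (.prom As.length P) (As.map .bang) (.bang B)

/-- Derivability without typing context and without disjointness conditions.  The judgment
`Seq T none S C` concerns a net with typed trees `S` and cuts `C`; the judgment `Seq T (some L) S C`
concerns a list of nets, with distinguished typed trees `L`, and with `S` and `C` the collections of
all other trees and of all cuts.  The predicate `T` restricts the axioms. -/
inductive Seq (T : Var → Formula Atom → Prop) : Option (List (Tree k Var × Formula Atom)) →
    Multiset (Tree k Var × Formula Atom) → Multiset (Cut k Var) → Prop
  | ax (x : Var) (A : Formula Atom) : T x A →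
      Seq T none ({(.var x, A)} + {(.var (CoInvol.co x), A.orth)}) 0
  | mix {S S' C C'} : Seq T none S C → Seq T none S' C' → Seq T none (S + S') (C + C')
  | cut {s t A S S' C C'} : Seq T none ({(s, A)} + S) C → Seq T none ({(t, A.orth)} + S') C' →
      Seq T none (S + S') ({(s, t)} + (C + C'))
  | neg {φ B S C} {L : List (Tree k Var × Formula Atom)} : NegRule φ (L.map Prod.snd) B →
      Seq T none ((L : Multiset _) + S) C → Seq T none ({(.node φ (L.map Prod.fst), B)} + S) C
  | pos {φ B S C} {L : List (Tree k Var × Formula Atom)} : PosRule φ (L.map Prod.snd) B →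
      Seq T (some L) S C → Seq T none ({(.node φ (L.map Prod.fst), B)} + S) C
  | nil : Seq T (some []) 0 0
  | cons {a S S' C C'} {L : List (Tree k Var × Formula Atom)} : Seq T none ({a} + S) C →
      Seq T (some L) S' C' → Seq T (some (a :: L)) (S + S') (C + C')

variable {T : Var → Formula Atom → Prop} {o : Option (List (Tree k Var × Formula Atom))}
  {S S' S₀ S₁ : Multiset (Tree k Var × Formula Atom)} {C C' C₀ C₁ : Multiset (Cut k Var)}

theorem Seq.cast (h : Seq T o S C) (hS : S = S') (hC : C = C') : Seq T o S' C' := by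
  subst hS hC; exact h

theorem Seq.mono {T' : Var → Formula Atom → Prop} (hT : ∀ x A, T x A → T' x A)
    (h : Seq T o S C) : Seq T' o S C := by
  induction h with
  | ax x A h => exact .ax x A (hT x A h)
  | mix _ _ ih ih' => exact .mix ih ih'
  | cut _ _ ih ih' => exact .cut ih ih'
  | neg h _ ih => exact .neg h ih
  | pos h _ ih => exact .pos h ih
  | nil => exact .nil
  | cons _ _ ih ih' => exact .cons ih ih'

/-- Every derivation of `S₁` and `C₁`, in any context, can be completed to a derivation of `S₀`
and `C₀`. -/
def Frame (T : Var → Formula Atom → Prop) (S₁ : Multiset (Tree k Var × Formula Atom))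
    (C₁ : Multiset (Cut k Var)) (o : Option (List (Tree k Var × Formula Atom)))
    (S₀ : Multiset (Tree k Var × Formula Atom)) (C₀ : Multiset (Cut k Var)) : Prop :=
  ∀ W F, Seq T none (W + S₁) (F + C₁) → Seq T o (W + S₀) (F + C₀)

theorem Frame.refl (T : Var → Formula Atom → Prop) (S : Multiset (Tree k Var × Formula Atom))
    (C : Multiset (Cut k Var)) : Frame T S C none S C := fun _ _ h => h

theorem Frame.cast (h : Frame T S₁ C₁ o S C) (hS : S = S') (hC : C = C') :
    Frame T S₁ C₁ o S' C' := by
  subst hS hC; exact h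

/-- This lemma and its variants below extend a frame by one rule: the rule is applied again to the
premise that contains the hole, and the extra trees `W` and cuts `F` pass to its conclusion. -/
theorem Frame.mix_left (h : Frame T S₁ C₁ none S₀ C₀) (h' : Seq T none S' C') :
    Frame T S₁ C₁ none (S₀ + S') (C₀ + C') := fun W F hW =>
  ((h W F hW).mix h').cast (by abel) (by abel)

theorem Frame.mix_right (h' : Seq T none S' C') (h : Frame T S₁ C₁ none S₀ C₀) :
    Frame T S₁ C₁ none (S' + S₀) (C' + C₀) :=
  (h.mix_left h').cast (by abel) (by abel)

theorem Frame.cut_left {s t : Tree k Var} {A : Formula Atom}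
    (h : Frame T S₁ C₁ none ({(s, A)} + S₀) C₀) (h' : Seq T none ({(t, A.orth)} + S') C') :
    Frame T S₁ C₁ none (S₀ + S') ({(s, t)} + (C₀ + C')) := fun W F hW =>
  (Seq.cut (S := W + S₀) ((h W F hW).cast (by abel) rfl) h').cast (by abel) (by abel)

theorem Frame.cut_right {s t : Tree k Var} {A : Formula Atom}
    (h' : Seq T none ({(s, A)} + S') C') (h : Frame T S₁ C₁ none ({(t, A.orth)} + S₀) C₀) :
    Frame T S₁ C₁ none (S' + S₀) ({(s, t)} + (C' + C₀)) := fun W F hW =>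
  (Seq.cut (S' := W + S₀) h' ((h W F hW).cast (by abel) rfl)).cast (by abel) (by abel)

theorem Frame.neg {φ : Con k Var} {B : Formula Atom} {L : List (Tree k Var × Formula Atom)}
    (hφ : NegRule φ (L.map Prod.snd) B) (h : Frame T S₁ C₁ none ((L : Multiset _) + S₀) C₀) :
    Frame T S₁ C₁ none ({(.node φ (L.map Prod.fst), B)} + S₀) C₀ := fun W F hW =>
  (Seq.neg (S := W + S₀) hφ ((h W F hW).cast (by abel) rfl)).cast (by abel) rfl

theorem Frame.pos {φ : Con k Var} {B : Formula Atom} {L : List (Tree k Var × Formula Atom)}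
    (hφ : PosRule φ (L.map Prod.snd) B) (h : Frame T S₁ C₁ (some L) S₀ C₀) :
    Frame T S₁ C₁ none ({(.node φ (L.map Prod.fst), B)} + S₀) C₀ := fun W F hW =>
  (Seq.pos hφ (h W F hW)).cast (by abel) rfl

theorem Frame.cons_left {a : Tree k Var × Formula Atom} {L : List (Tree k Var × Formula Atom)}
    (h : Frame T S₁ C₁ none ({a} + S₀) C₀) (h' : Seq T (some L) S' C') :
    Frame T S₁ C₁ (some (a :: L)) (S₀ + S') (C₀ + C') := fun W F hW =>
  (Seq.cons (S := W + S₀) ((h W F hW).cast (by abel) rfl) h').cast (by abel) (by abel)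

theorem Frame.cons_right {a : Tree k Var × Formula Atom} {L : List (Tree k Var × Formula Atom)}
    (h' : Seq T none ({a} + S') C') (h : Frame T S₁ C₁ (some L) S₀ C₀) :
    Frame T S₁ C₁ (some (a :: L)) (S' + S₀) (C' + C₀) := fun W F hW =>
  (Seq.cons h' (h W F hW)).cast (by abel) (by abel)

theorem singleton_add_eq_add {α : Type*} {a : α} {M M₁ M₂ : Multiset α} (h : {a} + M = M₁ + M₂) :
    (∃ N, M₁ = {a} + N ∧ M = N + M₂) ∨ ∃ N, M₂ = {a} + N ∧ M = M₁ + N := by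
  have ha : a ∈ M₁ + M₂ := h ▸ by simp
  rcases Multiset.mem_add.1 ha with ha | ha <;> obtain ⟨N, rfl⟩ := Multiset.exists_cons_of_mem ha
  · refine .inl ⟨N, rfl, ?_⟩
    simpa using h
  · refine .inr ⟨N, rfl, ?_⟩
    simpa using h

theorem singleton_add_eq_singleton_add {α : Type*} {a b : α} {M M' : Multiset α}
    (h : {a} + M = {b} + M') : (a = b ∧ M = M') ∨ ∃ N, M' = {a} + N ∧ M = {b} + N := by
  rcases singleton_add_eq_add h with ⟨N, h1, rfl⟩ | h
  · have : N = 0 := by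
      have := congrArg Multiset.card h1
      simpa using this
    subst this
    simp only [add_zero, Multiset.singleton_inj] at h1
    exact .inl ⟨h1.symm, by simp⟩
  · exact .inr h

/-- The rule that introduces a tree, as it occurs in a derivation. -/
theorem Seq.exists_rule (h : Seq T o S C) {φ : Con k Var} {ts : List (Tree k Var)}
    {A : Formula Atom} (hS : {(.node φ ts, A)} + S₀ = S) :
    ∃ (L : List (Tree k Var × Formula Atom)) (S₁ : Multiset (Tree k Var × Formula Atom))
      (C₁ : Multiset (Cut k Var)), ts = L.map Prod.fst ∧
      (NegRule φ (L.map Prod.snd) A ∧ Seq T none ((L : Multiset _) + S₁) C₁ ∨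
        PosRule φ (L.map Prod.snd) A ∧ Seq T (some L) S₁ C₁) ∧ Frame T S₁ C₁ o S₀ C := by
  induction h generalizing S₀ with
  | ax x B _ =>
    -- Both trees of an axiom are variables, so neither is a node.
    rcases singleton_add_eq_singleton_add hS with ⟨h, _⟩ | ⟨N, h, _⟩
    · simp at h
    · have := congrArg ((Tree.node φ ts, A) ∈ ·) h
      simp at this
  | mix h h' ih ih' =>
    rcases singleton_add_eq_add hS with ⟨N, rfl, rfl⟩ | ⟨N, rfl, rfl⟩
    · obtain ⟨L, S₁, C₁, hts, hr, hf⟩ := ih rfl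
      exact ⟨L, S₁, C₁, hts, hr, hf.mix_left h'⟩
    · obtain ⟨L, S₁, C₁, hts, hr, hf⟩ := ih' rfl
      exact ⟨L, S₁, C₁, hts, hr, .mix_right h hf⟩
  | @cut s t A S S' C C' h h' ih ih' =>
    rcases singleton_add_eq_add hS with ⟨N, rfl, rfl⟩ | ⟨N, rfl, rfl⟩
    · obtain ⟨L, S₁, C₁, hts, hr, hf⟩ := ih (S₀ := {(s, A)} + N) (by abel)
      exact ⟨L, S₁, C₁, hts, hr, hf.cut_left h'⟩
    · obtain ⟨L, S₁, C₁, hts, hr, hf⟩ := ih' (S₀ := {(t, A.orth)} + N) (by abel)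
      exact ⟨L, S₁, C₁, hts, hr, .cut_right h hf⟩
  | @neg ψ B S C L hψ h ih =>
    -- Either the given tree is the one introduced by this last rule, and the frame is trivial, or
    -- it was already a tree of the premise.
    rcases singleton_add_eq_singleton_add hS with ⟨e, rfl⟩ | ⟨N, rfl, rfl⟩
    · simp only [Prod.mk.injEq, Tree.node.injEq] at e
      obtain ⟨⟨rfl, rfl⟩, rfl⟩ := e
      exact ⟨L, _, C, rfl, .inl ⟨hψ, h⟩, .refl _ _ _⟩
    · obtain ⟨L', S₁, C₁, hts, hr, hf⟩ := ih (S₀ := (L : Multiset _) + N) (by abel)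
      exact ⟨L', S₁, C₁, hts, hr, .neg hψ hf⟩
  | @pos ψ B S C L hψ h ih =>
    rcases singleton_add_eq_singleton_add hS with ⟨e, rfl⟩ | ⟨N, rfl, rfl⟩
    · simp only [Prod.mk.injEq, Tree.node.injEq] at e
      obtain ⟨⟨rfl, rfl⟩, rfl⟩ := e
      exact ⟨L, _, C, rfl, .inr ⟨hψ, h⟩, .refl _ _ _⟩
    · obtain ⟨L', S₁, C₁, hts, hr, hf⟩ := ih rfl
      exact ⟨L', S₁, C₁, hts, hr, .pos hψ hf⟩
  | nil => simp at hS
  | @cons a S S' C C' L h h' ih ih' =>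
    rcases singleton_add_eq_add hS with ⟨N, rfl, rfl⟩ | ⟨N, rfl, rfl⟩
    · obtain ⟨L, S₁, C₁, hts, hr, hf⟩ := ih (S₀ := {a} + N) (by abel)
      exact ⟨L, S₁, C₁, hts, hr, hf.cons_left h'⟩
    · obtain ⟨L, S₁, C₁, hts, hr, hf⟩ := ih' rfl
      exact ⟨L, S₁, C₁, hts, hr, .cons_right h hf⟩

/-- The cut rule that introduces a cut, as it occurs in a derivation. -/
theorem Seq.exists_cut (h : Seq T o S C) {s t : Tree k Var} (hC : {(s, t)} + C₀ = C) :
    ∃ (A : Formula Atom) (S₁ S₂ : Multiset (Tree k Var × Formula Atom))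
      (C₁ C₂ : Multiset (Cut k Var)), Seq T none ({(s, A)} + S₁) C₁ ∧
      Seq T none ({(t, A.orth)} + S₂) C₂ ∧ Frame T (S₁ + S₂) (C₁ + C₂) o S C₀ := by
  induction h generalizing C₀ with
  | ax x B _ => simp at hC
  | mix h h' ih ih' =>
    rcases singleton_add_eq_add hC with ⟨N, rfl, rfl⟩ | ⟨N, rfl, rfl⟩
    · obtain ⟨A, S₁, S₂, C₁, C₂, h1, h2, hf⟩ := ih rfl
      exact ⟨A, S₁, S₂, C₁, C₂, h1, h2, hf.mix_left h'⟩
    · obtain ⟨A, S₁, S₂, C₁, C₂, h1, h2, hf⟩ := ih' rfl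
      exact ⟨A, S₁, S₂, C₁, C₂, h1, h2, .mix_right h hf⟩
  | @cut s' t' A S S' C C' h h' ih ih' =>
    rcases singleton_add_eq_singleton_add hC with ⟨e, rfl⟩ | ⟨N, e, rfl⟩
    · simp only [Prod.mk.injEq] at e
      obtain ⟨rfl, rfl⟩ := e
      exact ⟨A, S, S', C, C', h, h', .refl _ _ _⟩
    · rcases singleton_add_eq_add e.symm with ⟨N, rfl, rfl⟩ | ⟨N, rfl, rfl⟩
      · obtain ⟨B, S₁, S₂, C₁, C₂, h1, h2, hf⟩ := ih rfl
        exact ⟨B, S₁, S₂, C₁, C₂, h1, h2, hf.cut_left h'⟩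
      · obtain ⟨B, S₁, S₂, C₁, C₂, h1, h2, hf⟩ := ih' rfl
        exact ⟨B, S₁, S₂, C₁, C₂, h1, h2, .cut_right h hf⟩
  | neg hψ h ih =>
    obtain ⟨B, S₁, S₂, C₁, C₂, h1, h2, hf⟩ := ih hC
    exact ⟨B, S₁, S₂, C₁, C₂, h1, h2, .neg hψ hf⟩
  | pos hψ h ih =>
    obtain ⟨B, S₁, S₂, C₁, C₂, h1, h2, hf⟩ := ih hC
    exact ⟨B, S₁, S₂, C₁, C₂, h1, h2, .pos hψ hf⟩
  | nil => simp at hC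
  | cons h h' ih ih' =>
    rcases singleton_add_eq_add hC with ⟨N, rfl, rfl⟩ | ⟨N, rfl, rfl⟩
    · obtain ⟨A, S₁, S₂, C₁, C₂, h1, h2, hf⟩ := ih rfl
      exact ⟨A, S₁, S₂, C₁, C₂, h1, h2, hf.cons_left h'⟩
    · obtain ⟨A, S₁, S₂, C₁, C₂, h1, h2, hf⟩ := ih' rfl
      exact ⟨A, S₁, S₂, C₁, C₂, h1, h2, .cons_right h hf⟩

/-- Derivability does not depend on the orientation of the cuts. -/
theorem Seq.swap {s t : Tree k Var} (h : Seq T o S ({(s, t)} + C)) : Seq T o S ({(t, s)} + C) := by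
  obtain ⟨A, S₁, S₂, C₁, C₂, h1, h2, hf⟩ := h.exists_cut rfl
  -- Negation is involutive, so the two premises of the cut can exchange their roles.
  have := Seq.cut h2 ((Formula.orth_orth A).symm ▸ h1)
  have := hf 0 {(t, s)} (this.cast (by abel) (by abel))
  exact this.cast (by abel) rfl

theorem Seq.some_cons {a : Tree k Var × Formula Atom} {L : List (Tree k Var × Formula Atom)}
    (h : Seq T (some (a :: L)) S C) : ∃ S₁ S₂ C₁ C₂, S = S₁ + S₂ ∧ C = C₁ + C₂ ∧
      Seq T none ({a} + S₁) C₁ ∧ Seq T (some L) S₂ C₂ := by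
  cases h with | cons h h' => exact ⟨_, _, _, _, rfl, rfl, h, h'⟩

theorem Seq.some_nil (h : Seq T (some []) S C) : S = 0 ∧ C = 0 := by
  cases h; exact ⟨rfl, rfl⟩

theorem Seq.some_append {L L' : List (Tree k Var × Formula Atom)} (h : Seq T (some L) S C)
    (h' : Seq T (some L') S' C') : Seq T (some (L ++ L')) (S + S') (C + C') := by
  induction L generalizing S C with
  | nil =>
    obtain ⟨rfl, rfl⟩ := h.some_nil
    exact h'.cast (by abel) (by abel)
  | cons a L ih =>
    obtain ⟨S₁, S₂, C₁, C₂, rfl, rfl, h1, h2⟩ := h.some_cons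
    exact (Seq.cons h1 (ih h2)).cast (by abel) (by abel)

theorem Seq.exists_of_some_append {L L' : List (Tree k Var × Formula Atom)}
    (h : Seq T (some (L ++ L')) S C) : ∃ S₁ S₂ C₁ C₂, S = S₁ + S₂ ∧ C = C₁ + C₂ ∧
      Seq T (some L) S₁ C₁ ∧ Seq T (some L') S₂ C₂ := by
  induction L generalizing S C with
  | nil => exact ⟨0, S, 0, C, by simp, by simp, .nil, h⟩
  | cons a L ih =>
    obtain ⟨S₁, S₂, C₁, C₂, rfl, rfl, h1, h2⟩ := Seq.some_cons h
    obtain ⟨S₃, S₄, C₃, C₄, rfl, rfl, h3, h4⟩ := ih h2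
    exact ⟨_, S₄, _, C₄, by abel, by abel, h1.cons h3, h4⟩

/-- Replacement of an argument of a constructor. -/
theorem Seq.exists_argument {φ : Con k Var} {us vs : List (Tree k Var)} {t : Tree k Var}
    {A : Formula Atom} (h : Seq T none ({(.node φ (us ++ t :: vs), A)} + S) C) :
    ∃ (B : Formula Atom) (S₁ : Multiset (Tree k Var × Formula Atom)) (C₁ : Multiset (Cut k Var)),
      Seq T none ({(t, B)} + S₁) C₁ ∧ ∀ w D, Seq T none ({(w, B)} + S₁) (D + C₁) →
        Seq T none ({(.node φ (us ++ w :: vs), A)} + S) (D + C) := by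
  obtain ⟨L, S₁, C₁, hts, hr, hf⟩ := h.exists_rule rfl
  obtain ⟨L₁, L₂, rfl, rfl, e⟩ := List.append_eq_map_iff.1 hts
  obtain ⟨⟨t, B⟩, L₃, rfl, rfl, rfl⟩ := List.map_eq_cons_iff.1 e
  -- For a negative constructor the other arguments stay in the same premise as `t`. For a positive
  -- one `t` has a premise of its own, and the remaining premises are reassembled around the new
  -- one.
  rcases hr with ⟨hr, h1⟩ | ⟨hr, h1⟩
  · refine ⟨B, (L₁ : Multiset _) + (L₃ : Multiset _) + S₁, C₁, h1.cast ?_ rfl, fun w D hw => ?_⟩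
    · rw [← Multiset.coe_add, ← Multiset.cons_coe, ← Multiset.singleton_add]; abel
    · have h2 : Seq T none (((L₁ ++ (w, B) :: L₃ : List _) : Multiset _) + S₁) (D + C₁) := by
        refine hw.cast ?_ rfl
        rw [← Multiset.coe_add, ← Multiset.cons_coe, ← Multiset.singleton_add]; abel
      have h3 := Seq.neg (φ := φ) (B := A) (by simpa using hr) h2
      simpa using hf _ D h3
  · obtain ⟨S₂, S₃, C₂, C₃, rfl, rfl, h2, h3⟩ := h1.exists_of_some_append
    obtain ⟨S₄, S₅, C₄, C₅, rfl, rfl, h4, h5⟩ := h3.some_cons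
    refine ⟨B, S₄, C₄, h4, fun w D hw => ?_⟩
    have h6 := Seq.pos (φ := φ) (B := A) (by simpa using hr) (h2.some_append (hw.cons h5))
    exact hf {(.node φ (L₁.map Prod.fst ++ w :: L₃.map Prod.fst), A)} D
      (h6.cast (by simp) (by abel))

end Judgment

-- Multisets of occurrences of variables.

section Occurrences

variable {k : Type u} {Var : Type v} {Atom : Type w}

/-- The occurrences of variables in a collection of typed trees. -/
def treeOcc (S : Multiset (Tree k Var × Formula Atom)) : Multiset Var :=
  S.bind fun a => (a.1.vars : Multiset Var)

/-- The occurrences of variables in a collection of cuts. -/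
def cutOcc (C : Multiset (Cut k Var)) : Multiset Var :=
  C.bind fun c => (Cut.vars c : Multiset Var)

/-- The occurrences of variables in the index of a judgment. -/
def indexOcc : Option (List (Tree k Var × Formula Atom)) → Multiset Var
  | none => 0
  | some L => treeOcc (Multiset.ofList L)

@[simp] theorem treeOcc_zero : treeOcc (0 : Multiset (Tree k Var × Formula Atom)) = 0 := rfl

@[simp] theorem treeOcc_add (S S' : Multiset (Tree k Var × Formula Atom)) :
    treeOcc (S + S') = treeOcc S + treeOcc S' := Multiset.add_bind _ _ _

@[simp] theorem treeOcc_cons (a : Tree k Var × Formula Atom)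
    (S : Multiset (Tree k Var × Formula Atom)) :
    treeOcc (a ::ₘ S) = (a.1.vars : Multiset Var) + treeOcc S := Multiset.cons_bind _ _ _

@[simp] theorem treeOcc_singleton (a : Tree k Var × Formula Atom) :
    treeOcc {a} = (a.1.vars : Multiset Var) := Multiset.singleton_bind _ _

theorem treeOcc_coe (L : List (Tree k Var × Formula Atom)) :
    treeOcc (Multiset.ofList L) = Multiset.ofList ((L.map Prod.fst).flatMap Tree.vars) := by
  simp [treeOcc, Multiset.coe_bind, List.flatMap_map]

@[simp] theorem treeOcc_node (φ : Con k Var) (L : List (Tree k Var × Formula Atom))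
    (B : Formula Atom) : treeOcc {(.node φ (L.map Prod.fst), B)} = treeOcc (Multiset.ofList L) := by
  rw [treeOcc_singleton, treeOcc_coe, Tree.vars_node]

@[simp] theorem cutOcc_zero : cutOcc (0 : Multiset (Cut k Var)) = 0 := rfl

@[simp] theorem cutOcc_add (C C' : Multiset (Cut k Var)) :
    cutOcc (C + C') = cutOcc C + cutOcc C' := Multiset.add_bind _ _ _

@[simp] theorem cutOcc_singleton (c : Cut k Var) :
    cutOcc {c} = (c.1.vars : Multiset Var) + (c.2.vars : Multiset Var) := by
  rw [cutOcc, Multiset.singleton_bind, Cut.vars, Multiset.coe_add]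

theorem cutOcc_coe (cs : List (Cut k Var)) :
    cutOcc (Multiset.ofList cs) = Multiset.ofList (cs.flatMap Cut.vars) := by
  simp [cutOcc, Multiset.coe_bind]

@[simp] theorem indexOcc_none :
    indexOcc (none : Option (List (Tree k Var × Formula Atom))) = 0 := rfl

@[simp] theorem indexOcc_nil :
    indexOcc (some ([] : List (Tree k Var × Formula Atom))) = 0 := rfl

theorem indexOcc_some (L : List (Tree k Var × Formula Atom)) :
    indexOcc (some L) = treeOcc (Multiset.ofList L) := rfl

@[simp] theorem indexOcc_cons (a : Tree k Var × Formula Atom)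
    (L : List (Tree k Var × Formula Atom)) :
    indexOcc (some (a :: L)) = (a.1.vars : Multiset Var) + indexOcc (some L) := by
  simp [indexOcc, ← Multiset.cons_coe]

/-- All occurrences of variables in a judgment. -/
def occ (o : Option (List (Tree k Var × Formula Atom)))
    (S : Multiset (Tree k Var × Formula Atom)) (C : Multiset (Cut k Var)) : Multiset Var :=
  indexOcc o + treeOcc S + cutOcc C

/-- The occurrences in a conclusion are the sum of those in the premises, for this rule and for the
ones below. Linearity of a conclusion thus passes to its premises and makes them disjoint, so `Seq`
need not contain such conditions. -/
theorem occ_mix (S S' : Multiset (Tree k Var × Formula Atom)) (C C' : Multiset (Cut k Var)) :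
    occ none (S + S') (C + C') = occ none S C + occ none S' C' := by
  simp [occ]; abel

theorem occ_cut (s t : Tree k Var) (A B : Formula Atom)
    (S S' : Multiset (Tree k Var × Formula Atom)) (C C' : Multiset (Cut k Var)) :
    occ none (S + S') ({(s, t)} + (C + C')) =
      occ none ({(s, A)} + S) C + occ none ({(t, B)} + S') C' := by
  simp only [occ, treeOcc_add, treeOcc_singleton, cutOcc_add, cutOcc_singleton, indexOcc_none]; abel

theorem occ_neg (φ : Con k Var) (L : List (Tree k Var × Formula Atom)) (B : Formula Atom)
    (S : Multiset (Tree k Var × Formula Atom)) (C : Multiset (Cut k Var)) :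
    occ none ({(.node φ (L.map Prod.fst), B)} + S) C = occ none ((L : Multiset _) + S) C := by
  simp only [occ, treeOcc_add, treeOcc_node]

theorem occ_pos (φ : Con k Var) (L : List (Tree k Var × Formula Atom)) (B : Formula Atom)
    (S : Multiset (Tree k Var × Formula Atom)) (C : Multiset (Cut k Var)) :
    occ none ({(.node φ (L.map Prod.fst), B)} + S) C = occ (some L) S C := by
  simp only [occ, treeOcc_add, treeOcc_node, indexOcc_some, indexOcc_none, zero_add]

theorem occ_cons (a : Tree k Var × Formula Atom) (L : List (Tree k Var × Formula Atom))
    (S S' : Multiset (Tree k Var × Formula Atom)) (C C' : Multiset (Cut k Var)) :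
    occ (some (a :: L)) (S + S') (C + C') = occ none ({a} + S) C + occ (some L) S' C' := by
  simp [occ]; abel

/-- Substitution in a typed tree. -/
def bindTyped (f : Var → Tree k Var) (a : Tree k Var × Formula Atom) : Tree k Var × Formula Atom :=
  (a.1.bind f, a.2)

/-- Substitution in a cut. -/
def bindCut (f : Var → Tree k Var) (c : Cut k Var) : Cut k Var := (c.1.bind f, c.2.bind f)

theorem map_fst_bindTyped (f : Var → Tree k Var) (L : List (Tree k Var × Formula Atom)) :
    (L.map (bindTyped f)).map Prod.fst = (L.map Prod.fst).map (Tree.bind f) := by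
  simp [bindTyped]

theorem map_snd_bindTyped (f : Var → Tree k Var) (L : List (Tree k Var × Formula Atom)) :
    (L.map (bindTyped f)).map Prod.snd = L.map Prod.snd := by
  simp [bindTyped]

theorem bindTyped_node (f : Var → Tree k Var) (φ : Con k Var)
    (L : List (Tree k Var × Formula Atom)) (B : Formula Atom) :
    bindTyped f (.node φ (L.map Prod.fst), B) =
      (.node φ ((L.map (bindTyped f)).map Prod.fst), B) := by
  rw [map_fst_bindTyped, bindTyped, Tree.bind_node]

theorem map_bindTyped_eq_self {S : Multiset (Tree k Var × Formula Atom)} {f : Var → Tree k Var}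
    (h : ∀ x ∈ treeOcc S, f x = .var x) : S.map (bindTyped f) = S := by
  refine (Multiset.map_congr rfl fun a ha => ?_).trans (Multiset.map_id _)
  exact Prod.ext (Tree.bind_eq_self _ fun x hx => h x (Multiset.mem_bind.2 ⟨a, ha, hx⟩)) rfl

theorem map_bindCut_eq_self {C : Multiset (Cut k Var)} {f : Var → Tree k Var}
    (h : ∀ x ∈ cutOcc C, f x = .var x) : C.map (bindCut f) = C := by
  refine (Multiset.map_congr rfl fun c hc => ?_).trans (Multiset.map_id _)
  have h' : ∀ x ∈ Cut.vars c, f x = .var x := fun x hx => h x (Multiset.mem_bind.2 ⟨c, hc, hx⟩)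
  exact Prod.ext (Tree.bind_eq_self _ fun x hx => h' x (by simp [Cut.vars, hx]))
    (Tree.bind_eq_self _ fun x hx => h' x (by simp [Cut.vars, hx]))

end Occurrences

-- Bound variables, and substitution in linear derivations.

section Linearity

variable {k : Type u} {Var : Type v} {Atom : Type w} [CoInvol Var] [CoInvol Atom] [CommSemiring k]
  {T : Var → Formula Atom → Prop} {o : Option (List (Tree k Var × Formula Atom))}
  {S S' S₀ S₁ : Multiset (Tree k Var × Formula Atom)} {C C' C₀ C₁ : Multiset (Cut k Var)}

open Classical in
/-- A variable and its covariable have the same number of occurrences. -/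
theorem Seq.count_co (h : Seq T o S C) (y : Var) :
    (occ o S C).count (CoInvol.co y) = (occ o S C).count y := by
  induction h with
  | ax x A _ =>
    by_cases h1 : x = y
    · subst h1
      simp [occ, CoInvol.co_ne, (CoInvol.co_ne x).symm]
    · by_cases h2 : x = CoInvol.co y
      · subst h2
        simp [occ, CoInvol.co_ne, (CoInvol.co_ne y).symm]
      · have h3 : y ≠ CoInvol.co x := fun h => h2 (by rw [h, CoInvol.co_co])
        simp [occ, Ne.symm h1, Ne.symm h2, h3]
  | mix _ _ ih ih' => rw [occ_mix, Multiset.count_add, ih, ih', Multiset.count_add]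
  | cut _ _ ih ih' => rw [occ_cut, Multiset.count_add, ih, ih', Multiset.count_add]
  | neg _ _ ih => rw [occ_neg, ih]
  | pos _ _ ih => rw [occ_pos, ih]
  | nil => simp [occ]
  | cons _ _ ih ih' => rw [occ_cons, Multiset.count_add, ih, ih', Multiset.count_add]

/-- Every variable of a derivable judgment is bound, so any compatible renaming of a typable net is
an α-conversion. -/
theorem Seq.co_mem (h : Seq T o S C) {y : Var} (hy : y ∈ occ o S C) :
    CoInvol.co y ∈ occ o S C := by
  classical
  rw [← Multiset.one_le_count_iff_mem] at hy ⊢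
  rwa [h.count_co]

/-- Derivations are stable under the compatible renamings that preserve the admissible axioms. -/
theorem Seq.rename {T' : Var → Formula Atom → Prop} (σ : Var → Var)
    (hσ : ∀ x, σ (CoInvol.co x) = CoInvol.co (σ x)) (hT : ∀ x A, T x A → T' (σ x) A)
    (h : Seq T o S C) :
    Seq T' (o.map (List.map (bindTyped fun x => .var (σ x))))
      (S.map (bindTyped fun x => .var (σ x))) (C.map (bindCut fun x => .var (σ x))) := by
  induction h with
  | ax x A h =>
    simp only [Multiset.map_add, Multiset.map_singleton, bindTyped, Tree.bind_var, hσ,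
      Multiset.map_zero]
    exact .ax _ _ (hT x A h)
  | mix _ _ ih ih' =>
    simp only [Multiset.map_add]
    exact .mix ih ih'
  | cut _ _ ih ih' =>
    simp only [Multiset.map_add, Multiset.map_singleton, bindTyped] at ih ih' ⊢
    exact .cut ih ih'
  | neg hφ _ ih =>
    simp only [Multiset.map_add, Multiset.map_singleton, Multiset.map_coe] at ih ⊢
    rw [bindTyped_node]
    exact .neg (by rwa [map_snd_bindTyped]) ih
  | pos hφ _ ih =>
    simp only [Multiset.map_add, Multiset.map_singleton] at ih ⊢
    rw [bindTyped_node]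
    exact .pos (by rwa [map_snd_bindTyped]) ih
  | nil => exact .nil
  | cons _ _ ih ih' =>
    simp only [Multiset.map_add, Multiset.map_singleton] at ih ih' ⊢
    exact .cons ih ih'

theorem Seq.bind_of_forall {f : Var → Tree k Var} (h : Seq T o S C)
    (hf : ∀ x ∈ occ o S C, f x = .var x) :
    Seq T (o.map (List.map (bindTyped f))) (S.map (bindTyped f)) (C.map (bindCut f)) := by
  rw [map_bindTyped_eq_self fun x hx => hf x (by simp [occ, hx]),
    map_bindCut_eq_self fun x hx => hf x (by simp [occ, hx])]
  cases o with
  | none => exact h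
  | some L =>
    have : L.map (bindTyped f) = L := by
      refine (List.map_congr_left fun a ha => ?_).trans (List.map_id _)
      refine Prod.ext (Tree.bind_eq_self _ fun x hx => hf x ?_) rfl
      simp only [occ, Multiset.mem_add, indexOcc_some]
      exact .inl (.inl (Multiset.mem_bind.2 ⟨a, ha, hx⟩))
    rw [Option.map_some, this]
    exact h

open Classical in
/-- The substitution of `s` for `y`. -/
noncomputable def substFun (y : Var) (s : Tree k Var) (z : Var) : Tree k Var :=
  if z = y then s else .var z

-- If `x` does not occur then neither does its covariable, by `Seq.count_co`, and the substitution
-- does nothing. This treats the premises in which the eliminated variable is absent.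
open Classical in
theorem Seq.bind_of_count_eq_zero {x : Var} {s : Tree k Var} (h : Seq T o S C)
    (hx : (occ o S C).count x = 0) :
    Seq T (o.map (List.map (bindTyped (substFun (CoInvol.co x) s))))
      (S.map (bindTyped (substFun (CoInvol.co x) s)))
      (C.map (bindCut (substFun (CoInvol.co x) s))) := by
  refine h.bind_of_forall fun z hz => if_neg ?_
  rintro rfl
  rw [← h.count_co, Multiset.count_eq_zero] at hx
  exact hx hz

open Classical in
/-- Replacement of an axiom, one of whose variables is a tree of the conclusion. -/
theorem Seq.subst_tree {x : Var} {s : Tree k Var} {A : Formula Atom} (h : Seq T o S C)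
    (hS : {(.var x, A)} + S₀ = S) (hx : (occ o S C).count x ≤ 1)
    (hs : Seq T none ({(s, A.orth)} + S₁) C₁) :
    Seq T (o.map (List.map (bindTyped (substFun (CoInvol.co x) s))))
      (S₀.map (bindTyped (substFun (CoInvol.co x) s)) + S₁)
      (C.map (bindCut (substFun (CoInvol.co x) s)) + C₁) := by
  -- The tree `x` alone uses up the permitted occurrence, so `x` is absent from every premise that
  -- does not contain this tree.
  have mem : ∀ {N : Multiset (Tree k Var × Formula Atom)} {o C},
      1 ≤ (occ o ({((.var x : Tree k Var), A)} + N) C).count x := by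
    intro N o C
    simp only [occ, treeOcc_add, treeOcc_singleton, Tree.vars_var, Multiset.coe_singleton,
      Multiset.count_add, Multiset.count_singleton_self]
    omega
  induction h generalizing S₀ with
  | ax y B _ =>
    -- The tree `x` may be either end of the axiom. In both cases the other end is its covariable
    -- with the dual type, and becomes `s`.
    rcases singleton_add_eq_singleton_add hS with ⟨h, rfl⟩ | ⟨N, h, rfl⟩
    · simp only [Prod.mk.injEq, Tree.var.injEq] at h
      obtain ⟨rfl, rfl⟩ := h
      simpa [bindTyped, substFun] using hs
    · have hN : N = 0 := by simpa using congrArg Multiset.card h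
      subst hN
      simp only [add_zero, Multiset.singleton_inj, Prod.mk.injEq, Tree.var.injEq] at h
      obtain ⟨rfl, rfl⟩ := h
      simpa [bindTyped, substFun] using hs
  | @mix S S' C C' h h' ih ih' =>
    rw [occ_mix, Multiset.count_add] at hx
    rcases singleton_add_eq_add hS with ⟨N, rfl, rfl⟩ | ⟨N, rfl, rfl⟩
    · exact ((ih rfl (by omega)).mix (h'.bind_of_count_eq_zero (x := x) (s := s)
        (by have := mem (N := N) (o := none) (C := C); omega))).cast (by rw [Multiset.map_add]; abel)
        (by rw [Multiset.map_add]; abel)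
    · exact ((h.bind_of_count_eq_zero (x := x) (s := s)
        (by have := mem (N := N) (o := none) (C := C'); omega)).mix (ih' rfl (by omega))).cast
        (by rw [Multiset.map_add]; abel) (by rw [Multiset.map_add]; abel)
  | @cut u t B S S' C C' h h' ih ih' =>
    rw [occ_cut u t B B.orth, Multiset.count_add] at hx
    rcases singleton_add_eq_add hS with ⟨N, rfl, rfl⟩ | ⟨N, rfl, rfl⟩
    · have hx' : ({(u, B)} : Multiset _) + ({((.var x : Tree k Var), A)} + N) =
        {((.var x : Tree k Var), A)} + ({(u, B)} + N) := by abel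
      rw [hx'] at hx ih
      have h1 := ih rfl (by omega)
      have h2 := h'.bind_of_count_eq_zero (x := x) (s := s)
        (by have := mem (N := {(u, B)} + N) (o := none) (C := C); omega)
      simp only [Multiset.map_add, Multiset.map_singleton] at h1 h2 ⊢
      exact ((h1.cast (add_assoc _ _ _) rfl).cut h2).cast (by abel) (by simp only [bindCut]; abel)
    · have hx' : ({(t, B.orth)} : Multiset _) + ({((.var x : Tree k Var), A)} + N) =
        {((.var x : Tree k Var), A)} + ({(t, B.orth)} + N) := by abel
      rw [hx'] at hx ih'
      have h1 := ih' rfl (by omega)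
      have h2 := h.bind_of_count_eq_zero (x := x) (s := s)
        (by have := mem (N := {(t, B.orth)} + N) (o := none) (C := C'); omega)
      simp only [Multiset.map_add, Multiset.map_singleton] at h1 h2 ⊢
      exact (h2.cut (h1.cast (add_assoc _ _ _) rfl)).cast (by abel) (by simp only [bindCut]; abel)
  | @neg φ B S C L hφ h ih =>
    rcases singleton_add_eq_singleton_add hS with ⟨e, rfl⟩ | ⟨N, rfl, rfl⟩
    · simp at e
    · rw [occ_neg] at hx
      have h1 := ih (S₀ := (L : Multiset _) + N) (by abel) hx
      simp only [Multiset.map_add, Multiset.map_singleton, Multiset.map_coe, bindTyped_node] at h1 ⊢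
      exact (Seq.neg (by rwa [map_snd_bindTyped]) (h1.cast (add_assoc _ _ _) rfl)).cast
        (by abel) rfl
  | @pos φ B S C L hφ h ih =>
    rcases singleton_add_eq_singleton_add hS with ⟨e, rfl⟩ | ⟨N, rfl, rfl⟩
    · simp at e
    · rw [occ_pos] at hx
      have h1 := ih rfl hx
      simp only [Multiset.map_add, Multiset.map_singleton, bindTyped_node] at h1 ⊢
      exact (Seq.pos (by rwa [map_snd_bindTyped]) h1).cast (by abel) rfl
  | nil => simp at hS
  | @cons a S S' C C' L h h' ih ih' =>
    rw [occ_cons, Multiset.count_add] at hx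
    rcases singleton_add_eq_add hS with ⟨N, rfl, rfl⟩ | ⟨N, rfl, rfl⟩
    · have hx' : ({a} : Multiset _) + ({((.var x : Tree k Var), A)} + N) =
        {((.var x : Tree k Var), A)} + ({a} + N) := by abel
      rw [hx'] at hx ih
      have h1 := ih rfl (by omega)
      have h2 := h'.bind_of_count_eq_zero (x := x) (s := s)
        (by have := mem (N := {a} + N) (o := none) (C := C); omega)
      simp only [Multiset.map_add, Multiset.map_singleton] at h1 h2 ⊢
      exact ((h1.cast (add_assoc _ _ _) rfl).cons h2).cast (by abel) (by abel)
    · have h1 := ih' rfl (by have := mem (N := N) (o := some L) (C := C'); omega)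
      have h2 := h.bind_of_count_eq_zero (x := x) (s := s)
        (by have := mem (N := N) (o := some L) (C := C'); omega)
      simp only [Multiset.map_add, Multiset.map_singleton] at h1 h2 ⊢
      exact (h2.cons h1).cast (by abel) (by abel)

open Classical in
/-- Elimination of a cut on a variable. -/
theorem Seq.subst_cut {x : Var} {s : Tree k Var} (h : Seq T o S C)
    (hC : {(.var x, s)} + C₀ = C) (hx : (occ o S C).count x ≤ 1) :
    Seq T (o.map (List.map (bindTyped (substFun (CoInvol.co x) s))))
      (S.map (bindTyped (substFun (CoInvol.co x) s)))
      (C₀.map (bindCut (substFun (CoInvol.co x) s))) := by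
  have mem : ∀ {o S} {N : Multiset (Cut k Var)},
      1 ≤ (occ (Atom := Atom) o S ({((.var x : Tree k Var), s)} + N)).count x := by
    intro o S N
    simp only [occ, cutOcc_add, cutOcc_singleton, Tree.vars_var, Multiset.coe_singleton,
      Multiset.count_add, Multiset.count_singleton_self]
    omega
  induction h generalizing C₀ with
  | ax y B _ => simp at hC
  | @mix S S' C C' h h' ih ih' =>
    rw [occ_mix, Multiset.count_add] at hx
    simp only [Multiset.map_add]
    rcases singleton_add_eq_add hC with ⟨N, rfl, rfl⟩ | ⟨N, rfl, rfl⟩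
    · rw [Multiset.map_add]
      exact (ih rfl (by omega)).mix (h'.bind_of_count_eq_zero (x := x) (s := s)
        (by have := mem (N := N) (o := none) (S := S); omega))
    · rw [Multiset.map_add]
      exact (h.bind_of_count_eq_zero (x := x) (s := s)
        (by have := mem (N := N) (o := none) (S := S'); omega)).mix (ih' rfl (by omega))
  | @cut u t B S S' C C' h h' ih ih' =>
    rw [occ_cut u t B B.orth, Multiset.count_add] at hx
    rcases singleton_add_eq_singleton_add hC with ⟨e, rfl⟩ | ⟨N, e, rfl⟩
    · simp only [Prod.mk.injEq] at e
      obtain ⟨rfl, rfl⟩ := e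
      have mem' : 1 ≤ (occ none ({((.var x : Tree k Var), B)} + S) C).count x := by
        simp only [occ, treeOcc_add, treeOcc_singleton, Tree.vars_var, Multiset.coe_singleton,
          Multiset.count_add, Multiset.count_singleton_self]
        omega
      -- Inside the premise of `x`, the derivation of `s` takes the place of the axiom on `x`.
      have h1 := h.subst_tree rfl (by omega) h'
      have h2 := h'.bind_of_count_eq_zero (x := x) (s := s) (by omega)
      -- The occurrence of `x` lies in the left premise, so neither `x` nor its covariable occurs in
      -- the derivation of `s`, and its other trees and cuts are unchanged.
      have h3 : ∀ z ∈ occ none ({(s, B.orth)} + S') C',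
          substFun (CoInvol.co x) s z = .var z := fun z hz => if_neg <| by
        rintro rfl
        have : (occ none ({(s, B.orth)} + S') C').count x = 0 := by omega
        rw [← h'.count_co, Multiset.count_eq_zero] at this
        exact this hz
      refine h1.cast ?_ ?_
      · rw [Multiset.map_add, map_bindTyped_eq_self (S := S') fun z hz => h3 z (by simp [occ, hz])]
      · rw [Multiset.map_add, map_bindCut_eq_self (C := C') fun z hz => h3 z (by simp [occ, hz])]
    · rcases singleton_add_eq_add e.symm with ⟨N, rfl, rfl⟩ | ⟨N, rfl, rfl⟩
      · have h1 := ih rfl (by omega)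
        have h2 := h'.bind_of_count_eq_zero (x := x) (s := s)
          (by have := mem (N := N) (o := none) (S := {(u, B)} + S); omega)
        simp only [Multiset.map_add, Multiset.map_singleton] at h1 h2 ⊢
        exact h1.cut h2
      · have h1 := ih' rfl (by omega)
        have h2 := h.bind_of_count_eq_zero (x := x) (s := s)
          (by have := mem (N := N) (o := none) (S := {(t, B.orth)} + S'); omega)
        simp only [Multiset.map_add, Multiset.map_singleton] at h1 h2 ⊢
        exact h2.cut h1
  | @neg φ B S C L hφ h ih =>
    rw [occ_neg] at hx
    have h1 := ih hC hx
    simp only [Multiset.map_add, Multiset.map_singleton, Multiset.map_coe, bindTyped_node] at h1 ⊢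
    exact Seq.neg (by rwa [map_snd_bindTyped]) h1
  | @pos φ B S C L hφ h ih =>
    rw [occ_pos] at hx
    have h1 := ih hC hx
    simp only [Multiset.map_add, Multiset.map_singleton, bindTyped_node] at h1 ⊢
    exact Seq.pos (by rwa [map_snd_bindTyped]) h1
  | nil => simp at hC
  | @cons a S S' C C' L h h' ih ih' =>
    rw [occ_cons, Multiset.count_add] at hx
    rcases singleton_add_eq_add hC with ⟨N, rfl, rfl⟩ | ⟨N, rfl, rfl⟩
    · have h1 := ih rfl (by omega)
      have h2 := h'.bind_of_count_eq_zero (x := x) (s := s)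
        (by have := mem (N := N) (o := none) (S := {a} + S); omega)
      simp only [Multiset.map_add, Multiset.map_singleton] at h1 h2 ⊢
      exact h1.cons h2
    · have h1 := ih' rfl (by omega)
      have h2 := h.bind_of_count_eq_zero (x := x) (s := s)
        (by have := mem (N := N) (o := some L) (S := S'); omega)
      simp only [Multiset.map_add, Multiset.map_singleton] at h1 h2 ⊢
      exact h2.cons h1

end Linearity

-- Typing the axioms in an extension of a context.

section Contexts

variable {k : Type u} {Var : Type v} {Atom : Type w} [CoInvol Var] [CoInvol Atom]

theorem Logic.mono {Φ Φ' : TypingContext Var Atom} (hΦ : Φ'.Extends Φ) {p : Net k Var}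
    {Γ : List (Formula Atom)} (h : Logic Φ p Γ) : Logic Φ' p Γ := by
  induction h with
  | ax x A h h' => exact .ax x A (hΦ _ _ h) (hΦ _ _ h')
  | perm t cs A σ _ ih => exact .perm t cs A σ ih
  | cut ss ts s t cs ds Γ Δ A _ _ h ih ih' => exact .cut ss ts s t cs ds Γ Δ A ih ih' h
  | par ts s t cs Γ A B _ ih => exact .par ts s t cs Γ A B ih
  | tens ss ts s t cs ds Γ Δ A B _ _ h ih ih' => exact .tens ss ts s t cs ds Γ Δ A B ih ih' h
  | mix ss ts cs ds Γ Δ _ _ h ih ih' => exact .mix ss ts cs ds Γ Δ ih ih' h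
  | weak ss cs Γ A _ ih => exact .weak ss cs Γ A ih
  | coweak A => exact .coweak A
  | der ss s cs Γ A _ ih => exact .der ss s cs Γ A ih
  | coder ss s cs Γ A _ ih => exact .coder ss s cs Γ A ih
  | contr ss s₁ s₂ cs Γ A _ ih => exact .contr ss s₁ s₂ cs Γ A ih
  | cocontr ss ts s t cs ds Γ Δ A _ _ h ih ih' =>
    exact .cocontr ss ts s t cs ds Γ Δ A ih ih' h
  | prom P ts t cs Γ A B _ _ h ih ih' => exact .prom P ts t cs Γ A B ih ih' h

/-- Axioms that are typed in a context. -/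
def TypingContext.Admits (Φ : TypingContext Var Atom) (x : Var) (A : Formula Atom) : Prop :=
  Φ.toFun x = some A ∧ Φ.toFun (CoInvol.co x) = some A.orth

theorem TypingContext.Admits.mono {Φ Φ' : TypingContext Var Atom} (hΦ : Φ'.Extends Φ) {x : Var}
    {A : Formula Atom} (h : Φ.Admits x A) : Φ'.Admits x A :=
  ⟨hΦ _ _ h.1, hΦ _ _ h.2⟩

/-- The last clause bounds the new domain. It is what allows extensions for disjoint premises to be
chained. -/
theorem TypingContext.exists_extension (Φ : TypingContext Var Atom) (x : Var) (A : Formula Atom)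
    (hx : Φ.toFun x = none) (hx' : Φ.toFun (CoInvol.co x) = none) :
    ∃ Φ' : TypingContext Var Atom, Φ'.Extends Φ ∧ Φ'.Admits x A ∧
      ∀ y, Φ'.toFun y ≠ none → Φ.toFun y ≠ none ∨ y = x ∨ y = CoInvol.co x := by
  classical
  have hne := CoInvol.co_ne x
  let f : Var → Option (Formula Atom) := fun y =>
    if y = x then some A else if y = CoInvol.co x then some A.orth else Φ.toFun y
  have f1 : f x = some A := if_pos rfl
  have f2 : f (CoInvol.co x) = some A.orth := by simp [f, hne]
  have f3 : ∀ y, y ≠ x → y ≠ CoInvol.co x → f y = Φ.toFun y := fun y h h' => by simp [f, h, h']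
  refine ⟨⟨f, ?_, ?_⟩, ?_, ⟨f1, f2⟩, ?_⟩
  · refine (Φ.finite_dom.union (Set.toFinite {x, CoInvol.co x})).subset fun y hy => ?_
    by_cases h : y = x
    · simp [h]
    by_cases h' : y = CoInvol.co x
    · simp [h']
    · exact .inl (by simpa [f3 y h h'] using hy)
  · intro y B B' hB hB'
    by_cases h : y = x
    · subst h
      rw [f1] at hB
      rw [f2] at hB'
      simp only [Option.some.injEq] at hB hB'
      rw [← hB, ← hB']
    by_cases h' : y = CoInvol.co x
    · subst h'
      rw [f2] at hB
      rw [CoInvol.co_co, f1] at hB'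
      simp only [Option.some.injEq] at hB hB'
      rw [← hB, ← hB', Formula.orth_orth]
    · rw [f3 y h h'] at hB
      rw [f3 _ (by rwa [Ne, CoInvol.co_eq_comm]) (by rwa [Ne, CoInvol.co_inj])] at hB'
      exact Φ.compat y B B' hB hB'
  · intro y B hB
    rw [← hB]
    exact f3 y (by rintro rfl; simp [hx] at hB) (by rintro rfl; simp [hx'] at hB)
  · intro y hy
    by_cases h : y = x
    · exact .inr (.inl h)
    by_cases h' : y = CoInvol.co x
    · exact .inr (.inr h')
    · exact .inl (by rwa [← f3 y h h'])

variable [CommSemiring k] {T : Var → Formula Atom → Prop}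
  {o : Option (List (Tree k Var × Formula Atom))}
  {S : Multiset (Tree k Var × Formula Atom)} {C : Multiset (Cut k Var)}

/-- The axioms of a linear derivation can be typed in an extension of any context that is not
defined on its variables. -/
theorem Seq.exists_context (h : Seq T o S C) (hn : (occ o S C).Nodup)
    (Φ : TypingContext Var Atom) (hΦ : ∀ x ∈ occ o S C, Φ.toFun x = none) :
    ∃ Φ' : TypingContext Var Atom, Φ'.Extends Φ ∧
      (∀ x, Φ'.toFun x ≠ none → Φ.toFun x ≠ none ∨ x ∈ occ o S C) ∧ Seq Φ'.Admits o S C := by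
  -- Common to all rules with two premises. The context is first extended for the left premise; by
  -- the bound on its new domain and by disjointness, it is still undefined on the variables of the
  -- right one.
  have two : ∀ {o₁ o₂ : Option (List (Tree k Var × Formula Atom))} {S₁ S₂ C₁ C₂},
      (occ o₁ S₁ C₁ + occ o₂ S₂ C₂).Nodup →
      ((occ o₁ S₁ C₁).Nodup → ∀ Φ : TypingContext Var Atom,
        (∀ x ∈ occ o₁ S₁ C₁, Φ.toFun x = none) → ∃ Φ' : TypingContext Var Atom, Φ'.Extends Φ ∧
          (∀ x, Φ'.toFun x ≠ none → Φ.toFun x ≠ none ∨ x ∈ occ o₁ S₁ C₁) ∧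
          Seq Φ'.Admits o₁ S₁ C₁) →
      ((occ o₂ S₂ C₂).Nodup → ∀ Φ : TypingContext Var Atom,
        (∀ x ∈ occ o₂ S₂ C₂, Φ.toFun x = none) → ∃ Φ' : TypingContext Var Atom, Φ'.Extends Φ ∧
          (∀ x, Φ'.toFun x ≠ none → Φ.toFun x ≠ none ∨ x ∈ occ o₂ S₂ C₂) ∧
          Seq Φ'.Admits o₂ S₂ C₂) →
      ∀ Φ : TypingContext Var Atom, (∀ x ∈ occ o₁ S₁ C₁ + occ o₂ S₂ C₂, Φ.toFun x = none) →
      ∃ Φ' : TypingContext Var Atom, Φ'.Extends Φ ∧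
        (∀ x, Φ'.toFun x ≠ none → Φ.toFun x ≠ none ∨ x ∈ occ o₁ S₁ C₁ + occ o₂ S₂ C₂) ∧
        Seq Φ'.Admits o₁ S₁ C₁ ∧ Seq Φ'.Admits o₂ S₂ C₂ := by
    intro o₁ o₂ S₁ S₂ C₁ C₂ hn h₁ h₂ Φ hΦ
    obtain ⟨hn₁, hn₂, hd⟩ := Multiset.nodup_add.1 hn
    obtain ⟨Φ₁, he₁, hdom₁, hs₁⟩ := h₁ hn₁ Φ fun x hx => hΦ x (by simp [hx])
    obtain ⟨Φ₂, he₂, hdom₂, hs₂⟩ := h₂ hn₂ Φ₁ fun x hx => by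
      by_contra hne
      rcases hdom₁ x hne with h | h
      · exact h (hΦ x (by simp [hx]))
      · exact Multiset.disjoint_left.1 hd h hx
    refine ⟨Φ₂, he₂.trans he₁, fun x hx => ?_, hs₁.mono fun x A => .mono he₂, hs₂⟩
    rcases hdom₂ x hx with h | h
    · rcases hdom₁ x h with h | h
      · exact .inl h
      · exact .inr (by simp [h])
    · exact .inr (by simp [h])
  induction h generalizing Φ with
  | ax x A _ =>
    obtain ⟨Φ', h1, h2, h3⟩ := Φ.exists_extension x A (hΦ _ (by simp [occ])) (hΦ _ (by simp [occ]))
    refine ⟨Φ', h1, fun y hy => (h3 y hy).imp_right ?_, .ax x A h2⟩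
    simp [occ]
  | mix _ _ ih ih' =>
    rw [occ_mix] at hn hΦ ⊢
    obtain ⟨Φ', h1, h2, h3, h4⟩ := two hn ih ih' Φ hΦ
    exact ⟨Φ', h1, h2, h3.mix h4⟩
  | @cut s t A S S' C C' _ _ ih ih' =>
    rw [occ_cut s t A A.orth] at hn hΦ ⊢
    obtain ⟨Φ', h1, h2, h3, h4⟩ := two hn ih ih' Φ hΦ
    exact ⟨Φ', h1, h2, h3.cut h4⟩
  | neg hφ _ ih =>
    rw [occ_neg] at hn hΦ ⊢
    obtain ⟨Φ', h1, h2, h3⟩ := ih hn Φ hΦ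
    exact ⟨Φ', h1, h2, .neg hφ h3⟩
  | pos hφ _ ih =>
    rw [occ_pos] at hn hΦ ⊢
    obtain ⟨Φ', h1, h2, h3⟩ := ih hn Φ hΦ
    exact ⟨Φ', h1, h2, .pos hφ h3⟩
  | nil => exact ⟨Φ, .refl _, fun _ h => .inl h, .nil⟩
  | cons _ _ ih ih' =>
    rw [occ_cons] at hn hΦ ⊢
    obtain ⟨Φ', h1, h2, h3, h4⟩ := two hn ih ih' Φ hΦ
    exact ⟨Φ', h1, h2, h3.cons h4⟩

/-- Finitely many typable classes have representatives that are derivable in the same context. -/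
theorem exists_context_of_classes {Γ : List (Formula Atom)} (s : List (NetClass k Var))
    (hs : ∀ c ∈ s, IsNetClass Γ c) (Φ : TypingContext Var Atom) :
    ∃ Φ' : TypingContext Var Atom, Φ'.Extends Φ ∧
      ∀ c ∈ s, ∃ p : Net k Var, p.toClass = c ∧ Logic Φ' p Γ := by
  induction s with
  | nil => exact ⟨Φ, .refl _, by simp⟩
  | cons c s ih =>
    obtain ⟨Φ₁, h₁, hs₁⟩ := ih fun c hc => hs c (by simp [hc])
    obtain ⟨Φ₂, h₂, p, hp, hl⟩ := hs c (by simp) Φ₁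
    refine ⟨Φ₂, h₂.trans h₁, fun d hd => ?_⟩
    rcases List.mem_cons.1 hd with rfl | hd
    · exact ⟨p, hp, hl⟩
    · obtain ⟨q, hq, hl'⟩ := hs₁ d hd
      exact ⟨q, hq, hl'.mono h₂⟩

/-- A content may have untypable summands that contribute nothing. The reduced form, with one
derivable representative for each class in the support, denotes the same combination and satisfies
the premise of the promotion rule. -/
theorem IsNetSum.exists_sumEq {Γ : List (Formula Atom)} {P : FSum k Var} (h : IsNetSum Γ P)
    (Φ : TypingContext Var Atom) : ∃ Φ' : TypingContext Var Atom, Φ'.Extends Φ ∧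
      ∃ P' : FSum k Var, SumEq P P' ∧ ∀ a ∈ P', Logic Φ' a.2 Γ := by
  obtain ⟨Φ', hΦ', hs⟩ := exists_context_of_classes (Γ := Γ) (FSum.value P).support.toList
    (fun c hc => h c (by simpa using hc)) Φ
  -- The empty net is the default representative outside the support.
  have : Nonempty (Net k Var) := ⟨.mk [] []⟩
  choose! r hr hl using hs
  refine ⟨Φ', hΦ', (FSum.value P).support.toList.map fun c => (FSum.value P c, r c),
    .of_value_eq ?_, ?_⟩
  · have h1 : FSum.value P = ∑ c ∈ (FSum.value P).support,
        Finsupp.single c (FSum.value P c) := (Finsupp.sum_single _).symm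
    rw [← Finset.sum_map_toList] at h1
    refine h1.trans (congrArg List.sum ?_)
    rw [List.map_map]
    exact List.map_congr_left fun c hc => by simp [hr c hc]
  · intro a ha
    obtain ⟨c, hc, rfl⟩ := List.mem_map.1 ha
    exact hl c hc

end Contexts

-- The exchange rule on lists, and derivability up to identification of box contents.

section Sequentialization

variable {k : Type u} {Var : Type v} {Atom : Type w} [CoInvol Var] [CoInvol Atom]

/-- The exchange rule of `Logic` permutes indices, whereas `List.Perm` relates entries. Entries may
repeat, so the permutation is lifted to the duplicate-free list of indices. -/
theorem exists_equiv_of_perm {α : Type*} {l l' : List α} (h : l.Perm l') :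
    ∃ σ : Equiv.Perm (Fin l.length), l' = List.ofFn fun i => l.get (σ i) := by
  have h1 : l'.Perm ((List.finRange l.length).map l.get) := by
    rw [← List.ofFn_eq_map, List.ofFn_get]; exact h.symm
  obtain ⟨r, hr', hr⟩ : ∃ r : List (Fin l.length), l' = r.map l.get ∧ r.Perm (List.finRange l.length) := by
    have := congrFun (congrFun (List.eq_map_comp_perm l.get) l') (List.finRange l.length)
    simp only [eq_iff_iff] at this
    exact this.2 h1
  subst hr'
  have hlen : r.length = l.length := by simpa using hr.length_eq
  have hnd : r.Nodup := hr.nodup_iff.2 (List.nodup_finRange _)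
  let f : Fin l.length → Fin l.length := fun i => r.get (i.cast hlen.symm)
  have hf : Function.Injective f := fun i j hij => by
    simpa using hnd.injective_get hij
  refine ⟨Equiv.ofBijective f (Finite.injective_iff_bijective.1 hf), ?_⟩
  refine List.ext_get (by simp [hlen]) fun i h1 h2 => ?_
  simp [f]

theorem Logic.perm_list {Φ : TypingContext Var Atom} {l l' : List (Tree k Var × Formula Atom)}
    {cs : List (Cut k Var)} (h : Logic Φ (.mk (l.map Prod.fst) cs) (l.map Prod.snd))
    (hl : l.Perm l') : Logic Φ (.mk (l'.map Prod.fst) cs) (l'.map Prod.snd) := by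
  obtain ⟨σ, rfl⟩ := exists_equiv_of_perm hl
  have h1 : l.map Prod.fst = List.ofFn fun i => (l.get i).1 := by
    conv_lhs => rw [← List.ofFn_get l, List.map_ofFn]
    rfl
  have h2 : l.map Prod.snd = List.ofFn fun i => (l.get i).2 := by
    conv_lhs => rw [← List.ofFn_get l, List.map_ofFn]
    rfl
  rw [h1, h2] at h
  have := Logic.perm _ cs _ σ h
  simpa [List.map_ofFn, Function.comp_def] using this

variable [CommSemiring k]

/-- Equality of typed trees up to identification of the contents of boxes. -/
def TypedEq (a b : Tree k Var × Formula Atom) : Prop := TreeEq a.1 b.1 ∧ a.2 = b.2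

/-- Derivability in a context, up to identification of the contents of boxes. -/
def LogicEq (Φ : TypingContext Var Atom) (l : List (Tree k Var × Formula Atom))
    (cs : List (Cut k Var)) : Prop :=
  ∃ (l' : List (Tree k Var × Formula Atom)) (cs' : List (Cut k Var)), List.Forall₂ TypedEq l l' ∧
    List.Forall₂ CutEq cs cs' ∧ Logic Φ (.mk (l'.map Prod.fst) cs') (l'.map Prod.snd)

theorem LogicEq.mono {Φ Φ' : TypingContext Var Atom} (hΦ : Φ'.Extends Φ)
    {l : List (Tree k Var × Formula Atom)} {cs : List (Cut k Var)} (h : LogicEq Φ l cs) :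
    LogicEq Φ' l cs := by
  obtain ⟨l', cs', h1, h2, h3⟩ := h
  exact ⟨l', cs', h1, h2, h3.mono hΦ⟩

theorem LogicEq.perm {Φ : TypingContext Var Atom} {l l₁ : List (Tree k Var × Formula Atom)}
    {cs : List (Cut k Var)} (h : LogicEq Φ l cs) (hl : l₁.Perm l) : LogicEq Φ l₁ cs := by
  obtain ⟨l', cs', h1, h2, h3⟩ := h
  obtain ⟨l₂, h4, h5⟩ := List.perm_comp_forall₂ hl h1
  exact ⟨l₂, cs', h4, h2, h3.perm_list h5.symm⟩

theorem TypedEq.forall₂_map_fst {l l' : List (Tree k Var × Formula Atom)}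
    (h : List.Forall₂ TypedEq l l') : List.Forall₂ TreeEq (l.map Prod.fst) (l'.map Prod.fst) := by
  simp only [List.forall₂_map_left_iff, List.forall₂_map_right_iff]
  exact h.imp fun _ _ h => h.1

theorem TypedEq.map_snd_eq {l l' : List (Tree k Var × Formula Atom)}
    (h : List.Forall₂ TypedEq l l') : l.map Prod.snd = l'.map Prod.snd := by
  induction h with
  | nil => rfl
  | cons h _ ih => rw [List.map_cons, List.map_cons, h.2, ih]

theorem CutEq.rel_of_forall₂ {cs cs' : List (Cut k Var)} (h : List.Forall₂ CutEq cs cs') :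
    Multiset.Rel CutEq (Multiset.ofList cs) (Multiset.ofList cs') := by
  induction h with
  | nil => exact .zero
  | cons h _ ih => exact .cons h ih

theorem mem_vars_iff_of_forall₂ {l l' : List (Tree k Var × Formula Atom)}
    {cs cs' : List (Cut k Var)} (h : List.Forall₂ TypedEq l l') (h' : List.Forall₂ CutEq cs cs')
    (x : Var) : x ∈ (Net.mk (l'.map Prod.fst) cs').vars ↔
      x ∈ occ none (Multiset.ofList l) (Multiset.ofList cs) := by
  have := Net.StructEq.vars_perm (p := .mk (l.map Prod.fst) cs) (q := .mk (l'.map Prod.fst) cs')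
    ⟨TypedEq.forall₂_map_fst h, CutEq.rel_of_forall₂ h'⟩
  rw [← this.mem_iff, Net.vars_mk]
  simp [occ, treeOcc_coe, cutOcc_coe]

/-- The disjointness conditions of `Logic` come from the linearity of the conclusion. Replacing box
contents and turning cuts around does not change which variables occur. -/
theorem disjoint_vars_of_forall₂ {l₁ l₁' l₂ l₂' : List (Tree k Var × Formula Atom)}
    {cs₁ cs₁' cs₂ cs₂' : List (Cut k Var)} (h₁ : List.Forall₂ TypedEq l₁ l₁')
    (h₁' : List.Forall₂ CutEq cs₁ cs₁') (h₂ : List.Forall₂ TypedEq l₂ l₂')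
    (h₂' : List.Forall₂ CutEq cs₂ cs₂')
    (hn : (occ none (Multiset.ofList l₁) (Multiset.ofList cs₁) +
      occ none (Multiset.ofList l₂) (Multiset.ofList cs₂)).Nodup) :
    (Net.mk (l₁'.map Prod.fst) cs₁').vars.Disjoint (Net.mk (l₂'.map Prod.fst) cs₂').vars := by
  intro x hx hx'
  rw [mem_vars_iff_of_forall₂ h₁ h₁'] at hx
  rw [mem_vars_iff_of_forall₂ h₂ h₂'] at hx'
  exact Multiset.disjoint_left.1 (Multiset.nodup_add.1 hn).2.2 hx hx'

end Sequentialization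

-- From linear derivations in `Seq` back to `Logic`.

section Realization

variable {k : Type u} {Var : Type v} {Atom : Type w} [CoInvol Var] [CoInvol Atom] [CommSemiring k]

/-- A net with a distinguished typed tree: the tree, the other typed trees, and the cuts. -/
abbrev Rooted (k : Type u) (Var : Type v) (Atom : Type w) :=
  (Tree k Var × Formula Atom) × List (Tree k Var × Formula Atom) × List (Cut k Var)

/-- The sequents of the logical system that correspond to a judgment `Seq T o S C`. -/
def Realizes (Φ : TypingContext Var Atom) : Option (List (Tree k Var × Formula Atom)) →
    Multiset (Tree k Var × Formula Atom) → Multiset (Cut k Var) → Prop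
  | none, S, C => ∃ cs : List (Cut k Var), Multiset.ofList cs = C ∧
      ∀ l : List (Tree k Var × Formula Atom), Multiset.ofList l = S → LogicEq Φ l cs
  | some L, S, C => ∃ M : List (Rooted k Var Atom), M.map (fun m => m.1) = L ∧
      Multiset.ofList (M.map fun m => m.2.1).flatten = S ∧
      Multiset.ofList (M.map fun m => m.2.2).flatten = C ∧
      ∀ m ∈ M, LogicEq Φ (m.2.1 ++ [m.1]) m.2.2

theorem Realizes.mono {Φ Φ' : TypingContext Var Atom} (hΦ : Φ'.Extends Φ)
    {o : Option (List (Tree k Var × Formula Atom))} {S : Multiset (Tree k Var × Formula Atom)}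
    {C : Multiset (Cut k Var)} (h : Realizes Φ o S C) : Realizes Φ' o S C := by
  cases o with
  | none =>
    obtain ⟨cs, hcs, h⟩ := h
    exact ⟨cs, hcs, fun l hl => (h l hl).mono hΦ⟩
  | some L =>
    obtain ⟨M, h1, h2, h3, h4⟩ := h
    exact ⟨M, h1, h2, h3, fun m hm => (h4 m hm).mono hΦ⟩

theorem Realizes.of_logicEq {Φ : TypingContext Var Atom} {S : Multiset (Tree k Var × Formula Atom)}
    {C : Multiset (Cut k Var)} {l : List (Tree k Var × Formula Atom)} {cs : List (Cut k Var)}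
    (h : LogicEq Φ l cs) (hl : Multiset.ofList l = S) (hcs : Multiset.ofList cs = C) :
    Realizes Φ none S C :=
  ⟨cs, hcs, fun _ hl' => h.perm (Multiset.coe_eq_coe.1 (hl'.trans hl.symm))⟩

theorem forall₂_concat_left {α β : Type*} {R : α → β → Prop} {l : List α} {a : α} {l' : List β}
    (h : List.Forall₂ R (l ++ [a]) l') :
    ∃ l₁ b, l' = l₁ ++ [b] ∧ List.Forall₂ R l l₁ ∧ R a b := by
  induction l generalizing l' with
  | nil =>
    cases h with | cons h h' =>
    cases h'
    exact ⟨[], _, rfl, .nil, h⟩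
  | cons c l ih =>
    cases h with | cons h h' =>
    obtain ⟨l₁, b, rfl, h1, h2⟩ := ih h'
    exact ⟨_ :: l₁, b, rfl, .cons h h1, h2⟩

theorem forall₂_ofFn {α β : Type*} {R : α → β → Prop} {n : ℕ} {f : Fin n → α} {g : Fin n → β}
    (h : ∀ i, R (f i) (g i)) : List.Forall₂ R (List.ofFn f) (List.ofFn g) := by
  induction n with
  | zero => simp
  | succ n ih =>
    rw [List.ofFn_succ, List.ofFn_succ]
    exact .cons (h 0) (ih fun i => h i.succ)

theorem exists_of_map_eq_singleton {α β : Type*} {l : List α} {f : α → β} {b : β}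
    (h : l.map f = [b]) : ∃ a, l = [a] ∧ f a = b := by
  obtain ⟨a, l, rfl, h1, h2⟩ := List.map_eq_cons_iff.1 h
  obtain rfl := List.map_eq_nil_iff.1 h2
  exact ⟨a, rfl, h1⟩

theorem exists_of_map_eq_pair {α β : Type*} {l : List α} {f : α → β} {b c : β}
    (h : l.map f = [b, c]) : ∃ a a', l = [a, a'] ∧ f a = b ∧ f a' = c := by
  obtain ⟨a, l, rfl, h1, h2⟩ := List.map_eq_cons_iff.1 h
  obtain ⟨a', rfl, h3⟩ := exists_of_map_eq_singleton h2
  exact ⟨a, a', rfl, h1, h3⟩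

theorem map_eq_ofFn_get {α β : Type*} (l : List α) (g : α → β) :
    l.map g = List.ofFn fun i => g (l.get i) := by
  conv_lhs => rw [← List.ofFn_get l, List.map_ofFn]
  rfl

theorem nodup_add_of_nodup_sum {α β : Type*} {l : List α} {f : α → Multiset β}
    (h : (l.map f).sum.Nodup) {i j : Fin l.length} (hij : i ≠ j) :
    (f (l.get i) + f (l.get j)).Nodup := by
  refine Multiset.nodup_of_le ?_ h
  rw [map_eq_ofFn_get, List.sum_ofFn, ← Finset.sum_pair (f := fun i => f (l.get i)) hij]
  exact Finset.sum_le_sum_of_subset (Finset.subset_univ _)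

/-- The occurrences of variables in a net with a distinguished tree. -/
def rootedOcc (m : Rooted k Var Atom) : Multiset Var :=
  occ none (Multiset.ofList (m.2.1 ++ [m.1])) (Multiset.ofList m.2.2)

theorem occ_some_map (M : List (Rooted k Var Atom)) :
    occ (some (M.map fun m => m.1)) (Multiset.ofList (M.map fun m => m.2.1).flatten)
      (Multiset.ofList (M.map fun m => m.2.2).flatten) = (M.map rootedOcc).sum := by
  induction M with
  | nil => rfl
  | cons m M ih =>
    simp only [List.map_cons, List.flatten_cons, ← Multiset.coe_add, List.sum_cons, ← ih]
    rw [occ_cons, rootedOcc, ← Multiset.coe_add, add_comm _ (Multiset.ofList [m.1])]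
    rfl

/-- A realization of a net with a distinguished tree. -/
def RootedEq (Φ : TypingContext Var Atom) (m m' : Rooted k Var Atom) : Prop :=
  TypedEq m.1 m'.1 ∧ List.Forall₂ TypedEq m.2.1 m'.2.1 ∧ List.Forall₂ CutEq m.2.2 m'.2.2 ∧
    Logic Φ (.mk (m'.2.1.map Prod.fst ++ [m'.1.1]) m'.2.2) (m'.2.1.map Prod.snd ++ [m'.1.2])

theorem LogicEq.exists_rootedEq {Φ : TypingContext Var Atom} {m : Rooted k Var Atom}
    (h : LogicEq Φ (m.2.1 ++ [m.1]) m.2.2) : ∃ m', RootedEq Φ m m' := by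
  obtain ⟨l', cs', h1, h2, h3⟩ := h
  obtain ⟨l₁, b, rfl, h4, h5⟩ := forall₂_concat_left h1
  exact ⟨(b, l₁, cs'), h5, h4, h2, by simpa using h3⟩

theorem RootedEq.disjoint {Φ : TypingContext Var Atom} {m₁ m₂ m₁' m₂' : Rooted k Var Atom}
    (h₁ : RootedEq Φ m₁ m₁') (h₂ : RootedEq Φ m₂ m₂') (hn : (rootedOcc m₁ + rootedOcc m₂).Nodup) :
    (Net.mk (m₁'.2.1.map Prod.fst ++ [m₁'.1.1]) m₁'.2.2).vars.Disjoint
      (Net.mk (m₂'.2.1.map Prod.fst ++ [m₂'.1.1]) m₂'.2.2).vars := by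
  have := disjoint_vars_of_forall₂ (l₁ := m₁.2.1 ++ [m₁.1]) (l₁' := m₁'.2.1 ++ [m₁'.1])
    (l₂ := m₂.2.1 ++ [m₂.1]) (l₂' := m₂'.2.1 ++ [m₂'.1])
    (List.rel_append h₁.2.1 (.cons h₁.1 .nil)) h₁.2.2.1
    (List.rel_append h₂.2.1 (.cons h₂.1 .nil)) h₂.2.2.1 hn
  simpa using this

theorem exists_eq_ofFn {α : Type*} (l : List α) {n : ℕ} (h : l.length = n) :
    ∃ f : Fin n → α, l = List.ofFn f := by
  subst h
  exact ⟨l.get, (List.ofFn_get l).symm⟩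

/-- Promotion is the one rule here that enlarges the context and changes a tree. The content is only
known to be typable class by class, so a common context has to be found and the content replaced by
an equal one whose summands are all derivable. -/
theorem Realizes.pos {Φ : TypingContext Var Atom} {φ : Con k Var} {B : Formula Atom}
    {L : List (Tree k Var × Formula Atom)} {S : Multiset (Tree k Var × Formula Atom)}
    {C : Multiset (Cut k Var)} (hφ : PosRule φ (L.map Prod.snd) B) (h : Realizes Φ (some L) S C)
    (hn : (occ (some L) S C).Nodup) : ∃ Φ' : TypingContext Var Atom, Φ'.Extends Φ ∧
      Realizes Φ' none ({(.node φ (L.map Prod.fst), B)} + S) C := by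
  obtain ⟨M, rfl, rfl, rfl, hM⟩ := h
  rw [occ_some_map] at hn
  -- The list of types must be a variable for the case analysis on the rule.
  generalize hΘ : (M.map fun m => m.1).map Prod.snd = Θ at hφ
  cases hφ with
  | tens A B =>
    rw [List.map_map] at hΘ
    obtain ⟨m₁, m₂, rfl, hΛ⟩ := exists_of_map_eq_pair hΘ
    · obtain ⟨m₁', h₁⟩ := (hM m₁ (by simp)).exists_rootedEq
      obtain ⟨m₂', h₂⟩ := (hM m₂ (by simp)).exists_rootedEq
      have hd := h₁.disjoint h₂ (by simpa using hn)
      have e1 : m₁'.1.2 = A := h₁.1.2.symm.trans hΛ.1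
      have e2 : m₂'.1.2 = B := h₂.1.2.symm.trans hΛ.2
      have := Logic.tens _ _ _ _ _ _ _ _ A B (e1 ▸ h₁.2.2.2) (e2 ▸ h₂.2.2.2) hd
      refine ⟨Φ, .refl _, .of_logicEq (l := m₁.2.1 ++ m₂.2.1 ++ [(.tens m₁.1.1 m₂.1.1, .tens A B)])
        (cs := m₁.2.2 ++ m₂.2.2)
        ⟨m₁'.2.1 ++ m₂'.2.1 ++ [(.tens m₁'.1.1 m₂'.1.1, .tens A B)], m₁'.2.2 ++ m₂'.2.2,
          List.rel_append (List.rel_append h₁.2.1 h₂.2.1)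
            (.cons ⟨.node _ (.cons h₁.1.1 (.cons h₂.1.1 .nil)), rfl⟩ .nil),
          List.rel_append h₁.2.2.1 h₂.2.2.1, by simpa using this⟩ ?_ (by simp)⟩
      rw [← Multiset.coe_add, add_comm]
      simp
  | coweak A =>
    obtain rfl : M = [] := by simpa using hΘ
    · refine ⟨Φ, .refl _, .of_logicEq (l := [(.coweak, .bang A)]) (cs := [])
        ⟨_, _, .cons ⟨.refl _, rfl⟩ .nil, .nil, .coweak A⟩ (by simp) (by simp)⟩
  | cocontr A =>
    rw [List.map_map] at hΘ
    obtain ⟨m₁, m₂, rfl, hΛ⟩ := exists_of_map_eq_pair hΘ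
    · obtain ⟨m₁', h₁⟩ := (hM m₁ (by simp)).exists_rootedEq
      obtain ⟨m₂', h₂⟩ := (hM m₂ (by simp)).exists_rootedEq
      have hd := h₁.disjoint h₂ (by simpa using hn)
      have e1 : m₁'.1.2 = .bang A := h₁.1.2.symm.trans hΛ.1
      have e2 : m₂'.1.2 = .bang A := h₂.1.2.symm.trans hΛ.2
      have := Logic.cocontr _ _ _ _ _ _ _ _ A (e1 ▸ h₁.2.2.2) (e2 ▸ h₂.2.2.2) hd
      refine ⟨Φ, .refl _, .of_logicEq
        (l := m₁.2.1 ++ m₂.2.1 ++ [(.cocontr m₁.1.1 m₂.1.1, .bang A)])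
        (cs := m₁.2.2 ++ m₂.2.2)
        ⟨m₁'.2.1 ++ m₂'.2.1 ++ [(.cocontr m₁'.1.1 m₂'.1.1, .bang A)], m₁'.2.2 ++ m₂'.2.2,
          List.rel_append (List.rel_append h₁.2.1 h₂.2.1)
            (.cons ⟨.node _ (.cons h₁.1.1 (.cons h₂.1.1 .nil)), rfl⟩ .nil),
          List.rel_append h₁.2.2.1 h₂.2.2.1, by simpa using this⟩ ?_ (by simp)⟩
      rw [← Multiset.coe_add, add_comm]
      simp
  | prom As B P hP =>
    obtain ⟨Φ', hΦ', P', hPP', hP'⟩ := hP.exists_sumEq Φ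
    obtain ⟨A, rfl⟩ := exists_eq_ofFn As (n := M.length) (by simpa using (congrArg List.length hΘ).symm)
    have hA : ∀ i, (M.get i).1.2 = (A i).bang := by
      rw [List.map_map, map_eq_ofFn_get, List.map_ofFn] at hΘ
      exact congrFun (List.ofFn_injective hΘ)
    have hm : ∀ i, ∃ m', RootedEq Φ' (M.get i) m' := fun i =>
      ((hM _ (List.get_mem M i)).mono hΦ').exists_rootedEq
    choose m' hm' using hm
    have := Logic.prom P' (fun i => (m' i).2.1.map Prod.fst) (fun i => (m' i).1.1)
      (fun i => (m' i).2.2) (fun i => (m' i).2.1.map Prod.snd) A B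
      (fun a ha => by
        have := hP' a ha
        rwa [List.map_ofFn] at this)
      (fun i => by
        have := (hm' i).2.2.2
        rwa [← (hm' i).1.2, hA] at this)
      (fun i j hij => (hm' i).disjoint (hm' j) (nodup_add_of_nodup_sum hn hij))
    rw [List.length_ofFn]
    refine ⟨Φ', hΦ', .of_logicEq
      (l := (List.ofFn fun i => (M.get i).2.1).flatten ++
        [(.prom M.length P (List.ofFn fun i => (M.get i).1.1), .bang B)])
      (cs := (List.ofFn fun i => (M.get i).2.2).flatten)
      ⟨(List.ofFn fun i => (m' i).2.1).flatten ++
        [(.prom M.length P' (List.ofFn fun i => (m' i).1.1), .bang B)],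
        (List.ofFn fun i => (m' i).2.2).flatten,
        List.rel_append (List.rel_flatten (forall₂_ofFn fun i => (hm' i).2.1)) (.cons ⟨?_, rfl⟩ .nil),
        List.rel_flatten (forall₂_ofFn fun i => (hm' i).2.2.1), ?_⟩ ?_ ?_⟩
    · exact (TreeEq.node _ (forall₂_ofFn fun i => (hm' i).1.1)).trans (.rel _ _ (.box _ _ _ _ hPP'))
    · simpa [List.map_flatten, List.map_ofFn, Function.comp_def] using this
    · rw [List.map_map, map_eq_ofFn_get M, map_eq_ofFn_get M, ← Multiset.coe_add, add_comm]
      rfl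
    · rw [map_eq_ofFn_get M]

/-- Since a realization is available for every order of the trees, the arguments may be placed last,
where the rules of `Logic` expect them. -/
theorem Realizes.neg {Φ : TypingContext Var Atom} {φ : Con k Var} {B : Formula Atom}
    {L : List (Tree k Var × Formula Atom)} {S : Multiset (Tree k Var × Formula Atom)}
    {C : Multiset (Cut k Var)} (hφ : NegRule φ (L.map Prod.snd) B)
    (h : Realizes Φ none (Multiset.ofList L + S) C) :
    Realizes Φ none ({(.node φ (L.map Prod.fst), B)} + S) C := by
  obtain ⟨cs, rfl, h⟩ := h
  obtain ⟨l, rfl⟩ : ∃ l, Multiset.ofList l = S := Quot.exists_rep S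
  obtain ⟨l', cs', h1, h2, h3⟩ := h (l ++ L) (by rw [add_comm]; rfl)
  have finish : ∀ t', TreeEq (.node φ (L.map Prod.fst)) t' → ∀ l₁, List.Forall₂ TypedEq l l₁ →
      Logic Φ (.mk (l₁.map Prod.fst ++ [t']) cs') (l₁.map Prod.snd ++ [B]) →
      Realizes Φ none ({(.node φ (L.map Prod.fst), B)} + Multiset.ofList l) cs := by
    intro t' ht l₁ hl hL
    refine .of_logicEq (l := l ++ [(.node φ (L.map Prod.fst), B)]) (cs := cs)
      ⟨l₁ ++ [(t', B)], cs', List.rel_append hl (.cons ⟨ht, rfl⟩ .nil), h2, by simpa using hL⟩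
      ?_ rfl
    rw [← Multiset.coe_add, add_comm]
    rfl
  generalize hΘ : L.map Prod.snd = Θ at hφ
  have one : ∀ a, L = [a] → ∃ l₁ b, l' = l₁ ++ [b] ∧ List.Forall₂ TypedEq l l₁ ∧ TypedEq a b := by
    rintro a rfl
    exact forall₂_concat_left h1
  have two : ∀ a₁ a₂, L = [a₁, a₂] → ∃ l₁ b₁ b₂, l' = l₁ ++ [b₁, b₂] ∧
      List.Forall₂ TypedEq l l₁ ∧ TypedEq a₁ b₁ ∧ TypedEq a₂ b₂ := by
    rintro a₁ a₂ rfl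
    rw [List.append_cons] at h1
    obtain ⟨l₁, b, rfl, h4, h5⟩ := forall₂_concat_left h1
    obtain ⟨l₂, b', rfl, h6, h7⟩ := forall₂_concat_left h4
    exact ⟨l₂, b', b, by simp, h6, h7, h5⟩
  cases hφ with
  | par A B =>
    obtain ⟨a₁, a₂, rfl, hΛ⟩ := exists_of_map_eq_pair hΘ
    · obtain ⟨l₁, b₁, b₂, rfl, h4, h5, h6⟩ := two a₁ a₂ rfl
      refine finish (.par b₁.1 b₂.1) (.node _ (.cons h5.1 (.cons h6.1 .nil))) l₁ h4 (.par _ _ _ _ _ A B ?_)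
      simp only [List.map_append, List.map_cons, List.map_nil] at h3
      rwa [← h5.2, ← h6.2, hΛ.1, hΛ.2] at h3
  | weak A =>
    obtain rfl : L = [] := by simpa using hΘ
    · refine finish .weak (.refl _) l' (by simpa using h1) (.weak _ _ _ A h3)
  | der A =>
    obtain ⟨a, rfl, hΛ⟩ := exists_of_map_eq_singleton hΘ
    · obtain ⟨l₁, b, rfl, h4, h5⟩ := one a rfl
      refine finish (.der b.1) (.node _ (.cons h5.1 .nil)) l₁ h4 (.der _ _ _ _ A ?_)
      simp only [List.map_append, List.map_cons, List.map_nil] at h3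
      rwa [← h5.2, hΛ] at h3
  | coder A =>
    obtain ⟨a, rfl, hΛ⟩ := exists_of_map_eq_singleton hΘ
    · obtain ⟨l₁, b, rfl, h4, h5⟩ := one a rfl
      refine finish (.coder b.1) (.node _ (.cons h5.1 .nil)) l₁ h4 (.coder _ _ _ _ A ?_)
      simp only [List.map_append, List.map_cons, List.map_nil] at h3
      rwa [← h5.2, hΛ] at h3
  | contr A =>
    obtain ⟨a₁, a₂, rfl, hΛ⟩ := exists_of_map_eq_pair hΘ
    · obtain ⟨l₁, b₁, b₂, rfl, h4, h5, h6⟩ := two a₁ a₂ rfl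
      refine finish (.contr b₁.1 b₂.1) (.node _ (.cons h5.1 (.cons h6.1 .nil))) l₁ h4
        (.contr _ _ _ _ _ A ?_)
      simp only [List.map_append, List.map_cons, List.map_nil] at h3
      rwa [← h5.2, ← h6.2, hΛ.1, hΛ.2] at h3

theorem Realizes.mix {Φ : TypingContext Var Atom} {S S' : Multiset (Tree k Var × Formula Atom)}
    {C C' : Multiset (Cut k Var)} (h : Realizes Φ none S C) (h' : Realizes Φ none S' C')
    (hn : (occ none S C + occ none S' C').Nodup) : Realizes Φ none (S + S') (C + C') := by
  obtain ⟨cs, rfl, h⟩ := h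
  obtain ⟨ds, rfl, h'⟩ := h'
  obtain ⟨l, rfl⟩ : ∃ l, Multiset.ofList l = S := Quot.exists_rep S
  obtain ⟨r, rfl⟩ : ∃ l, Multiset.ofList l = S' := Quot.exists_rep S'
  obtain ⟨l', cs', h1, h2, h3⟩ := h l rfl
  obtain ⟨r', ds', h1', h2', h3'⟩ := h' r rfl
  have := Logic.mix _ _ _ _ _ _ h3 h3' (disjoint_vars_of_forall₂ h1 h2 h1' h2' hn)
  exact .of_logicEq ⟨l' ++ r', cs' ++ ds', List.rel_append h1 h1', List.rel_append h2 h2',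
    by simpa using this⟩ rfl rfl

theorem Realizes.cut {Φ : TypingContext Var Atom} {S S' : Multiset (Tree k Var × Formula Atom)}
    {C C' : Multiset (Cut k Var)} {s t : Tree k Var} {A : Formula Atom}
    (h : Realizes Φ none ({(s, A)} + S) C) (h' : Realizes Φ none ({(t, A.orth)} + S') C')
    (hn : (occ none ({(s, A)} + S) C + occ none ({(t, A.orth)} + S') C').Nodup) :
    Realizes Φ none (S + S') ({(s, t)} + (C + C')) := by
  obtain ⟨cs, rfl, h⟩ := h
  obtain ⟨ds, rfl, h'⟩ := h'
  obtain ⟨l, rfl⟩ : ∃ l, Multiset.ofList l = S := Quot.exists_rep S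
  obtain ⟨r, rfl⟩ : ∃ l, Multiset.ofList l = S' := Quot.exists_rep S'
  have e1 : Multiset.ofList (l ++ [(s, A)]) = {(s, A)} + Multiset.ofList l := by
    rw [← Multiset.coe_add, add_comm]; rfl
  have e2 : Multiset.ofList (r ++ [(t, A.orth)]) = {(t, A.orth)} + Multiset.ofList r := by
    rw [← Multiset.coe_add, add_comm]; rfl
  obtain ⟨m, h1⟩ := LogicEq.exists_rootedEq (m := ((s, A), l, cs)) (h _ e1)
  obtain ⟨m', h2⟩ := LogicEq.exists_rootedEq (m := ((t, A.orth), r, ds)) (h' _ e2)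
  have hd := h1.disjoint h2 (by simpa only [rootedOcc, e1, e2] using hn)
  have h3 := h1.2.2.2
  have h4 := h2.2.2.2
  rw [← h1.1.2] at h3
  rw [← h2.1.2] at h4
  have := Logic.cut _ _ _ _ _ _ _ _ A h3 h4 hd
  refine .of_logicEq (l := l ++ r) (cs := cs ++ ds ++ [(s, t)])
    ⟨m.2.1 ++ m'.2.1, m.2.2 ++ m'.2.2 ++ [(m.1.1, m'.1.1)], List.rel_append h1.2.1 h2.2.1,
      List.rel_append (List.rel_append h1.2.2.1 h2.2.2.1) (.cons (.inl ⟨h1.1.1, h2.1.1⟩) .nil),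
      by simpa using this⟩ rfl ?_
  rw [← Multiset.coe_add, add_comm]
  rfl

theorem Realizes.cons {Φ : TypingContext Var Atom} {a : Tree k Var × Formula Atom}
    {L : List (Tree k Var × Formula Atom)} {S S' : Multiset (Tree k Var × Formula Atom)}
    {C C' : Multiset (Cut k Var)} (h : Realizes Φ none ({a} + S) C)
    (h' : Realizes Φ (some L) S' C') : Realizes Φ (some (a :: L)) (S + S') (C + C') := by
  obtain ⟨cs, rfl, h⟩ := h
  obtain ⟨M, rfl, rfl, rfl, hM⟩ := h'
  obtain ⟨l, rfl⟩ : ∃ l, Multiset.ofList l = S := Quot.exists_rep S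
  refine ⟨(a, l, cs) :: M, rfl, by simp [← Multiset.coe_add], by simp [← Multiset.coe_add],
    fun m hm => ?_⟩
  rcases List.mem_cons.1 hm with rfl | hm
  · refine h _ ?_
    rw [← Multiset.coe_add, add_comm]
    rfl
  · exact hM m hm

/-- Linear derivations whose axioms are typed in a context can be realized in an extension. -/
theorem Seq.realizes {Φ₀ : TypingContext Var Atom}
    {o : Option (List (Tree k Var × Formula Atom))} {S : Multiset (Tree k Var × Formula Atom)}
    {C : Multiset (Cut k Var)} (h : Seq Φ₀.Admits o S C) (hn : (occ o S C).Nodup)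
    (Φ : TypingContext Var Atom) (hΦ : Φ.Extends Φ₀) :
    ∃ Φ' : TypingContext Var Atom, Φ'.Extends Φ ∧ Realizes Φ' o S C := by
  induction h generalizing Φ with
  | ax x A h =>
    have h' := h.mono hΦ
    exact ⟨Φ, .refl _, .of_logicEq (l := [(.var x, A), (.var (CoInvol.co x), A.orth)]) (cs := [])
      ⟨_, _, .cons ⟨.refl _, rfl⟩ (.cons ⟨.refl _, rfl⟩ .nil), .nil, .ax x A h'.1 h'.2⟩ rfl rfl⟩
  | mix _ _ ih ih' =>
    rw [occ_mix] at hn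
    obtain ⟨Φ₁, h1, h2⟩ := ih (Multiset.nodup_add.1 hn).1 Φ hΦ
    -- The boxes of the right premise are typed over the context obtained for the left one, which is
    -- then weakened to the common extension.
    obtain ⟨Φ₂, h3, h4⟩ := ih' (Multiset.nodup_add.1 hn).2.1 Φ₁ (h1.trans hΦ)
    exact ⟨Φ₂, h3.trans h1, (h2.mono h3).mix h4 hn⟩
  | @cut s t A S S' C C' _ _ ih ih' =>
    rw [occ_cut s t A A.orth] at hn
    obtain ⟨Φ₁, h1, h2⟩ := ih (Multiset.nodup_add.1 hn).1 Φ hΦ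
    obtain ⟨Φ₂, h3, h4⟩ := ih' (Multiset.nodup_add.1 hn).2.1 Φ₁ (h1.trans hΦ)
    exact ⟨Φ₂, h3.trans h1, (h2.mono h3).cut h4 hn⟩
  | neg hφ _ ih =>
    rw [occ_neg] at hn
    obtain ⟨Φ₁, h1, h2⟩ := ih hn Φ hΦ
    exact ⟨Φ₁, h1, .neg hφ h2⟩
  | pos hφ _ ih =>
    rw [occ_pos] at hn
    obtain ⟨Φ₁, h1, h2⟩ := ih hn Φ hΦ
    obtain ⟨Φ₂, h3, h4⟩ := h2.pos hφ hn
    exact ⟨Φ₂, h3.trans h1, h4⟩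
  | nil => exact ⟨Φ, .refl _, [], rfl, rfl, rfl, by simp⟩
  | cons _ _ ih ih' =>
    rw [occ_cons] at hn
    obtain ⟨Φ₁, h1, h2⟩ := ih (Multiset.nodup_add.1 hn).1 Φ hΦ
    obtain ⟨Φ₂, h3, h4⟩ := ih' (Multiset.nodup_add.1 hn).2.1 Φ₁ (h1.trans hΦ)
    exact ⟨Φ₂, h3.trans h1, (h2.mono h3).cons h4⟩

end Realization

-- Typability of nets, and its equivalence with derivability for linear nets.

section NetTyping

variable {k : Type u} {Var : Type v} {Atom : Type w} [CoInvol Var] [CoInvol Atom] [CommSemiring k]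

/-- Typability of a net, without typing context and without disjointness conditions. -/
def Net.HasType (p : Net k Var) (Γ : List (Formula Atom)) : Prop :=
  ∃ L : List (Tree k Var × Formula Atom), L.map Prod.fst = p.trees ∧ L.map Prod.snd = Γ ∧
    Seq (fun _ _ => True) none (Multiset.ofList L) (Multiset.ofList p.cuts)

theorem eq_of_map_fst_snd {L L' : List (Tree k Var × Formula Atom)}
    (h : L.map Prod.fst = L'.map Prod.fst) (h' : L.map Prod.snd = L'.map Prod.snd) : L = L' := by
  induction L generalizing L' with
  | nil => exact (List.map_eq_nil_iff.1 h.symm).symm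
  | cons a L ih =>
    obtain ⟨b, L', rfl, h1, h2⟩ := List.map_eq_cons_iff.1 h.symm
    simp only [List.map_cons, List.cons.injEq] at h'
    rw [ih h2.symm h'.2, Prod.ext h1.symm h'.1]

/-- A list of typed trees is determined by its trees and its types, so the existential in
`Net.HasType` has only one possible witness. -/
theorem Net.hasType_mk {ts : List (Tree k Var)} {cs : List (Cut k Var)} {Γ : List (Formula Atom)}
    {L : List (Tree k Var × Formula Atom)} (h : L.map Prod.fst = ts) (h' : L.map Prod.snd = Γ) :
    (Net.mk ts cs).HasType Γ ↔
      Seq (fun _ _ => True) none (Multiset.ofList L) (Multiset.ofList cs) := by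
  constructor
  · rintro ⟨L', h1, h2, h3⟩
    rwa [eq_of_map_fst_snd (h1.trans h.symm) (h2.trans h'.symm)] at h3
  · exact fun hs => ⟨L, h, h', hs⟩

theorem Net.HasType.length_eq {p : Net k Var} {Γ : List (Formula Atom)} (h : p.HasType Γ) :
    p.trees.length = Γ.length := by
  obtain ⟨L, h1, h2, -⟩ := h
  rw [← h1, ← h2, List.length_map, List.length_map]

theorem Net.hasType_append {ss ts : List (Tree k Var)} {cs : List (Cut k Var)}
    {Γ Δ : List (Formula Atom)} (h : ts.length = Δ.length) :
    (Net.mk (ss ++ ts) cs).HasType (Γ ++ Δ) ↔ ∃ L : List (Tree k Var × Formula Atom),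
      L.map Prod.fst = ss ∧ L.map Prod.snd = Γ ∧
      Seq (fun _ _ => True) none (Multiset.ofList (ts.zip Δ) + Multiset.ofList L)
        (Multiset.ofList cs) := by
  have h1 : (ts.zip Δ).map Prod.fst = ts := List.map_fst_zip h.le
  have h2 : (ts.zip Δ).map Prod.snd = Δ := List.map_snd_zip h.ge
  constructor
  · rintro ⟨L, h3, h4, h5⟩
    obtain ⟨L₁, L₂, rfl, rfl, h6⟩ := List.map_eq_append_iff.1 h3
    obtain ⟨h7, h8⟩ := List.append_inj' ((List.map_append).symm.trans h4)
      (by rw [List.length_map, ← h, ← h6, List.length_map])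
    have : L₂ = ts.zip Δ := eq_of_map_fst_snd (h6.trans h1.symm) (h8.trans h2.symm)
    subst this
    refine ⟨L₁, rfl, h7, h5.cast ?_ rfl⟩
    rw [← Multiset.coe_add, add_comm]
  · rintro ⟨L, rfl, rfl, h5⟩
    refine ⟨L ++ ts.zip Δ, by simp [Net.trees, h1], by simp [h2], h5.cast ?_ rfl⟩
    rw [← Multiset.coe_add, add_comm]

theorem Net.hasType_concat {ss : List (Tree k Var)} {s : Tree k Var} {cs : List (Cut k Var)}
    {Γ : List (Formula Atom)} {A : Formula Atom} :
    (Net.mk (ss ++ [s]) cs).HasType (Γ ++ [A]) ↔ ∃ L : List (Tree k Var × Formula Atom),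
      L.map Prod.fst = ss ∧ L.map Prod.snd = Γ ∧
      Seq (fun _ _ => True) none ({(s, A)} + Multiset.ofList L) (Multiset.ofList cs) :=
  Net.hasType_append (ts := [s]) (Δ := [A]) rfl

theorem occ_of_map_fst {L : List (Tree k Var × Formula Atom)} {p : Net k Var}
    (h : L.map Prod.fst = p.trees) :
    occ none (Multiset.ofList L) (Multiset.ofList p.cuts) = Multiset.ofList p.vars := by
  obtain ⟨ts, cs⟩ := p
  rw [Net.vars_mk, ← Multiset.coe_add, occ, indexOcc_none, zero_add, treeOcc_coe, cutOcc_coe, h]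
  rfl

/-- Typable linear nets are derivable, up to identification, in an extension of any context. -/
theorem Net.HasType.isNetClass [Infinite Var] {p : Net k Var} {Γ : List (Formula Atom)}
    (h : p.HasType Γ) (hn : p.vars.Nodup) : IsNetClass Γ p.toClass := by
  intro Φ
  obtain ⟨L, h1, h2, h3⟩ := h
  -- `Φ` may give the variables of `p` types other than those of the axioms, so all of them are
  -- moved off its domain.
  obtain ⟨σ, hσ, hav⟩ := exists_compatible_avoiding p.vars _ Φ.finite_dom
  have hclosed : ∀ x ∈ p.vars, CoInvol.co x ∈ p.vars := fun x hx => by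
    rw [← Multiset.mem_coe, ← occ_of_map_fst h1] at hx ⊢
    exact h3.co_mem hx
  have hpq : NetEq p (p.rename σ) := .alpha p σ hσ fun x hx hx' => absurd (hclosed x hx) hx'
  have h4 := h3.rename (T' := fun _ _ => True) σ hσ fun _ _ h => h
  simp only [Option.map_none, Multiset.map_coe] at h4
  set L' := L.map (bindTyped fun x => .var (σ x)) with hL'
  have h1' : L'.map Prod.fst = (p.rename σ).trees := by
    rw [hL', map_fst_bindTyped, h1]; rfl
  have h2' : L'.map Prod.snd = Γ := by rw [hL', map_snd_bindTyped, h2]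
  change Seq _ none (Multiset.ofList L') (Multiset.ofList (p.rename σ).cuts) at h4
  have hocc := occ_of_map_fst h1'
  have hn' : (occ none (Multiset.ofList L') (Multiset.ofList (p.rename σ).cuts)).Nodup := by
    rw [hocc, Multiset.coe_nodup, Net.vars_rename]
    exact hn.map σ.injective
  -- First the axioms receive their types; then `Seq.realizes` enlarges the context again for the
  -- boxes.
  obtain ⟨Φ₁, h5, -, h6⟩ := h4.exists_context hn' Φ fun x hx => by
    rw [hocc, Multiset.mem_coe, Net.vars_rename] at hx
    obtain ⟨y, hy, rfl⟩ := List.mem_map.1 hx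
    simpa using (hav y hy).1
  obtain ⟨Φ₂, h7, cs, h8, h9⟩ := h6.realizes hn' Φ₁ (.refl _)
  obtain ⟨l, ds, h10, h11, h12⟩ := h9 L' rfl
  refine ⟨Φ₂, h7.trans h5, .mk (l.map Prod.fst) ds, Net.toClass_eq.2 (.symm _ _ ?_), ?_⟩
  · refine .trans _ _ _ hpq (Net.StructEq.netEq ⟨?_, ?_⟩)
    · rw [← h1']; exact TypedEq.forall₂_map_fst h10
    · rw [← h8]; exact CutEq.rel_of_forall₂ h11
  · rwa [← h2', TypedEq.map_snd_eq h10]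

theorem isNetSum_of_forall [Infinite Var] {P : FSum k Var} {Γ : List (Formula Atom)}
    (h : ∀ a ∈ P, a.2.HasType Γ ∧ a.2.vars.Nodup) : IsNetSum Γ P := fun c hc => by
  obtain ⟨a, ha, rfl⟩ := FSum.mem_of_value_ne_zero hc
  exact (h a ha).1.isNetClass (h a ha).2

theorem Seq.some_ofFn {T : Var → Formula Atom → Prop} {n : ℕ}
    (a : Fin n → Tree k Var × Formula Atom) (L : Fin n → List (Tree k Var × Formula Atom))
    (cs : Fin n → List (Cut k Var))
    (h : ∀ i, Seq T none ({a i} + Multiset.ofList (L i)) (Multiset.ofList (cs i))) :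
    Seq T (some (List.ofFn a)) (Multiset.ofList (List.ofFn L).flatten)
      (Multiset.ofList (List.ofFn cs).flatten) := by
  induction n with
  | zero => exact .nil
  | succ n ih =>
    simp only [List.ofFn_succ, List.flatten_cons, ← Multiset.coe_add]
    exact .cons (h 0) (ih _ _ _ fun i => h i.succ)

/-- In the reductions, trees and types come as separate lists rather than as a list of pairs. The
same holds for `Seq.pos'`. -/
theorem Seq.neg' {T : Var → Formula Atom → Prop} {φ : Con k Var} {B : Formula Atom}
    {ts : List (Tree k Var)} {As : List (Formula Atom)} {S : Multiset (Tree k Var × Formula Atom)}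
    {C : Multiset (Cut k Var)} (hφ : NegRule φ As B) (hl : ts.length = As.length)
    (h : Seq T none (Multiset.ofList (ts.zip As) + S) C) : Seq T none ({(.node φ ts, B)} + S) C := by
  have := Seq.neg (by rwa [List.map_snd_zip hl.ge]) h
  rwa [List.map_fst_zip hl.le] at this

theorem Seq.pos' {T : Var → Formula Atom → Prop} {φ : Con k Var} {B : Formula Atom}
    {ts : List (Tree k Var)} {As : List (Formula Atom)} {S : Multiset (Tree k Var × Formula Atom)}
    {C : Multiset (Cut k Var)} (hφ : PosRule φ As B) (hl : ts.length = As.length)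
    (h : Seq T (some (ts.zip As)) S C) : Seq T none ({(.node φ ts, B)} + S) C := by
  have := Seq.pos (by rwa [List.map_snd_zip hl.ge]) h
  rwa [List.map_fst_zip hl.le] at this

theorem Net.HasType.concat_neg {φ : Con k Var} {B : Formula Atom} {ss ts : List (Tree k Var)}
    {cs : List (Cut k Var)} {Γ Δ : List (Formula Atom)} (hφ : NegRule φ Δ B)
    (hl : ts.length = Δ.length) (h : (Net.mk (ss ++ ts) cs).HasType (Γ ++ Δ)) :
    (Net.mk (ss ++ [.node φ ts]) cs).HasType (Γ ++ [B]) := by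
  obtain ⟨L, h1, h2, h3⟩ := (Net.hasType_append hl).1 h
  exact Net.hasType_concat.2 ⟨L, h1, h2, .neg' hφ hl h3⟩

theorem Net.vars_append (ss ts : List (Tree k Var)) (cs ds : List (Cut k Var)) :
    Multiset.ofList (Net.mk (ss ++ ts) (cs ++ ds)).vars =
      Multiset.ofList (Net.mk ss cs).vars + Multiset.ofList (Net.mk ts ds).vars := by
  simp only [Net.vars_mk, List.flatMap_append, ← Multiset.coe_add]
  abel

theorem Net.coe_vars_mk (ts : List (Tree k Var)) (cs : List (Cut k Var)) :
    Multiset.ofList (Net.mk ts cs).vars =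
      Multiset.ofList (ts.flatMap Tree.vars) + Multiset.ofList (cs.flatMap Cut.vars) := by
  rw [Net.vars_mk, Multiset.coe_add]

theorem nodup_of_disjoint {l₁ l₂ l : List Var} (h₁ : l₁.Nodup) (h₂ : l₂.Nodup)
    (h : l₁.Disjoint l₂) (hl : Multiset.ofList l = Multiset.ofList l₁ + Multiset.ofList l₂) :
    l.Nodup := by
  rw [← Multiset.coe_nodup, hl, Multiset.coe_add, Multiset.coe_nodup]
  exact List.Nodup.append h₁ h₂ h

theorem nodup_sum {n : ℕ} {f : Fin n → Multiset Var} (h : ∀ i, (f i).Nodup)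
    (hd : ∀ i j, i ≠ j → ∀ x ∈ f i, x ∉ f j) : (∑ i, f i).Nodup := by
  induction n with
  | zero => simp
  | succ n ih =>
    rw [Fin.sum_univ_succ]
    refine Multiset.nodup_add.2 ⟨h 0, ih (fun i => h i.succ) (fun i j hij =>
      hd _ _ fun e => hij (Fin.succ_injective _ e)), Multiset.disjoint_left.2 fun {x} hx hx' => ?_⟩
    obtain ⟨i, -, hi⟩ := Multiset.mem_sum.1 hx'
    exact hd 0 i.succ (Fin.succ_ne_zero i).symm x hx hi

theorem sum_ofFn_flatMap {n : ℕ} (ts : Fin n → List (Tree k Var)) (t : Fin n → Tree k Var)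
    (cs : Fin n → List (Cut k Var)) (φ : Con k Var) :
    Multiset.ofList (Net.mk ((List.ofFn ts).flatten ++ [.node φ (List.ofFn t)])
      (List.ofFn cs).flatten).vars =
      ∑ i, Multiset.ofList (Net.mk (ts i ++ [t i]) (cs i)).vars := by
  induction n with
  | zero => simp [Net.vars_mk]
  | succ n ih =>
    have := ih (fun i => ts i.succ) (fun i => t i.succ) (fun i => cs i.succ)
    rw [Fin.sum_univ_succ, ← this]
    simp only [Net.coe_vars_mk, List.ofFn_succ, List.flatten_cons, List.flatMap_append,
      List.flatMap_cons, Tree.vars_node, ← Multiset.coe_add, List.flatMap_nil]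
    abel

/-- The rules of `Logic` are instances of those of `Seq`, and their disjointness conditions give
linearity. For a box, the induction hypothesis makes every summand of the content typable and
linear, hence derivable over any context, which is the context-free condition `IsNetSum`. -/
theorem Logic.hasType [Infinite Var] {Φ : TypingContext Var Atom} {p : Net k Var}
    {Γ : List (Formula Atom)} (h : Logic Φ p Γ) :
    p.HasType Γ ∧ p.vars.Nodup ∧ p.IsSimple := by
  have isCon : ∀ {φ : Con k Var}, (∀ n P, φ ≠ .prom n P) → φ.IsCon := fun {φ} h =>
    ⟨φ, fun n P e => absurd e (h n P), fun n P e => absurd e (h n P)⟩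
  have simple : ∀ {ts : List (Tree k Var)} {cs : List (Cut k Var)}, (Net.mk ts cs).vars.Nodup →
      (∀ t ∈ ts, t.IsTree) → (∀ c ∈ cs, c.1.IsTree ∧ c.2.IsTree) → (Net.mk ts cs).IsSimple :=
    fun h h1 h2 => .mk _ _ h1 (fun c hc => (h2 c hc).1) (fun c hc => (h2 c hc).2) h
  have trees : ∀ {ts : List (Tree k Var)} {cs : List (Cut k Var)}, (Net.mk ts cs).IsSimple →
      (∀ t ∈ ts, t.IsTree) ∧ ∀ c ∈ cs, c.1.IsTree ∧ c.2.IsTree := fun h => by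
    cases h with | mk _ _ h1 h2 h3 _ => exact ⟨h1, fun c hc => ⟨h2 c hc, h3 c hc⟩⟩
  have node : ∀ {φ : Con k Var} {ss ts : List (Tree k Var)} {cs : List (Cut k Var)},
      (Net.mk (ss ++ [.node φ ts]) cs).vars.Nodup → φ.IsCon → ts.length = φ.arity →
      (∀ t ∈ ts, t.IsTree) → (Tree.node φ ts).IsTree := fun hn h1 h2 h3 => by
    refine .node _ _ h1 h2 h3 ?_
    rw [Net.vars_mk, List.flatMap_append] at hn
    simpa using (List.nodup_append.1 (List.nodup_append.1 hn).1).2.1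
  have neg : ∀ {φ : Con k Var} {B : Formula Atom} {ss ts : List (Tree k Var)}
      {cs : List (Cut k Var)} {Γ Δ : List (Formula Atom)}, NegRule φ Δ B →
      ts.length = Δ.length → ts.length = φ.arity → (∀ n P, φ ≠ .prom n P) →
      ((Net.mk (ss ++ ts) cs).HasType (Γ ++ Δ) ∧ (Net.mk (ss ++ ts) cs).vars.Nodup ∧
        (Net.mk (ss ++ ts) cs).IsSimple) →
      ((Net.mk (ss ++ [.node φ ts]) cs).HasType (Γ ++ [B]) ∧
        (Net.mk (ss ++ [.node φ ts]) cs).vars.Nodup ∧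
        (Net.mk (ss ++ [.node φ ts]) cs).IsSimple) := by
    rintro φ B ss ts cs Γ Δ hφ hl ha hp ⟨h1, h2, h3⟩
    have hn : (Net.mk (ss ++ [.node φ ts]) cs).vars.Nodup := by
      simpa [Net.vars_mk] using h2
    refine ⟨h1.concat_neg hφ hl, hn, simple hn (fun t ht => ?_) (trees h3).2⟩
    rcases List.mem_append.1 ht with ht | ht
    · exact (trees h3).1 t (by simp [ht])
    · obtain rfl := List.mem_singleton.1 ht
      exact node hn (isCon hp) ha fun t ht => (trees h3).1 t (by simp [ht])
  have pos : ∀ {φ : Con k Var} {B A A' : Formula Atom} {ss ts : List (Tree k Var)}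
      {s t : Tree k Var} {cs ds : List (Cut k Var)} {Γ Δ : List (Formula Atom)},
      PosRule φ [A, A'] B → φ.arity = 2 → (∀ n P, φ ≠ .prom n P) →
      ((Net.mk (ss ++ [s]) cs).HasType (Γ ++ [A]) ∧ (Net.mk (ss ++ [s]) cs).vars.Nodup ∧
        (Net.mk (ss ++ [s]) cs).IsSimple) →
      ((Net.mk (ts ++ [t]) ds).HasType (Δ ++ [A']) ∧ (Net.mk (ts ++ [t]) ds).vars.Nodup ∧
        (Net.mk (ts ++ [t]) ds).IsSimple) →
      (Net.mk (ss ++ [s]) cs).vars.Disjoint (Net.mk (ts ++ [t]) ds).vars →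
      ((Net.mk (ss ++ ts ++ [.node φ [s, t]]) (cs ++ ds)).HasType (Γ ++ Δ ++ [B]) ∧
        (Net.mk (ss ++ ts ++ [.node φ [s, t]]) (cs ++ ds)).vars.Nodup ∧
        (Net.mk (ss ++ ts ++ [.node φ [s, t]]) (cs ++ ds)).IsSimple) := by
    rintro φ B A A' ss ts s t cs ds Γ Δ hφ ha hp ⟨h1, h2, h3⟩ ⟨h1', h2', h3'⟩ hd
    have hn : (Net.mk (ss ++ ts ++ [.node φ [s, t]]) (cs ++ ds)).vars.Nodup := by
      refine nodup_of_disjoint h2 h2' hd ?_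
      simp only [Net.coe_vars_mk, List.flatMap_append, List.flatMap_cons, List.flatMap_nil,
        Tree.vars_node, ← Multiset.coe_add]
      abel
    refine ⟨?_, hn, simple hn (fun u hu => ?_) fun c hc => ?_⟩
    · obtain ⟨L, e1, e2, e3⟩ := Net.hasType_concat.1 h1
      obtain ⟨L', e1', e2', e3'⟩ := Net.hasType_concat.1 h1'
      refine Net.hasType_concat.2 ⟨L ++ L', by simp [e1, e1'], by simp [e2, e2'], ?_⟩
      refine (Seq.pos' (ts := [s, t]) hφ rfl (e3.cons (e3'.cons .nil))).cast ?_ ?_ <;> simp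
    · simp only [List.mem_append, List.mem_singleton] at hu
      rcases hu with (hu | hu) | rfl
      · exact (trees h3).1 u (by simp [hu])
      · exact (trees h3').1 u (by simp [hu])
      · refine node hn (isCon hp) (by simp [ha]) fun u hu => ?_
        simp only [List.mem_cons, List.not_mem_nil, or_false] at hu
        rcases hu with rfl | rfl
        · exact (trees h3).1 u (by simp)
        · exact (trees h3').1 u (by simp)
    · rcases List.mem_append.1 hc with hc | hc
      exacts [(trees h3).2 c hc, (trees h3').2 c hc]
  induction h with
  | ax x A _ _ =>
    have hn : (Net.mk [(.var x : Tree k Var), .var (CoInvol.co x)] []).vars.Nodup := by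
      simp [Net.vars_mk, (CoInvol.co_ne x).symm]
    refine ⟨⟨[(.var x, A), (.var (CoInvol.co x), A.orth)], rfl, rfl, .ax x A trivial⟩, hn,
      simple hn (fun t ht => ?_) (by simp)⟩
    simp only [List.mem_cons, List.not_mem_nil, or_false] at ht
    rcases ht with rfl | rfl <;> exact .var _
  | @perm n t cs A σ _ ih =>
    obtain ⟨h1, h2, h3⟩ := ih
    have hp : (List.ofFn fun i => t (σ i)).Perm (List.ofFn t) :=
      Equiv.Perm.ofFn_comp_perm σ t
    have hn : (Net.mk (List.ofFn fun i => t (σ i)) cs).vars.Nodup := by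
      refine (List.Perm.nodup_iff ?_).2 h2
      rw [Net.vars_mk, Net.vars_mk]
      exact (hp.flatMap_right _).append_right _
    refine ⟨?_, hn, simple hn (fun t ht => (trees h3).1 t (hp.mem_iff.1 ht)) (trees h3).2⟩
    rw [Net.hasType_mk (L := List.ofFn fun i => (t i, A i)) (by rw [List.map_ofFn]; rfl)
      (by rw [List.map_ofFn]; rfl)] at h1
    refine (Net.hasType_mk (L := List.ofFn fun i => (t (σ i), A (σ i)))
      (by rw [List.map_ofFn]; rfl) (by rw [List.map_ofFn]; rfl)).2 (h1.cast ?_ rfl)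
    exact Multiset.coe_eq_coe.2 (Equiv.Perm.ofFn_comp_perm σ fun i => (t i, A i)).symm
  | cut ss ts s t cs ds Γ Δ A _ _ hd ih ih' =>
    obtain ⟨h1, h2, h3⟩ := ih
    obtain ⟨h1', h2', h3'⟩ := ih'
    have hn : (Net.mk (ss ++ ts) (cs ++ ds ++ [(s, t)])).vars.Nodup := by
      refine nodup_of_disjoint h2 h2' hd ?_
      simp only [Net.coe_vars_mk, List.flatMap_append, List.flatMap_cons, List.flatMap_nil,
        Cut.vars, ← Multiset.coe_add]
      abel
    refine ⟨?_, hn, simple hn (fun u hu => ?_) fun c hc => ?_⟩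
    · obtain ⟨L, e1, e2, e3⟩ := Net.hasType_concat.1 h1
      obtain ⟨L', e1', e2', e3'⟩ := Net.hasType_concat.1 h1'
      refine ⟨L ++ L', by simp [e1, e1', Net.trees], by simp [e2, e2'],
        (e3.cut e3').cast (by simp) ?_⟩
      rw [Net.cuts, ← Multiset.coe_add, add_comm, ← Multiset.coe_add]; rfl
    · rcases List.mem_append.1 hu with hu | hu
      exacts [(trees h3).1 u (by simp [hu]), (trees h3').1 u (by simp [hu])]
    · simp only [List.mem_append, List.mem_singleton] at hc
      rcases hc with (hc | hc) | rfl
      exacts [(trees h3).2 c hc, (trees h3').2 c hc,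
        ⟨(trees h3).1 s (by simp), (trees h3').1 t (by simp)⟩]
  | par ts s t cs Γ A B _ ih => exact neg (.par A B) rfl rfl (by simp) ih
  | tens ss ts s t cs ds Γ Δ A B _ _ hd ih ih' => exact pos (.tens A B) rfl (by simp) ih ih' hd
  | mix ss ts cs ds Γ Δ _ _ hd ih ih' =>
    obtain ⟨h1, h2, h3⟩ := ih
    obtain ⟨h1', h2', h3'⟩ := ih'
    have hn := nodup_of_disjoint h2 h2' hd (Net.vars_append ss ts cs ds)
    refine ⟨?_, hn, simple hn (fun u hu => ?_) fun c hc => ?_⟩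
    · obtain ⟨L, e1, e2, e3⟩ := h1
      obtain ⟨L', e1', e2', e3'⟩ := h1'
      exact ⟨L ++ L', by simp [e1, e1', Net.trees], by simp [e2, e2'], e3.mix e3'⟩
    · rcases List.mem_append.1 hu with hu | hu
      exacts [(trees h3).1 u hu, (trees h3').1 u hu]
    · rcases List.mem_append.1 hc with hc | hc
      exacts [(trees h3).2 c hc, (trees h3').2 c hc]
  | weak ss cs Γ A _ ih =>
    exact neg (ts := []) (Δ := []) (.weak A) rfl rfl (by simp) (by simpa using ih)
  | coweak A =>
    have hn : (Net.mk [(.coweak : Tree k Var)] []).vars.Nodup := by simp [Net.vars_mk]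
    refine ⟨⟨[(.coweak, .bang A)], rfl, rfl, .pos' (ts := []) (.coweak A) rfl .nil⟩, hn,
      simple hn (fun t ht => ?_) (by simp)⟩
    obtain rfl := List.mem_singleton.1 ht
    exact node (ss := []) hn (isCon (by simp)) rfl (by simp)
  | der ss s cs Γ A _ ih => exact neg (.der A) rfl rfl (by simp) ih
  | coder ss s cs Γ A _ ih => exact neg (.coder A) rfl rfl (by simp) ih
  | contr ss s₁ s₂ cs Γ A _ ih => exact neg (.contr A) rfl rfl (by simp) ih
  | cocontr ss ts s t cs ds Γ Δ A _ _ hd ih ih' =>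
    exact pos (.cocontr A) rfl (by simp) ih ih' hd
  | @prom n P ts t cs Γ A B _ _ hd ihP ih =>
    have hn : (Net.mk ((List.ofFn ts).flatten ++ [.prom n P (List.ofFn t)])
        (List.ofFn cs).flatten).vars.Nodup := by
      rw [← Multiset.coe_nodup, sum_ofFn_flatMap]
      exact nodup_sum (fun i => Multiset.coe_nodup.2 (ih i).2.1) fun i j hij x hx hx' =>
        hd i j hij hx hx'
    -- The contents are derivable in `Φ`, but `IsNetSum` asks for derivability over every context;
    -- it is regained through `Net.HasType`.
    have hb : IsNetSum ((List.ofFn A).map (fun A => A.orth.quest) ++ [B]) P :=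
      isNetSum_of_forall fun a ha => by
        rw [List.map_ofFn]
        exact ⟨(ihP a ha).1, (ihP a ha).2.1⟩
    refine ⟨?_, hn, simple hn (fun u hu => ?_) fun c hc => ?_⟩
    · choose L h1 h2 h3 using fun i => Net.hasType_concat.1 (ih i).1
      refine Net.hasType_concat.2 ⟨(List.ofFn L).flatten, ?_, ?_, ?_⟩
      · rw [List.map_flatten, List.map_ofFn]
        exact congrArg _ (congrArg _ (funext h1))
      · rw [List.map_flatten, List.map_ofFn]
        exact congrArg _ (congrArg _ (funext h2))
      · have hφ := PosRule.prom _ B P hb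
        have := Seq.pos (L := List.ofFn fun i => (t i, (A i).bang)) (φ := .prom n P) (B := .bang B)
          (by simpa [List.map_ofFn, Function.comp_def] using hφ) (Seq.some_ofFn _ L cs h3)
        simpa [List.map_ofFn, Function.comp_def] using this
    · rcases List.mem_append.1 hu with hu | hu
      · obtain ⟨l, hl, hu⟩ := List.mem_flatten.1 hu
        obtain ⟨i, rfl⟩ := List.mem_ofFn.1 hl
        exact (trees (ih i).2.2).1 u (by simp [hu])
      · obtain rfl := List.mem_singleton.1 hu
        refine node hn ⟨_, ?_, ?_⟩ (by simp [Con.arity]) fun u hu => ?_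
        · rintro n' P' e a ha
          cases e
          exact (ihP a ha).2.2
        · rintro n' P' e a ha
          cases e
          simpa [Net.width] using (ihP a ha).1.length_eq
        · obtain ⟨i, rfl⟩ := List.mem_ofFn.1 hu
          exact (trees (ih i).2.2).1 _ (by simp)
    · obtain ⟨l, hl, hc⟩ := List.mem_flatten.1 hc
      obtain ⟨i, rfl⟩ := List.mem_ofFn.1 hl
      exact (trees (ih i).2.2).2 c hc

end NetTyping

-- Invariance of typability under identification, inversion and derived rules.

section Invariance

variable {k : Type u} {Var : Type v} {Atom : Type w} [CoInvol Var] [CoInvol Atom] [CommSemiring k]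
  {T : Var → Formula Atom → Prop} {o : Option (List (Tree k Var × Formula Atom))}
  {S S' S₀ S₁ S₂ : Multiset (Tree k Var × Formula Atom)} {C C' C₀ C₁ C₂ : Multiset (Cut k Var)}

theorem IsNetSum.congr {Γ : List (Formula Atom)} {P Q : FSum k Var} (h : IsNetSum Γ P)
    (hPQ : FSum.value P = FSum.value Q) : IsNetSum Γ Q := fun c hc => h c (by rwa [hPQ])

theorem PosRule.congr {n : ℕ} {P Q : FSum k Var} {As : List (Formula Atom)} {B : Formula Atom}
    (h : PosRule (.prom n P) As B) (hPQ : FSum.value P = FSum.value Q) :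
    PosRule (.prom n Q) As B := by
  cases h with
  | prom As B _ h => exact .prom As B Q (h.congr hPQ)

/-- The typing of a box depends on its label only through the linear combination that it denotes. -/
theorem Seq.prom_congr {n : ℕ} {P Q : FSum k Var} {ts : List (Tree k Var)} {A : Formula Atom}
    (hPQ : FSum.value P = FSum.value Q) (h : Seq T none ({(.prom n P ts, A)} + S) C) :
    Seq T none ({(.prom n Q ts, A)} + S) C := by
  obtain ⟨L, S₁, C₁, rfl, hr, hf⟩ := h.exists_rule rfl
  rcases hr with ⟨hr, h1⟩ | ⟨hr, h1⟩
  · cases hr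
  · exact (hf {(.prom n Q (L.map Prod.fst), A)} 0 ((Seq.pos (hr.congr hPQ) h1).cast rfl
      (zero_add _).symm)).cast rfl (zero_add _)

theorem Seq.treeStep {t t' : Tree k Var} (h : TreeStep t t') (A : Formula Atom)
    (S : Multiset (Tree k Var × Formula Atom)) (C : Multiset (Cut k Var)) :
    Seq T none ({(t, A)} + S) C ↔ Seq T none ({(t', A)} + S) C := by
  refine TreeStep.rec (motive_1 := fun t t' _ => ∀ A S C,
      Seq T none ({(t, A)} + S) C ↔ Seq T none ({(t', A)} + S) C) (motive_2 := fun _ _ _ => True)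
    (motive_3 := fun _ _ _ => True)
    ?_ ?_ ?_ ?_ ?_ ?_ ?_ ?_ ?_ ?_ ?_ ?_ ?_ ?_ ?_ ?_ ?_ ?_ h A S C
  any_goals intros; trivial
  · intro n P Q ts h _ A S C
    exact ⟨Seq.prom_congr h.value_eq, Seq.prom_congr h.value_eq.symm⟩
  · intro φ us vs t t' _ ih A S C
    constructor
    · intro h
      obtain ⟨B, S₁, C₁, h1, h2⟩ := h.exists_argument
      exact (h2 t' 0 (((ih B S₁ C₁).1 h1).cast rfl (zero_add _).symm)).cast rfl (zero_add _)
    · intro h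
      obtain ⟨B, S₁, C₁, h1, h2⟩ := h.exists_argument
      exact (h2 t 0 (((ih B S₁ C₁).2 h1).cast rfl (zero_add _).symm)).cast rfl (zero_add _)

theorem Seq.treeEq {t t' : Tree k Var} (h : TreeEq t t') (A : Formula Atom)
    (S : Multiset (Tree k Var × Formula Atom)) (C : Multiset (Cut k Var)) :
    Seq T none ({(t, A)} + S) C ↔ Seq T none ({(t', A)} + S) C := by
  induction h with
  | rel _ _ h => exact Seq.treeStep h A S C
  | refl => rfl
  | symm _ _ _ ih => exact ih.symm
  | trans _ _ _ _ _ ih ih' => exact ih.trans ih'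

theorem Seq.cutEq {c d : Cut k Var} (hcd : CutEq c d) (h : Seq T o S ({c} + C)) :
    Seq T o S ({d} + C) := by
  obtain ⟨s, t⟩ := c
  obtain ⟨s', t'⟩ := d
  obtain ⟨A, S₁, S₂, C₁, C₂, h1, h2, hf⟩ := h.exists_cut rfl
  have key : ∀ {s' t'}, TreeEq s s' → TreeEq t t' → Seq T o S ({(s', t')} + C) := fun hs ht =>
    (hf 0 {(_, _)} ((((Seq.treeEq hs _ _ _).1 h1).cut ((Seq.treeEq ht _ _ _).1 h2)).cast
      (by abel) (by abel))).cast (by abel) rfl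
  rcases hcd with ⟨hs, ht⟩ | ⟨hs, ht⟩
  · exact key hs ht
  · exact (key hs ht).swap

theorem Seq.rel_cutEq {D : Multiset (Cut k Var)} (hCD : Multiset.Rel CutEq C D)
    (E : Multiset (Cut k Var)) (h : Seq T o S (E + C)) : Seq T o S (E + D) := by
  induction hCD generalizing E with
  | zero => exact h
  | @cons c d C D hcd _ ih =>
    have h1 : Seq T o S ({d} + (E + C)) :=
      Seq.cutEq hcd (h.cast rfl (by rw [← Multiset.singleton_add]; abel))
    have h2 := ih ({d} + E) (h1.cast rfl (by abel))
    exact h2.cast rfl (by rw [← Multiset.singleton_add]; abel)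

theorem Seq.forall₂_treeEq {ts : List (Tree k Var)} {L : List (Tree k Var × Formula Atom)}
    (hts : List.Forall₂ TreeEq (L.map Prod.fst) ts) (S : Multiset (Tree k Var × Formula Atom))
    (h : Seq T none (Multiset.ofList L + S) C) :
    ∃ L' : List (Tree k Var × Formula Atom), L'.map Prod.fst = ts ∧
      L'.map Prod.snd = L.map Prod.snd ∧ Seq T none (Multiset.ofList L' + S) C := by
  induction L generalizing ts S with
  | nil =>
    cases hts
    exact ⟨[], rfl, rfl, h⟩
  | cons a L ih =>
    cases hts with | @cons _ t _ ts ht hts =>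
    have h1 : Seq T none ({(t, a.2)} + (Multiset.ofList L + S)) C := by
      refine (Seq.treeEq ht _ _ _).1 (h.cast ?_ rfl)
      rw [← Multiset.cons_coe, ← Multiset.singleton_add, add_assoc]
    obtain ⟨L', h2, h3, h4⟩ := ih hts ({(t, a.2)} + S) (h1.cast (by abel) rfl)
    refine ⟨(t, a.2) :: L', by simp [h2], by simp [h3], h4.cast ?_ rfl⟩
    rw [← Multiset.cons_coe, ← Multiset.singleton_add]
    abel

/-- Typability is invariant under identification. -/
theorem Net.HasType.of_netEq {p q : Net k Var} {Γ : List (Formula Atom)} (h : p.HasType Γ)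
    (hpq : NetEq p q) : q.HasType Γ := by
  obtain ⟨σ, hσ, -, hs⟩ := hpq.exists_rename
  obtain ⟨L, h1, h2, h3⟩ := h
  have h4 := h3.rename (T' := fun _ _ => True) σ hσ fun _ _ h => h
  simp only [Option.map_none, Multiset.map_coe] at h4
  set L' := L.map (bindTyped fun x => .var (σ x)) with hL'
  have h1' : L'.map Prod.fst = (p.rename σ).trees := by
    rw [hL', map_fst_bindTyped, h1]; rfl
  have h2' : L'.map Prod.snd = Γ := by rw [hL', map_snd_bindTyped, h2]
  change Seq _ none (Multiset.ofList L') (Multiset.ofList (p.rename σ).cuts) at h4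
  obtain ⟨L'', h5, h6, h7⟩ := Seq.forall₂_treeEq (h1' ▸ hs.1) 0 (h4.cast (by abel) rfl)
  exact ⟨L'', h5, h6.trans h2', (Seq.rel_cutEq hs.2 0 (h7.cast (by abel)
    (zero_add _).symm)).cast rfl (zero_add _)⟩

/-- Stating the typing of box contents by means of `Logic` keeps `Seq` out of its own side
conditions. This lemma returns to `Seq` when a box is opened. -/
theorem IsNetClass.hasType [Infinite Var] {p : Net k Var} {Γ : List (Formula Atom)}
    (h : IsNetClass Γ p.toClass) : p.HasType Γ := by
  -- Any context would do; the empty one is at hand.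
  let Φ : TypingContext Var Atom := ⟨fun _ => none, by simp, by simp⟩
  obtain ⟨Φ', -, q, hq, hl⟩ := h Φ
  exact hl.hasType.1.of_netEq (Net.toClass_eq.1 hq)

/-! ### Inversion -/

/-- The root constructor determines the rule, and the frame keeps all that comes after it. The other
inversions follow the same pattern. -/
theorem Seq.inv_par {s t : Tree k Var} {A : Formula Atom}
    (h : Seq T o ({(.par s t, A)} + S) C) : ∃ X Y S₁ C₁, A = .par X Y ∧
      Seq T none ({(s, X)} + ({(t, Y)} + S₁)) C₁ ∧ Frame T S₁ C₁ o S C := by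
  obtain ⟨L, S₁, C₁, hts, hr, hf⟩ := h.exists_rule rfl
  obtain ⟨⟨s, X⟩, ⟨t, Y⟩, rfl, rfl, rfl⟩ := exists_of_map_eq_pair hts.symm
  rcases hr with ⟨hr, h1⟩ | ⟨hr, h1⟩
  · cases hr
    exact ⟨X, Y, S₁, C₁, rfl, h1.cast (by rw [← add_assoc]; rfl) rfl, hf⟩
  · cases hr

theorem Seq.inv_contr {s t : Tree k Var} {A : Formula Atom}
    (h : Seq T o ({(.contr s t, A)} + S) C) : ∃ X S₁ C₁, A = .quest X ∧
      Seq T none ({(s, .quest X)} + ({(t, .quest X)} + S₁)) C₁ ∧ Frame T S₁ C₁ o S C := by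
  obtain ⟨L, S₁, C₁, hts, hr, hf⟩ := h.exists_rule rfl
  obtain ⟨⟨s, X⟩, ⟨t, Y⟩, rfl, rfl, rfl⟩ := exists_of_map_eq_pair hts.symm
  rcases hr with ⟨hr, h1⟩ | ⟨hr, h1⟩
  · cases hr with | contr X =>
    exact ⟨X, S₁, C₁, rfl, h1.cast (by rw [← add_assoc]; rfl) rfl, hf⟩
  · cases hr

theorem Seq.inv_weak {A : Formula Atom} (h : Seq T o ({(.weak, A)} + S) C) :
    ∃ X S₁ C₁, A = .quest X ∧ Seq T none S₁ C₁ ∧ Frame T S₁ C₁ o S C := by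
  obtain ⟨L, S₁, C₁, hts, hr, hf⟩ := h.exists_rule rfl
  obtain rfl := List.map_eq_nil_iff.1 hts.symm
  rcases hr with ⟨hr, h1⟩ | ⟨hr, h1⟩
  · cases hr with | weak X =>
    exact ⟨X, S₁, C₁, rfl, h1.cast (zero_add _) rfl, hf⟩
  · cases hr

theorem Seq.inv_der {s : Tree k Var} {A : Formula Atom} (h : Seq T o ({(.der s, A)} + S) C) :
    ∃ X S₁ C₁, A = .quest X ∧ Seq T none ({(s, X)} + S₁) C₁ ∧ Frame T S₁ C₁ o S C := by
  obtain ⟨L, S₁, C₁, hts, hr, hf⟩ := h.exists_rule rfl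
  obtain ⟨⟨s, X⟩, rfl, rfl⟩ := exists_of_map_eq_singleton hts.symm
  rcases hr with ⟨hr, h1⟩ | ⟨hr, h1⟩
  · cases hr
    exact ⟨X, S₁, C₁, rfl, h1, hf⟩
  · cases hr

theorem Seq.inv_coder {s : Tree k Var} {A : Formula Atom} (h : Seq T o ({(.coder s, A)} + S) C) :
    ∃ X S₁ C₁, A = .bang X ∧ Seq T none ({(s, X)} + S₁) C₁ ∧ Frame T S₁ C₁ o S C := by
  obtain ⟨L, S₁, C₁, hts, hr, hf⟩ := h.exists_rule rfl
  obtain ⟨⟨s, X⟩, rfl, rfl⟩ := exists_of_map_eq_singleton hts.symm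
  rcases hr with ⟨hr, h1⟩ | ⟨hr, h1⟩
  · cases hr
    exact ⟨X, S₁, C₁, rfl, h1, hf⟩
  · cases hr

/-- Coweakening has no premise. Once it is removed, nothing is left in the hole of the frame. -/
theorem Seq.inv_coweak {A : Formula Atom} (h : Seq T o ({(.coweak, A)} + S) C) :
    ∃ X, A = .bang X ∧ Frame T 0 0 o S C := by
  obtain ⟨L, S₁, C₁, hts, hr, hf⟩ := h.exists_rule rfl
  obtain rfl := List.map_eq_nil_iff.1 hts.symm
  rcases hr with ⟨hr, h1⟩ | ⟨hr, h1⟩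
  · cases hr
  · obtain ⟨rfl, rfl⟩ := h1.some_nil
    cases hr with | coweak X => exact ⟨X, rfl, hf⟩

theorem Seq.inv_tens {s t : Tree k Var} {A : Formula Atom}
    (h : Seq T o ({(.tens s t, A)} + S) C) : ∃ X Y S₁ S₂ C₁ C₂, A = .tens X Y ∧
      Seq T none ({(s, X)} + S₁) C₁ ∧ Seq T none ({(t, Y)} + S₂) C₂ ∧
      Frame T (S₁ + S₂) (C₁ + C₂) o S C := by
  obtain ⟨L, S₀, C₀, hts, hr, hf⟩ := h.exists_rule rfl
  obtain ⟨⟨s, X⟩, ⟨t, Y⟩, rfl, rfl, rfl⟩ := exists_of_map_eq_pair hts.symm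
  rcases hr with ⟨hr, h1⟩ | ⟨hr, h1⟩
  · cases hr
  · obtain ⟨S₁, S₂, C₁, C₂, rfl, rfl, h2, h3⟩ := h1.some_cons
    obtain ⟨S₃, S₄, C₃, C₄, rfl, rfl, h4, h5⟩ := h3.some_cons
    obtain ⟨rfl, rfl⟩ := h5.some_nil
    cases hr
    exact ⟨X, Y, S₁, S₃, C₁, C₃, rfl, h2, h4, by simpa using hf⟩

theorem Seq.inv_cocontr {s t : Tree k Var} {A : Formula Atom}
    (h : Seq T o ({(.cocontr s t, A)} + S) C) : ∃ X S₁ S₂ C₁ C₂, A = .bang X ∧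
      Seq T none ({(s, .bang X)} + S₁) C₁ ∧ Seq T none ({(t, .bang X)} + S₂) C₂ ∧
      Frame T (S₁ + S₂) (C₁ + C₂) o S C := by
  obtain ⟨L, S₀, C₀, hts, hr, hf⟩ := h.exists_rule rfl
  obtain ⟨⟨s, X⟩, ⟨t, Y⟩, rfl, rfl, rfl⟩ := exists_of_map_eq_pair hts.symm
  rcases hr with ⟨hr, h1⟩ | ⟨hr, h1⟩
  · cases hr
  · obtain ⟨S₁, S₂, C₁, C₂, rfl, rfl, h2, h3⟩ := h1.some_cons
    obtain ⟨S₃, S₄, C₃, C₄, rfl, rfl, h4, h5⟩ := h3.some_cons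
    obtain ⟨rfl, rfl⟩ := h5.some_nil
    cases hr with | cocontr X =>
    exact ⟨X, S₁, S₃, C₁, C₃, rfl, h2, h4, by simpa using hf⟩

theorem Seq.inv_prom {n : ℕ} {P : FSum k Var} {ts : List (Tree k Var)} {A : Formula Atom}
    (h : Seq T o ({(.prom n P ts, A)} + S) C) :
    ∃ (As : List (Formula Atom)) (B : Formula Atom) (S₁ : Multiset (Tree k Var × Formula Atom))
      (C₁ : Multiset (Cut k Var)), A = .bang B ∧ As.length = n ∧ ts.length = n ∧
      IsNetSum (As.map (fun A => A.orth.quest) ++ [B]) P ∧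
      Seq T (some (ts.zip (As.map .bang))) S₁ C₁ ∧ Frame T S₁ C₁ o S C := by
  obtain ⟨L, S₁, C₁, rfl, hr, hf⟩ := h.exists_rule rfl
  rcases hr with ⟨hr, h1⟩ | ⟨hr, h1⟩
  · cases hr
  · generalize hΘ : L.map Prod.snd = Θ at hr
    cases hr with | prom As B _ hP =>
    refine ⟨As, B, S₁, C₁, rfl, rfl, by simpa using congrArg List.length hΘ, hP, ?_, hf⟩
    have hz : (L.map Prod.fst).zip (L.map Prod.snd) = L :=
      eq_of_map_fst_snd (List.map_fst_zip (by simp)) (List.map_snd_zip (by simp))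
    rw [← hΘ, hz]
    exact h1

/-- After a reduction the two sides of a cut are joined in one derivation, which cannot be split
into two premises. It can still be passed through the two frames in turn, each side waiting in `W`
and `F` while the other is completed. This is why frames allow an arbitrary context. -/
theorem Frame.pair (hf : Frame T (S + S') (C + C') o S₀ C₀) (h : Frame T S₁ C₁ none S C)
    (h' : Frame T S₂ C₂ none S' C') : Frame T (S₁ + S₂) (C₁ + C₂) o S₀ C₀ := fun W F hW => by
  have h1 := h (W + S₂) (F + C₂) (hW.cast (by abel) (by abel))
  have h2 := h' (W + S) (F + C) (h1.cast (by abel) (by abel))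
  exact hf W F (h2.cast (by abel) (by abel))

theorem Frame.close (hf : Frame T S C o S₀ C₀) {F : Multiset (Cut k Var)}
    (h : Seq T none S (F + C)) : Seq T o S₀ (F + C₀) :=
  (hf 0 F (h.cast (zero_add _).symm rfl)).cast (zero_add _) rfl

/-! ### Derived rules -/

theorem Seq.weak {X : Formula Atom} (h : Seq T none S C) :
    Seq T none ({(.weak, .quest X)} + S) C :=
  .neg' (ts := []) (.weak X) rfl (h.cast (zero_add _).symm rfl)

theorem Seq.coder {X : Formula Atom} {s : Tree k Var} (h : Seq T none ({(s, X)} + S) C) :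
    Seq T none ({(.coder s, .bang X)} + S) C :=
  .neg' (ts := [s]) (.coder X) rfl h

theorem Seq.contr {X : Formula Atom} {s t : Tree k Var}
    (h : Seq T none ({(s, .quest X)} + ({(t, .quest X)} + S)) C) :
    Seq T none ({(.contr s t, .quest X)} + S) C :=
  .neg' (ts := [s, t]) (.contr X) rfl (h.cast (add_assoc _ _ _).symm rfl)

theorem Seq.coweak (X : Formula Atom) : Seq (k := k) T none {(.coweak, .bang X)} 0 :=
  (Seq.pos' (ts := []) (.coweak X) rfl .nil).cast (add_zero _) rfl

theorem Seq.cocontr {X : Formula Atom} {s t : Tree k Var}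
    (h : Seq T none ({(s, .bang X)} + S) C) (h' : Seq T none ({(t, .bang X)} + S') C') :
    Seq T none ({(.cocontr s t, .bang X)} + (S + S')) (C + C') :=
  (Seq.pos' (ts := [s, t]) (.cocontr X) rfl (h.cons (h'.cons .nil))).cast (by abel) (by abel)

theorem Seq.prom {As : List (Formula Atom)} {B : Formula Atom} {P : FSum k Var}
    {ts : List (Tree k Var)} {n : ℕ} (hP : IsNetSum (As.map (fun A => A.orth.quest) ++ [B]) P)
    (hn : As.length = n) (hts : ts.length = n)
    (h : Seq T (some (ts.zip (As.map .bang))) S C) :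
    Seq T none ({(.prom n P ts, .bang B)} + S) C := by
  subst hn
  exact .pos' (.prom As B P hP) (by simp [hts]) h

/-- The members of `L` belong to separate nets, while those of `R` lie in a single one. The cuts can
thus be made one after the other, each merging one more net. -/
theorem Seq.cut_list {L R : List (Tree k Var × Formula Atom)}
    (hLR : List.Forall₂ (fun a b => b.2 = a.2.orth) L R) (hL : Seq T (some L) S C)
    (hR : Seq T none (Multiset.ofList R + S') C') :
    Seq T none (S + S') (Multiset.ofList ((L.map Prod.fst).zip (R.map Prod.fst)) + (C + C')) := by
  induction hLR generalizing S C S' C' with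
  | nil =>
    obtain ⟨rfl, rfl⟩ := hL.some_nil
    exact hR.cast (by rfl) (by simp)
  | @cons a b L R hab _ ih =>
    obtain ⟨S₁, S₂, C₁, C₂, rfl, rfl, h1, h2⟩ := hL.some_cons
    have h3 : Seq T none ({(b.1, a.2.orth)} + (Multiset.ofList R + S')) C' :=
      hR.cast (by rw [← Multiset.cons_coe, ← Multiset.singleton_add, add_assoc, ← hab]) rfl
    have h4 := ih h2 ((Seq.cut h1 h3).cast (S' := Multiset.ofList R + (S₁ + S')) (by abel) rfl)
    refine h4.cast (by abel) ?_
    rw [List.map_cons, List.map_cons, List.zip_cons_cons, ← Multiset.cons_coe,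
      ← Multiset.singleton_add]
    abel

/-- The reduction rules do not all write the cuts on the arguments of a box in the same orientation.
-/
theorem rel_cutEq_zip_swap (ss ts : List (Tree k Var)) :
    Multiset.Rel CutEq (Multiset.ofList (ss.zip ts)) (Multiset.ofList (ts.zip ss)) := by
  induction ss generalizing ts with
  | nil => simp
  | cons s ss ih =>
    cases ts with
    | nil => simp
    | cons t ts => exact .cons (.inr ⟨.refl _, .refl _⟩) (ih ts)

theorem Seq.zip_swap {ss ts : List (Tree k Var)}
    (h : Seq T o S (Multiset.ofList (ss.zip ts) + C)) :
    Seq T o S (Multiset.ofList (ts.zip ss) + C) :=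
  (Seq.rel_cutEq (rel_cutEq_zip_swap ss ts) C (h.cast rfl (add_comm _ _))).cast rfl (add_comm _ _)

theorem forall₂_orth_zip {ts us : List (Tree k Var)} {As : List (Formula Atom)}
    (ht : ts.length = As.length) (hu : us.length = As.length) :
    List.Forall₂ (fun a b : Tree k Var × Formula Atom => b.2 = a.2.orth)
      (ts.zip (As.map .bang)) (us.zip (As.map fun A => A.orth.quest)) := by
  induction As generalizing ts us with
  | nil => simp
  | cons A As ih =>
    match ts, us, ht, hu with
    | t :: ts, u :: us, ht, hu => exact .cons rfl (ih (by simpa using ht) (by simpa using hu))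

/-- Cuts between the arguments of a box and trees of the dual types. -/
theorem Seq.cut_zip {ts us : List (Tree k Var)} {As : List (Formula Atom)}
    (ht : ts.length = As.length) (hu : us.length = As.length)
    (h : Seq T (some (ts.zip (As.map .bang))) S C)
    (h' : Seq T none (Multiset.ofList (us.zip (As.map fun A => A.orth.quest)) + S') C') :
    Seq T none (S + S') (Multiset.ofList (ts.zip us) + (C + C')) := by
  have := Seq.cut_list (forall₂_orth_zip ht hu) h h'
  rwa [List.map_fst_zip (by simp [ht]), List.map_fst_zip (by simp [hu])] at this

theorem Seq.weak_list (As : List (Formula Atom)) (h : Seq T none S C) :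
    Seq T none (Multiset.ofList ((List.replicate As.length (.weak : Tree k Var)).zip
      (As.map fun A => A.orth.quest)) + S) C := by
  induction As with
  | nil => exact h.cast (zero_add _).symm rfl
  | cons A As ih =>
    refine (Seq.weak (X := A.orth) ih).cast ?_ rfl
    rw [List.length_cons, List.replicate_succ, List.map_cons, List.zip_cons_cons,
      ← Multiset.cons_coe, ← Multiset.singleton_add, add_assoc]

theorem Seq.contr_list {As : List (Formula Atom)} {ss ts : List (Tree k Var)}
    (hs : ss.length = As.length) (ht : ts.length = As.length)
    (h : Seq T none (Multiset.ofList (ss.zip (As.map fun A => A.orth.quest)) +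
      (Multiset.ofList (ts.zip (As.map fun A => A.orth.quest)) + S)) C) :
    Seq T none (Multiset.ofList ((List.zipWith Tree.contr ss ts).zip
      (As.map fun A => A.orth.quest)) + S) C := by
  induction As generalizing ss ts S with
  | nil => simpa using h
  | cons A As ih =>
    match ss, ts, hs, ht with
    | s :: ss, t :: ts, hs, ht =>
      simp only [List.map_cons, List.zip_cons_cons, ← Multiset.cons_coe,
        ← Multiset.singleton_add, List.zipWith_cons_cons] at h ⊢
      have h1 := Seq.contr (h.cast (S' := {(s, A.orth.quest)} + ({(t, A.orth.quest)} +
        (Multiset.ofList (ss.zip (As.map fun A => A.orth.quest)) +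
          (Multiset.ofList (ts.zip (As.map fun A => A.orth.quest)) + S)))) (by abel) rfl)
      have h2 := ih (S := {(.contr s t, A.orth.quest)} + S) (by simpa using hs) (by simpa using ht)
        (h1.cast (by abel) rfl)
      exact h2.cast (by abel) rfl

/-- The axioms that feed a copied box: the variables are its arguments, and their covariables become
available with the dual types. -/
theorem Seq.ax_list (hT : ∀ x A, T x A) {xs : List Var} {As : List (Formula Atom)}
    (hx : xs.length = As.length) :
    Seq (k := k) T (some ((xs.map .var).zip (As.map .bang)))
      (Multiset.ofList ((xs.map Tree.covar).zip (As.map fun A => A.orth.quest))) 0 := by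
  induction As generalizing xs with
  | nil => simpa using Seq.nil
  | cons A As ih =>
    match xs, hx with
    | x :: xs, hx =>
      simp only [List.map_cons, List.zip_cons_cons, ← Multiset.cons_coe, ← Multiset.singleton_add]
      exact (Seq.cons (.ax x _ (hT x _)) (ih (by simpa using hx))).cast rfl (by abel)

end Invariance

-- The basic cut reductions as transformations of derivations.

section CutElimination

variable {k : Type u} {Var : Type v} {Atom : Type w} [CoInvol Var] [CoInvol Atom] [CommSemiring k]
  {T : Var → Formula Atom → Prop} {o : Option (List (Tree k Var × Formula Atom))}
  {S S' S₀ S₁ S₂ : Multiset (Tree k Var × Formula Atom)} {C C' C₀ C₁ C₂ : Multiset (Cut k Var)}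
  {s s₁ s₂ t t₁ t₂ : Tree k Var}

theorem Seq.red_par_tens (h : Seq T o S ({(.par s₁ s₂, .tens t₁ t₂)} + C)) :
    Seq T o S (Multiset.ofList [(s₁, t₁), (s₂, t₂)] + C) := by
  obtain ⟨A, S₁, S₂, C₁, C₂, h1, h2, hf⟩ := h.exists_cut rfl
  obtain ⟨X, Y, S₃, C₃, rfl, h3, f3⟩ := h1.inv_par
  obtain ⟨X', Y', S₄, S₅, C₄, C₅, e, h4, h5, f4⟩ := h2.inv_tens
  obtain ⟨rfl, rfl⟩ : X.orth = X' ∧ Y.orth = Y' := by simpa [Formula.orth] using e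
  refine (hf.pair f3 f4).close ?_
  have h6 := (Seq.cut h3 h4).cast (S' := {(s₂, Y)} + (S₃ + S₄)) (by abel) rfl
  refine (Seq.cut h6 h5).cast (by abel) ?_
  rw [← Multiset.cons_coe, ← Multiset.singleton_add, Multiset.coe_singleton]
  abel

theorem Seq.red_weak_coweak (h : Seq T o S ({(.weak, .coweak)} + C)) : Seq T o S C := by
  obtain ⟨A, S₁, S₂, C₁, C₂, h1, h2, hf⟩ := h.exists_cut rfl
  obtain ⟨X, S₃, C₃, rfl, h3, f3⟩ := h1.inv_weak
  obtain ⟨X', e, f4⟩ := h2.inv_coweak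
  exact ((hf.pair f3 f4).close (F := 0) (h3.cast (by abel) (by abel))).cast rfl (zero_add _)

theorem Seq.red_contr_coweak (h : Seq T o S ({(.contr s₁ s₂, .coweak)} + C)) :
    Seq T o S (Multiset.ofList [(s₁, .coweak), (s₂, .coweak)] + C) := by
  obtain ⟨A, S₁, S₂, C₁, C₂, h1, h2, hf⟩ := h.exists_cut rfl
  obtain ⟨X, S₃, C₃, rfl, h3, f3⟩ := h1.inv_contr
  obtain ⟨X', e, f4⟩ := h2.inv_coweak
  refine (hf.pair f3 f4).close ?_
  have h4 : Seq (k := k) T none ({(.coweak, (Formula.quest X).orth)} + 0) 0 :=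
    (Seq.coweak X.orth).cast (add_zero _).symm rfl
  have h6 := (Seq.cut h3 h4).cast (S' := {(s₂, _)} + S₃) (by abel) rfl
  refine (Seq.cut h6 h4).cast (by abel) ?_
  rw [← Multiset.cons_coe, ← Multiset.singleton_add, Multiset.coe_singleton]
  abel

theorem Seq.red_weak_cocontr (h : Seq T o S ({(.weak, .cocontr t₁ t₂)} + C)) :
    Seq T o S (Multiset.ofList [(.weak, t₁), (.weak, t₂)] + C) := by
  obtain ⟨A, S₁, S₂, C₁, C₂, h1, h2, hf⟩ := h.exists_cut rfl
  obtain ⟨X, S₃, C₃, rfl, h3, f3⟩ := h1.inv_weak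
  obtain ⟨X', S₄, S₅, C₄, C₅, e, h4, h5, f4⟩ := h2.inv_cocontr
  obtain rfl : X.orth = X' := by simpa [Formula.orth] using e
  refine (hf.pair f3 f4).close ?_
  have h6 := (Seq.cut (Seq.weak (X := X) h3) h4)
  refine (Seq.cut (Seq.weak (X := X) h6) h5).cast (by abel) ?_
  rw [← Multiset.cons_coe, ← Multiset.singleton_add, Multiset.coe_singleton]
  abel

theorem Seq.red_der_coder (h : Seq T o S ({(.der s, .coder t)} + C)) :
    Seq T o S (Multiset.ofList [(s, t)] + C) := by
  obtain ⟨A, S₁, S₂, C₁, C₂, h1, h2, hf⟩ := h.exists_cut rfl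
  obtain ⟨X, S₃, C₃, rfl, h3, f3⟩ := h1.inv_der
  obtain ⟨X', S₄, C₄, e, h4, f4⟩ := h2.inv_coder
  obtain rfl : X.orth = X' := by simpa [Formula.orth] using e
  exact (hf.pair f3 f4).close (Seq.cut h3 h4)

theorem Seq.red_contr_coder (h : Seq T o S ({(.contr s₁ s₂, .coder t)} + C)) :
    Seq T o S (Multiset.ofList [(s₁, .coder t), (s₂, .coweak)] + C) ∧
      Seq T o S (Multiset.ofList [(s₁, .coweak), (s₂, .coder t)] + C) := by
  obtain ⟨A, S₁, S₂, C₁, C₂, h1, h2, hf⟩ := h.exists_cut rfl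
  obtain ⟨X, S₃, C₃, rfl, h3, f3⟩ := h1.inv_contr
  have h4 : Seq (k := k) T none ({(.coweak, (Formula.quest X).orth)} + 0) 0 :=
    (Seq.coweak X.orth).cast (add_zero _).symm rfl
  -- The codereliction is moved unchanged, so its premise is kept whole and its frame is trivial.
  have f5 := hf.pair f3 (.refl T S₂ C₂)
  constructor <;> refine f5.close ?_
  · have h6 := (Seq.cut h3 h2).cast (S' := {(s₂, _)} + (S₃ + S₂)) (by abel) rfl
    refine (Seq.cut h6 h4).cast (by abel) ?_
    rw [← Multiset.cons_coe, ← Multiset.singleton_add, Multiset.coe_singleton]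
    abel
  · have h6 := (Seq.cut h3 h4).cast (S' := {(s₂, _)} + S₃) (by abel) rfl
    refine (Seq.cut h6 h2).cast (by abel) ?_
    rw [← Multiset.cons_coe, ← Multiset.singleton_add, Multiset.coe_singleton]
    abel

theorem Seq.red_der_cocontr (h : Seq T o S ({(.der s, .cocontr t₁ t₂)} + C)) :
    Seq T o S (Multiset.ofList [(.der s, t₁), (.weak, t₂)] + C) ∧
      Seq T o S (Multiset.ofList [(.weak, t₁), (.der s, t₂)] + C) := by
  obtain ⟨A, S₁, S₂, C₁, C₂, h1, h2, hf⟩ := h.exists_cut rfl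
  obtain ⟨X', S₄, S₅, C₄, C₅, e, h4, h5, f4⟩ := h2.inv_cocontr
  -- Only the shape of the type is needed; the dereliction itself is cut again as it stands.
  obtain ⟨X, -, -, rfl, -, -⟩ := h1.inv_der
  obtain rfl : X.orth = X' := by simpa [Formula.orth] using e
  have f5 := hf.pair (.refl T S₁ C₁) f4
  constructor <;> refine f5.close ?_
  · refine (Seq.cut (Seq.weak (X := X) (Seq.cut h1 h4)) h5).cast (by abel) ?_
    rw [← Multiset.cons_coe, ← Multiset.singleton_add, Multiset.coe_singleton]
    abel
  · refine (Seq.cut (Seq.weak (X := X) (Seq.cut h1 h5)) h4).cast (by abel) ?_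
    rw [← Multiset.cons_coe, ← Multiset.singleton_add, Multiset.coe_singleton]
    abel

/-- Four axioms form a two-by-two exchange. The `sᵢ` are cut against cocontractions of the rows of
variables. This puts all the covariables in one net, where the columns can be contracted and cut
against the `tⱼ`. -/
theorem Seq.red_contr_cocontr (hT : ∀ x A, T x A)
    (h : Seq T o S ({(.contr s₁ s₂, .cocontr t₁ t₂)} + C)) (x₁₁ x₁₂ x₂₁ x₂₂ : Var) :
    Seq T o S (Multiset.ofList
      [(s₁, .cocontr (.var x₁₁) (.var x₁₂)), (s₂, .cocontr (.var x₂₁) (.var x₂₂)),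
        (.contr (.covar x₁₁) (.covar x₂₁), t₁), (.contr (.covar x₁₂) (.covar x₂₂), t₂)] + C) := by
  obtain ⟨A, S₁, S₂, C₁, C₂, h1, h2, hf⟩ := h.exists_cut rfl
  obtain ⟨X, S₃, C₃, rfl, h3, f3⟩ := h1.inv_contr
  obtain ⟨X', S₄, S₅, C₄, C₅, e, h4, h5, f4⟩ := h2.inv_cocontr
  obtain rfl : X.orth = X' := by simpa [Formula.orth] using e
  refine (hf.pair f3 f4).close ?_
  have hax : ∀ x : Var, Seq (k := k) T none ({(.var x, .bang X.orth)} + {(.covar x, .quest X)}) 0 :=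
    fun x => by
      have := Seq.ax (k := k) (T := T) x (.bang X.orth) (hT _ _)
      rwa [Formula.orth, Formula.orth_orth] at this
  have h6 := (Seq.cut h3 (Seq.cocontr (hax x₁₁) (hax x₁₂))).cast
    (S' := {(s₂, .quest X)} + (S₃ + ({(.covar x₁₁, .quest X)} + {(.covar x₁₂, .quest X)})))
    (by abel) rfl
  have h7 := (Seq.cut h6 (Seq.cocontr (hax x₂₁) (hax x₂₂))).cast
    (S' := {(.covar x₁₁, .quest X)} + ({(.covar x₂₁, .quest X)} +
      (S₃ + ({(.covar x₁₂, .quest X)} + {(.covar x₂₂, .quest X)}))))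
    (by abel) rfl
  have h8 := (Seq.cut h7.contr h4).cast
    (S' := {(.covar x₁₂, .quest X)} + ({(.covar x₂₂, .quest X)} + (S₃ + S₄))) (by abel) rfl
  refine (Seq.cut h8.contr h5).cast (by abel) ?_
  simp only [← Multiset.cons_coe, ← Multiset.singleton_add, Multiset.coe_nil, add_zero]
  abel

theorem Seq.red_prom_weak {n : ℕ} {P : FSum k Var} {ts : List (Tree k Var)}
    (h : Seq T o S ({(.prom n P ts, .weak)} + C)) :
    Seq T o S (Multiset.ofList (ts.map fun t => (t, .weak)) + C) := by
  obtain ⟨A, S₁, S₂, C₁, C₂, h1, h2, hf⟩ := h.exists_cut rfl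
  obtain ⟨As, B, S₃, C₃, rfl, hn, hts, -, h3, f3⟩ := h1.inv_prom
  obtain ⟨X, S₄, C₄, -, h4, f4⟩ := h2.inv_weak
  refine (hf.pair f3 f4).close ?_
  -- The weakening on the box is replaced by one weakening for each auxiliary type, and these are
  -- cut against the arguments.
  have h5 := Seq.cut_zip (hts.trans hn.symm) (by simp) h3 (h4.weak_list As)
  refine h5.cast rfl ?_
  congr 2
  rw [hn, ← hts]
  exact List.ext_getElem (by simp) (by simp)

theorem Seq.red_prom_contr (hT : ∀ x A, T x A) {n : ℕ} {P : FSum k Var} {ts : List (Tree k Var)}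
    (h : Seq T o S ({(.prom n P ts, .contr s₁ s₂)} + C)) {xs ys : List Var}
    (hx : xs.length = ts.length) (hy : ys.length = ts.length) :
    Seq T o S (Multiset.ofList ((.prom n P (xs.map .var), s₁) :: (.prom n P (ys.map .var), s₂) ::
      List.zip ts (List.zipWith (fun x y => .contr (.covar x) (.covar y)) xs ys)) + C) := by
  obtain ⟨A, S₁, S₂, C₁, C₂, h1, h2, hf⟩ := h.exists_cut rfl
  obtain ⟨As, B, S₃, C₃, rfl, hn, hts, hP, h3, f3⟩ := h1.inv_prom
  obtain ⟨X, S₄, C₄, e, h4, f4⟩ := h2.inv_contr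
  obtain rfl : B.orth = X := by simpa [Formula.orth] using e
  refine (hf.pair f3 f4).close ?_
  -- A copy of the box fed by axioms. The content is duplicated without being inspected.
  have hax : ∀ {xs : List Var}, xs.length = ts.length → Seq (k := k) T none
      ({(.prom n P (xs.map .var), .bang B)} +
        Multiset.ofList ((xs.map Tree.covar).zip (As.map fun A => A.orth.quest))) 0 := fun hx =>
    Seq.prom hP hn (by simp [hx, hts]) (Seq.ax_list hT (hx.trans (hts.trans hn.symm)))
  have h5 := (Seq.cut (hax hx) h4).cast
    (S' := {(s₂, (Formula.bang B).orth)} + (Multiset.ofList ((xs.map Tree.covar).zip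
      (As.map fun A => A.orth.quest)) + S₄)) (by rw [Formula.orth]; abel) rfl
  have h6 := (Seq.cut (hax hy) h5).cast
    (S' := Multiset.ofList ((xs.map Tree.covar).zip (As.map fun A => A.orth.quest)) +
      (Multiset.ofList ((ys.map Tree.covar).zip (As.map fun A => A.orth.quest)) + S₄))
    (by abel) rfl
  have h7 := Seq.contr_list (by simp [hx, hts, hn]) (by simp [hy, hts, hn]) h6
  have h8 := Seq.cut_zip (hts.trans hn.symm) (by simp [hx, hy, hts, hn]) h3 h7
  refine h8.cast (by abel) ?_
  rw [List.zipWith_map, ← Multiset.cons_coe, ← Multiset.cons_coe, ← Multiset.singleton_add,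
    ← Multiset.singleton_add]
  abel

/-- The summands of the content need not all be typable. The type `Γ` of the content is therefore
exhibited, and the conclusion is stated for each net of that type. -/
theorem Seq.red_prom_der {n : ℕ} {P : FSum k Var} {ts : List (Tree k Var)}
    (h : Seq (fun _ _ => True) o S ({(.prom n P ts, .der s)} + C)) : ∃ Γ, IsNetSum (Atom := Atom) Γ P ∧
      ∀ (ss : List (Tree k Var)) (s' : Tree k Var) (cs : List (Cut k Var)),
        (Net.mk (ss ++ [s']) cs).HasType Γ →
        Seq (fun _ _ => True) o S (Multiset.ofList (cs ++ ss.zip ts ++ [(s', s)]) + C) := by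
  obtain ⟨A, S₁, S₂, C₁, C₂, h1, h2, hf⟩ := h.exists_cut rfl
  obtain ⟨As, B, S₃, C₃, rfl, hn, hts, hP, h3, f3⟩ := h1.inv_prom
  obtain ⟨X, S₄, C₄, e, h4, f4⟩ := h2.inv_der
  obtain rfl : B.orth = X := by simpa [Formula.orth] using e
  refine ⟨_, hP, fun ss s' cs hty => ?_⟩
  have hss : ss.length = As.length := by simpa [Net.trees] using hty.length_eq
  refine (hf.pair f3 f4).close ?_
  obtain ⟨L, e1, e2, h5⟩ := Net.hasType_concat.1 hty
  -- The types of the auxiliary trees are dictated by the box.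
  have hL : L = ss.zip (As.map fun A => A.orth.quest) :=
    eq_of_map_fst_snd (by rw [e1, List.map_fst_zip (by simp [hss])])
      (by rw [e2, List.map_snd_zip (by simp [hss])])
  subst hL
  have h6 := Seq.cut_zip (hts.trans hn.symm) hss h3 (Seq.cut h5 h4)
  refine h6.zip_swap.cast rfl ?_
  rw [← Multiset.coe_add, ← Multiset.coe_add, Multiset.coe_singleton]
  abel

end CutElimination

-- Cut reduction of nets preserves types.

section CutReduction

variable {k : Type u} {Var : Type v} {Atom : Type w} [CoInvol Var] [CoInvol Atom] [CommSemiring k]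

theorem coe_flatMap_vars_zip {ss ts : List (Tree k Var)} (h : ss.length = ts.length) :
    Multiset.ofList ((ss.zip ts).flatMap Cut.vars) =
      Multiset.ofList (ss.flatMap Tree.vars) + Multiset.ofList (ts.flatMap Tree.vars) := by
  induction ss generalizing ts with
  | nil => simp [List.length_eq_zero_iff.1 h.symm]
  | cons s ss ih =>
    match ts, h with
    | t :: ts, h =>
      simp only [List.zip_cons_cons, List.flatMap_cons, ← Multiset.coe_add, Cut.vars,
        ih (ts := ts) (by simpa using h)]
      abel

theorem rel_cutEq_zip {ss ss' ts ts' : List (Tree k Var)} (hs : List.Forall₂ TreeEq ss ss')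
    (ht : List.Forall₂ TreeEq ts ts') :
    Multiset.Rel CutEq (Multiset.ofList (ss.zip ts)) (Multiset.ofList (ss'.zip ts')) := by
  induction hs generalizing ts ts' with
  | nil => simp
  | cons h _ ih =>
    cases ht with
    | nil => simp
    | cons h' ht => exact .cons (.inl ⟨h, h'⟩) (ih ht)

theorem Cut.map_rename_zip (σ : Var → Var) (ss ts : List (Tree k Var)) :
    (ss.zip ts).map (Cut.rename σ) = (ss.map (Tree.rename σ)).zip (ts.map (Tree.rename σ)) := by
  rw [List.zip_map]
  rfl

theorem forall₂_append_left_iff {α β : Type*} {R : α → β → Prop} {l₁ l₂ : List α}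
    {m₁ m₂ : List β} (hl : l₁.length = m₁.length) :
    List.Forall₂ R (l₁ ++ l₂) (m₁ ++ m₂) ↔ List.Forall₂ R l₁ m₁ ∧ List.Forall₂ R l₂ m₂ := by
  refine ⟨fun h => ?_, fun h => List.rel_append h.1 h.2⟩
  induction l₁ generalizing m₁ with
  | nil =>
    obtain rfl := List.length_eq_zero_iff.1 hl.symm
    exact ⟨.nil, h⟩
  | cons a l₁ ih =>
    match m₁, hl with
    | b :: m₁, hl =>
      cases h with | cons h h' =>
      obtain ⟨h1, h2⟩ := ih (by simpa using hl) h'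
      exact ⟨.cons h h1, h2⟩

/-- Every rule except the opening of a box acts on derivations separately for each summand. For the
opening only the data are recorded, because the coefficients in the content then matter. -/
theorem CutRed.seq {c : Cut k Var} {P : FSum k Var} (h : CutRed c P) :
    (∀ a ∈ P, a.2.trees = [] ∧ ∀ (S : Multiset (Tree k Var × Formula Atom)) C,
      Seq (fun _ _ => True) none S ({c} + C) →
      Seq (fun _ _ => True) none S (Multiset.ofList a.2.cuts + C)) ∨
    ∃ (L : List (k × List (Tree k Var) × Tree k Var × List (Cut k Var))) (ts : List (Tree k Var))
      (s : Tree k Var), (∀ e ∈ L, e.2.1.length = ts.length) ∧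
      c = (.prom ts.length (L.map fun e => (e.1, .mk (e.2.1 ++ [e.2.2.1]) e.2.2.2)) ts, .der s) ∧
      P = L.map fun e => (e.1, .mk [] (e.2.2.2 ++ List.zip e.2.1 ts ++ [(e.2.2.1, s)])) := by
  have hT : ∀ (x : Var) (A : Formula Atom), (fun _ _ => True : Var → Formula Atom → Prop) x A :=
    fun _ _ => trivial
  cases h with
  | prom_der L ts s hL => exact .inr ⟨L, ts, s, hL, rfl, rfl⟩
  -- The reduct is the empty sum.
  | der_coweak | weak_coder => left; simp
  | contr_coder s₁ s₂ t =>
    left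
    simp only [List.mem_cons, List.not_mem_nil, or_false, forall_eq_or_imp, forall_eq]
    exact ⟨⟨rfl, fun S C h => h.red_contr_coder.1⟩, ⟨rfl, fun S C h => h.red_contr_coder.2⟩⟩
  | der_cocontr s t₁ t₂ =>
    left
    simp only [List.mem_cons, List.not_mem_nil, or_false, forall_eq_or_imp, forall_eq]
    exact ⟨⟨rfl, fun S C h => h.red_der_cocontr.1⟩, ⟨rfl, fun S C h => h.red_der_cocontr.2⟩⟩
  | par_tens => exact .inl (by simpa using ⟨rfl, fun S C h => h.red_par_tens⟩)
  | weak_coweak =>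
    refine .inl fun a ha => ?_
    obtain rfl := List.mem_singleton.1 ha
    exact ⟨rfl, fun S C h => h.red_weak_coweak.cast rfl (zero_add _).symm⟩
  | contr_coweak =>
    refine .inl fun a ha => ?_
    obtain rfl := List.mem_singleton.1 ha
    exact ⟨rfl, fun S C h => h.red_contr_coweak⟩
  | weak_cocontr =>
    refine .inl fun a ha => ?_
    obtain rfl := List.mem_singleton.1 ha
    exact ⟨rfl, fun S C h => h.red_weak_cocontr⟩
  | der_coder =>
    refine .inl fun a ha => ?_
    obtain rfl := List.mem_singleton.1 ha
    exact ⟨rfl, fun S C h => h.red_der_coder⟩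
  | contr_cocontr s₁ s₂ t₁ t₂ x₁₁ x₁₂ x₂₁ x₂₂ =>
    refine .inl fun a ha => ?_
    obtain rfl := List.mem_singleton.1 ha
    exact ⟨rfl, fun S C h => h.red_contr_cocontr hT x₁₁ x₁₂ x₂₁ x₂₂⟩
  | prom_weak =>
    refine .inl fun a ha => ?_
    obtain rfl := List.mem_singleton.1 ha
    exact ⟨rfl, fun S C h => h.red_prom_weak⟩
  | prom_contr P ts s₁ s₂ xs ys hx hy =>
    refine .inl fun a ha => ?_
    obtain rfl := List.mem_singleton.1 ha
    exact ⟨rfl, fun S C h => h.red_prom_contr hT hx hy⟩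

/-- Cut reduction preserves types. -/
theorem NetRedCut.isNetSum [Infinite Var] {q : Net k Var} {R : FSum k Var}
    {Γ : List (Formula Atom)} (h : NetRedCut q R) (hq : q.HasType Γ) (hs : q.IsSimple)
    (hR : ∀ a ∈ R, a.2.IsSimple) : IsNetSum Γ R := by
  cases h with
  | var_cut ts x s cs hx =>
    refine isNetSum_of_forall fun a ha => ⟨?_, (hR a ha).nodup⟩
    obtain rfl := List.mem_singleton.1 ha
    obtain ⟨L, h1, h2, h3⟩ := hq
    have hocc := occ_of_map_fst h1
    -- The linearity of the source net bounds the number of occurrences of `x`.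
    have h4 := h3.subst_cut (x := x) (s := s) (C₀ := Multiset.ofList cs) rfl (by
      classical
      rw [hocc]
      exact Multiset.nodup_iff_count_le_one.1 (Multiset.coe_nodup.2 hs.nodup) x)
    refine ⟨L.map (bindTyped (substFun (CoInvol.co x) s)), ?_, ?_, h4⟩
    · rw [map_fst_bindTyped, h1]; rfl
    · rw [map_snd_bindTyped, h2]
  | context ss c bs P h =>
    obtain ⟨L, h1, h2, h3⟩ := hq
    have h3' : Seq (fun _ _ => True) none (Multiset.ofList L) ({c} + Multiset.ofList bs) := h3
    rcases CutRed.seq (Atom := Atom) h with h | ⟨L', ts, s, hL, rfl, rfl⟩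
    · refine isNetSum_of_forall fun a ha => ⟨?_, (hR a ha).nodup⟩
      obtain ⟨b, hb, rfl⟩ := List.mem_map.1 ha
      obtain ⟨h4, h5⟩ := h b hb
      refine ⟨L, ?_, h2, h5 _ _ h3'⟩
      rw [h1]
      change ss = ss ++ b.2.trees
      rw [h4, List.append_nil]
    · obtain ⟨Θ, hΘ, h4⟩ := h3'.red_prom_der
      rw [List.map_map] at hR ⊢
      intro d hd
      have nodup : ∀ e ∈ L', (Net.mk (ss ++ []) ((e.2.2.2 ++ List.zip e.2.1 ts ++ [(e.2.2.1, s)])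
          ++ bs)).vars.Nodup := fun e he => (hR _ (List.mem_map_of_mem he)).nodup
      -- The class at hand comes from a content of nonzero coefficient, which is typable. This
      -- requires that identified contents give identified reducts.
      obtain ⟨e, he, rfl, hv⟩ := FSum.exists_of_value_map_ne_zero L'
        (fun e => .mk (e.1 ++ [e.2.1]) e.2.2)
        (fun e => .mk (ss ++ []) ((e.2.2 ++ List.zip e.1 ts ++ [(e.2.1, s)]) ++ bs)) (by
          intro a ha b hb hab
          have vars : ∀ e ∈ L', Multiset.ofList (Net.mk (ss ++ []) ((e.2.2.2 ++
              List.zip e.2.1 ts ++ [(e.2.2.1, s)]) ++ bs)).vars =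
              Multiset.ofList (Net.mk (e.2.1 ++ [e.2.2.1]) e.2.2.2).vars +
              Multiset.ofList (ss.flatMap Tree.vars ++ ts.flatMap Tree.vars ++ s.vars ++
                bs.flatMap Cut.vars) := fun e he => by
            simp only [Net.coe_vars_mk, List.flatMap_append, ← Multiset.coe_add,
              coe_flatMap_vars_zip (hL e he), List.flatMap_cons, List.flatMap_nil, Cut.vars,
              Multiset.coe_nil, add_zero]
            abel
          -- The common context consists of `ss`, `ts`, `s` and `bs`; a renaming that fixes its
          -- variables only acts on the opened content.
          refine NetEq.of_context _ hab (vars a ha) (vars b hb) (nodup a ha) (nodup b hb) ?_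
          rintro σ hσ ⟨ht, hc⟩
          have hss : ss.map (Tree.rename σ) = ss :=
            Tree.map_rename_eq_self _ fun x hx => hσ x (by
              simp only [Multiset.mem_coe, List.mem_append]; tauto)
          have hts : ts.map (Tree.rename σ) = ts :=
            Tree.map_rename_eq_self _ fun x hx => hσ x (by
              simp only [Multiset.mem_coe, List.mem_append]; tauto)
          have hbs : bs.map (Cut.rename σ) = bs :=
            Cut.map_rename_eq_self _ fun x hx => hσ x (by
              simp only [Multiset.mem_coe, List.mem_append]; tauto)
          have hs' : s.rename σ = s :=
            Tree.rename_eq_self _ fun x hx => hσ x (by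
              simp only [Multiset.mem_coe, List.mem_append]; tauto)
          simp only [Net.rename_mk, Net.trees, Net.cuts, List.map_append, List.map_cons,
            List.map_nil] at ht hc ⊢
          obtain ⟨ht1, ht2⟩ := (forall₂_append_left_iff
            (by simp [hL a ha, hL b hb])).1 ht
          cases ht2 with | cons ht2 _ =>
          refine ⟨by simpa [Net.trees, hss] using forall₂_treeEq_refl ss, ?_⟩
          simp only [Net.cuts, Cut.map_rename_zip, hts, hbs, ← Multiset.coe_add]
          refine .add (.add (.add hc (rel_cutEq_zip ht1 (forall₂_treeEq_refl ts))) ?_)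
            (rel_cutEq_refl _)
          exact .cons (.inl ⟨ht2, by rw [Cut.rename, hs']; exact .refl _⟩) .zero) hd
      have h5 := (hΘ _ hv).hasType
      refine Net.HasType.isNetClass ⟨L, by simpa [Net.trees] using h1, h2, ?_⟩ (nodup e he)
      exact h4 _ _ _ h5

end CutReduction

-- The commutative reductions as transformations of derivations.

section CommutativeSteps

variable {k : Type u} {Var : Type v} {Atom : Type w} [CoInvol Var] [CoInvol Atom] [CommSemiring k]
  {T : Var → Formula Atom → Prop} {o : Option (List (Tree k Var × Formula Atom))}
  {S S' S₀ S₁ S₂ : Multiset (Tree k Var × Formula Atom)} {C C' C₀ C₁ C₂ : Multiset (Cut k Var)}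

theorem exists_eq_append_cons {α : Type*} {l : List α} {m n : ℕ} (h : l.length = m + n + 1) :
    ∃ l₁ a l₂, l = l₁ ++ a :: l₂ ∧ l₁.length = m ∧ l₂.length = n := by
  have hd : (l.drop m).length = n + 1 := by rw [List.length_drop]; omega
  match e : l.drop m, hd with
  | a :: l₂, hd =>
    exact ⟨l.take m, a, l₂, by rw [← e, List.take_append_drop],
      by rw [List.length_take]; omega, by simpa using hd⟩

/-- The middle block is put in front, because the rules act there when a port is replaced. -/
theorem Net.hasType_main {ls ms rs : List (Tree k Var)} {s : Tree k Var} {cs : List (Cut k Var)}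
    {Γ₁ Γ₂ Γ₃ : List (Formula Atom)} {B : Formula Atom} (h₁ : ls.length = Γ₁.length)
    (h₂ : ms.length = Γ₂.length) (h₃ : rs.length = Γ₃.length) :
    (Net.mk (ls ++ ms ++ rs ++ [s]) cs).HasType (Γ₁ ++ Γ₂ ++ Γ₃ ++ [B]) ↔
      Seq (fun _ _ => True) none (Multiset.ofList (ms.zip Γ₂) + ({(s, B)} +
        (Multiset.ofList (ls.zip Γ₁) + Multiset.ofList (rs.zip Γ₃)))) (Multiset.ofList cs) := by
  rw [Net.hasType_mk (L := ls.zip Γ₁ ++ ms.zip Γ₂ ++ rs.zip Γ₃ ++ [(s, B)])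
    (by simp [List.map_fst_zip h₁.le, List.map_fst_zip h₂.le, List.map_fst_zip h₃.le])
    (by simp [List.map_snd_zip h₁.ge, List.map_snd_zip h₂.ge, List.map_snd_zip h₃.ge])]
  have : Multiset.ofList (ls.zip Γ₁ ++ ms.zip Γ₂ ++ rs.zip Γ₃ ++ [(s, B)]) =
      Multiset.ofList (ms.zip Γ₂) + ({(s, B)} +
        (Multiset.ofList (ls.zip Γ₁) + Multiset.ofList (rs.zip Γ₃))) := by
    rw [← Multiset.coe_add, ← Multiset.coe_add, ← Multiset.coe_add, Multiset.coe_singleton]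
    abel
  rw [this]

theorem Ported.hasType_net {e : Ported k Var} {Γ₁ Γ₃ : List (Formula Atom)} {A B : Formula Atom}
    (h₁ : e.before.length = Γ₁.length) (h₃ : e.after.length = Γ₃.length) :
    e.net.HasType (Γ₁ ++ A :: Γ₃ ++ [B]) ↔
      Seq (fun _ _ => True) none ({(e.port, A)} + ({(e.main, B)} +
        (Multiset.ofList (e.before.zip Γ₁) + Multiset.ofList (e.after.zip Γ₃))))
        (Multiset.ofList e.cuts) := by
  have := Net.hasType_main (cs := e.cuts) (s := e.main) (B := B) h₁
    (ms := [e.port]) (Γ₂ := [A]) rfl h₃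
  simpa [Ported.net] using this

/-- The typing of a box in which the argument `t` is absorbed: the tree `w` is a copy of the root
of `t`, and the list `ms` consists of the covariables of the arguments of this root. -/
theorem Seq.absorb {n : ℕ} {P : FSum k Var} {ls us rs ms : List (Tree k Var)} {t w : Tree k Var}
    {A : Formula Atom} (hn : n = ls.length + rs.length + 1)
    (h : Seq T none ({(.prom n P (ls ++ t :: rs), A)} + S) C)
    (ht : ∀ A S C, Seq T none ({(t, .bang A)} + S) C →
      ∃ (As : List (Formula Atom)) (S' : Multiset (Tree k Var × Formula Atom))
        (C' : Multiset (Cut k Var)), us.length = As.length ∧ ms.length = As.length ∧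
        Seq T (some (us.zip (As.map .bang))) S' C' ∧ Frame T S' C' none S C ∧
        Seq (fun _ _ => True) none ({(w, .bang A)} +
          Multiset.ofList (ms.zip (As.map fun A => A.orth.quest))) 0) :
    ∃ Γ Γ' : List (Formula Atom), IsNetSum Γ P ∧
      (∀ e : Ported k Var, e.before.length = ls.length → e.after.length = rs.length →
        e.net.HasType Γ → (Net.mk (e.before ++ ms ++ e.after ++ [e.main])
          (e.cuts ++ [(e.port, w)])).HasType Γ') ∧
      ∀ (R : FSum k Var) (m : ℕ), m = ls.length + us.length + rs.length → IsNetSum Γ' R →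
        Seq T none ({(.prom m R (ls ++ us ++ rs), A)} + S) C := by
  obtain ⟨As, B, S₁, C₁, rfl, hAs, -, hP, h1, f1⟩ := h.inv_prom
  -- `A` is the type at the position of the absorbed argument.
  obtain ⟨As₁, A, As₂, rfl, hl, hr⟩ := exists_eq_append_cons (hAs.trans hn)
  rw [List.map_append, List.map_cons, List.zip_append (by simp [hl]), List.zip_cons_cons] at h1
  obtain ⟨S₂, S₃, C₂, C₃, rfl, rfl, h2, h3⟩ := h1.exists_of_some_append
  obtain ⟨S₄, S₅, C₄, C₅, rfl, rfl, h4, h5⟩ := h3.some_cons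
  obtain ⟨As, S₆, C₆, hus, hms, h6, f2, h7⟩ := ht _ _ _ h4
  refine ⟨_, (As₁ ++ As ++ As₂).map (fun A => A.orth.quest) ++ [B], hP, fun e he he' hty => ?_,
    fun R m hm hR => ?_⟩
  · rw [List.map_append, List.map_cons, Ported.hasType_net (by simp [he, hl])
      (by simp [he', hr])] at hty
    rw [List.map_append, List.map_append, Net.hasType_main (by simp [he, hl])
      (by simp [hms]) (by simp [he', hr])]
    have h7' : Seq (fun _ _ => True) none ({(w, A.orth.quest.orth)} +
        Multiset.ofList (ms.zip (As.map fun A => A.orth.quest))) 0 := by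
      rwa [Formula.orth, Formula.orth_orth]
    -- Inside the box, the port is cut against the copy `w`, and the covariables `ms` take its place
    -- among the auxiliary trees.
    refine (Seq.cut hty h7').cast (by abel) ?_
    rw [← Multiset.coe_add, Multiset.coe_singleton]
    abel
  · have h8 : Seq T (some ((ls ++ us ++ rs).zip ((As₁ ++ As ++ As₂).map .bang)))
        (S₂ + (S₆ + S₅)) (C₂ + (C₆ + C₅)) := by
      rw [List.map_append, List.map_append, List.append_assoc, List.append_assoc,
        List.zip_append (by simp [hl]), List.zip_append (by simp [hus])]
      exact h2.some_append (h6.some_append h5)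
    have h9 := Seq.prom (n := m) hR (by simp [hl, hr, hus, hm, add_assoc])
      (by simp [hm, add_assoc]) h8
    -- Outside, the arguments of `t` feed the new box directly. The rules that followed the root of
    -- `t` are replayed below it by `f2`, and those that followed the old box by `f1`.
    have h10 := f2 ({(.prom m R (ls ++ us ++ rs), .bang B)} + (S₂ + S₅)) (C₂ + C₅)
      (h9.cast (by abel) (by abel))
    exact (f1 {(.prom m R (ls ++ us ++ rs), .bang B)} 0 (h10.cast (by abel) (by abel))).cast rfl
      (zero_add _)

/-- This is the chain rule for a box. One summand of its content is taken out, with the port cut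
against the codereliction, and is cocontracted with a copy of the whole box in which this port is
coweakened. The other auxiliary trees of the two copies are contracted and cut against the original
arguments. -/
theorem Seq.red_prom_coder {n : ℕ} {P : FSum k Var} {ls rs : List (Tree k Var)} {u : Tree k Var}
    {A : Formula Atom} (hn : n = ls.length + rs.length + 1)
    (h : Seq (fun _ _ => True) none ({(.prom n P (ls ++ .coder u :: rs), A)} + S) C)
    {xs ys : List Var} (hx : xs.length = ls.length) (hy : ys.length = rs.length) :
    ∃ Γ : List (Formula Atom), IsNetSum Γ P ∧
      ∀ e : Ported k Var, e.before.length = ls.length → e.after.length = rs.length →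
        e.net.HasType Γ → Seq (fun _ _ => True) none
          ({(.cocontr (.prom n P (xs.map .var ++ .coweak :: ys.map .var)) (.coder e.main), A)} + S)
          (Multiset.ofList (e.cuts ++ [(e.port, .coder u)]
              ++ List.zip (List.zipWith (fun x s => .contr (.covar x) s) xs e.before) ls
              ++ List.zip (List.zipWith (fun x s => .contr (.covar x) s) ys e.after) rs) + C) := by
  obtain ⟨As, B, S₁, C₁, rfl, hAs, -, hP, h1, f1⟩ := h.inv_prom
  obtain ⟨As₁, A, As₂, rfl, hl, hr⟩ := exists_eq_append_cons (hAs.trans hn)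
  rw [List.map_append, List.map_cons, List.zip_append (by simp [hl]), List.zip_cons_cons] at h1
  obtain ⟨S₂, S₃, C₂, C₃, rfl, rfl, h2, h3⟩ := h1.exists_of_some_append
  obtain ⟨S₄, S₅, C₄, C₅, rfl, rfl, h4, h5⟩ := h3.some_cons
  refine ⟨_, hP, fun e he he' hty => ?_⟩
  rw [List.map_append, List.map_cons, Ported.hasType_net (by simp [he, hl])
    (by simp [he', hr])] at hty
  set Θ₁ := As₁.map fun A => A.orth.quest
  set Θ₂ := As₂.map fun A => A.orth.quest
  have h4' : Seq (fun _ _ => True) none ({(.coder u, A.orth.quest.orth)} + S₄) C₄ := by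
    rwa [Formula.orth, Formula.orth_orth]
  -- The linear copy, extracted from the box.
  have h6 := (Seq.cut hty h4').cast (S' := {(e.main, B)} +
    (Multiset.ofList (e.before.zip Θ₁) + Multiset.ofList (e.after.zip Θ₂) + S₄)) (by abel) rfl
  have hax : ∀ {xs : List Var} {As : List (Formula Atom)}, xs.length = As.length →
      Seq (k := k) (fun _ _ => True) (some ((xs.map .var).zip (As.map .bang)))
        (Multiset.ofList ((xs.map Tree.covar).zip (As.map fun A => A.orth.quest))) 0 :=
    fun h => Seq.ax_list (fun _ _ => trivial) h
  -- The arguments of the remaining copy of the box: axioms everywhere except for a coweakening at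
  -- the port.
  have h7 := (hax (hx.trans hl.symm)).some_append
    (Seq.cons ((Seq.coweak A).cast (S' := {(.coweak, .bang A)} + 0) (add_zero _).symm rfl)
      (hax (hy.trans hr.symm)))
  rw [← List.zip_cons_cons, ← List.zip_append (by simp [hx, hl]), ← List.map_cons,
    ← List.map_append] at h7
  have h8 := Seq.prom hP hAs (by simp [hx, hy, hn, add_assoc]) h7
  set w : Tree k Var :=
    .cocontr (.prom n P (xs.map .var ++ .coweak :: ys.map .var)) (.coder e.main)
  have h9 := (Seq.cocontr h8 h6.coder).cast (S' :=
    Multiset.ofList ((xs.map Tree.covar).zip Θ₁) + (Multiset.ofList (e.before.zip Θ₁) +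
      ({(w, .bang B)} + (Multiset.ofList ((ys.map Tree.covar).zip Θ₂) +
        Multiset.ofList (e.after.zip Θ₂) + S₄)))) (by abel) rfl
  -- The cocontraction has put both copies in one net, so their auxiliary trees can be contracted
  -- pairwise, on each side of the port.
  have h10 := (Seq.contr_list (by simp [hx, hl]) (by simp [he, hl]) h9).cast (S' :=
    Multiset.ofList ((ys.map Tree.covar).zip Θ₂) + (Multiset.ofList (e.after.zip Θ₂) +
      ({(w, .bang B)} + (Multiset.ofList ((List.zipWith Tree.contr (xs.map Tree.covar)
        e.before).zip Θ₁) + S₄)))) (by abel) rfl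
  have h11 := (Seq.contr_list (by simp [hy, hr]) (by simp [he', hr]) h10).cast (S' :=
    Multiset.ofList ((List.zipWith Tree.contr (xs.map Tree.covar) e.before).zip Θ₁) +
      (Multiset.ofList ((List.zipWith Tree.contr (ys.map Tree.covar) e.after).zip Θ₂) +
      ({(w, .bang B)} + S₄))) (by abel) rfl
  have h12 := (Seq.cut_zip hl.symm (by simp [hx, he, hl]) h2 h11).zip_swap.cast (S' :=
    Multiset.ofList ((List.zipWith Tree.contr (ys.map Tree.covar) e.after).zip Θ₂) +
      ({(w, .bang B)} + (S₂ + S₄))) (by abel) rfl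
  have h13 := (Seq.cut_zip hr.symm (by simp [hy, he', hr]) h5 h12).zip_swap
  rw [List.zipWith_map_left, List.zipWith_map_left] at h13
  refine f1 {(w, .bang B)} _ (h13.cast (by abel) ?_)
  rw [← Multiset.coe_add, ← Multiset.coe_add, ← Multiset.coe_add, Multiset.coe_singleton]
  abel

end CommutativeSteps

-- Commutative reduction of nets preserves types.

section CommutativeReduction

variable {k : Type u} {Var : Type v} {Atom : Type w} [CoInvol Var] [CoInvol Atom] [CommSemiring k]

/-- The function `G` fills the hole of a net with a tree and adds cuts; the variables of the
surrounding net are those of `M`. -/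
structure IsHole (G : Tree k Var → List (Cut k Var) → Net k Var) (M : Multiset Var) : Prop where
  vars : ∀ w ds, Multiset.ofList (G w ds).vars =
    Multiset.ofList w.vars + Multiset.ofList (ds.flatMap Cut.vars) + M
  rename : ∀ σ : Equiv.Perm Var, (∀ x ∈ M, σ x = x) → ∀ w ds,
    (G w ds).rename σ = G (w.rename σ) (ds.map (Cut.rename σ))
  structEq : ∀ w w' ds ds', TreeEq w w' →
    Multiset.Rel CutEq (Multiset.ofList ds) (Multiset.ofList ds') →
    (G w ds).StructEq (G w' ds')
  isTree : ∀ w ds, (G w ds).IsSimple → w.IsTree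

theorem forall₂_treeEq_insert (us vs : List (Tree k Var)) {w w' : Tree k Var} (h : TreeEq w w') :
    List.Forall₂ TreeEq (us ++ w :: vs) (us ++ w' :: vs) :=
  List.rel_append (forall₂_treeEq_refl us) (.cons h (forall₂_treeEq_refl vs))

/-- A constructor around the reduced tree is absorbed into the hole. Closure under constructors thus
becomes an induction with a varying hole, starting from `IsHole.tree` or `IsHole.cut`. -/
theorem IsHole.node {G : Tree k Var → List (Cut k Var) → Net k Var} {M : Multiset Var}
    (hG : IsHole G M) (φ : Con k Var) (us vs : List (Tree k Var)) :
    IsHole (fun w ds => G (.node φ (us ++ w :: vs)) ds)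
      (Multiset.ofList (us.flatMap Tree.vars) + Multiset.ofList (vs.flatMap Tree.vars) + M) where
  vars w ds := by
    simp only [hG.vars, Tree.vars_node, List.flatMap_append, List.flatMap_cons,
      ← Multiset.coe_add]
    abel
  rename σ hσ w ds := by
    simp only [Multiset.mem_add, Multiset.mem_coe] at hσ
    rw [hG.rename σ (fun x hx => hσ x (.inr hx)), Tree.rename_node, List.map_append, List.map_cons,
      Tree.map_rename_eq_self us fun x hx => hσ x (.inl (.inl hx)),
      Tree.map_rename_eq_self vs fun x hx => hσ x (.inl (.inr hx))]
  structEq w w' ds ds' hw hd :=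
    hG.structEq _ _ _ _ (TreeEq.node φ (forall₂_treeEq_insert us vs hw)) hd
  isTree w ds h := (hG.isTree _ _ h).sub_mem (by simp)

theorem IsHole.tree (us vs : List (Tree k Var)) (cs : List (Cut k Var)) :
    IsHole (fun w ds => .mk (us ++ w :: vs) (cs ++ ds))
      (Multiset.ofList (us.flatMap Tree.vars) + Multiset.ofList (vs.flatMap Tree.vars) +
        Multiset.ofList (cs.flatMap Cut.vars)) where
  vars w ds := by
    simp only [Net.coe_vars_mk, List.flatMap_append, List.flatMap_cons, ← Multiset.coe_add]
    abel
  rename σ hσ w ds := by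
    simp only [Multiset.mem_add, Multiset.mem_coe] at hσ
    rw [Net.rename_mk, List.map_append, List.map_append, List.map_cons,
      Tree.map_rename_eq_self us fun x hx => hσ x (.inl (.inl hx)),
      Tree.map_rename_eq_self vs fun x hx => hσ x (.inl (.inr hx)),
      Cut.map_rename_eq_self cs fun x hx => hσ x (.inr hx)]
  structEq w w' ds ds' hw hd := by
    refine ⟨forall₂_treeEq_insert us vs hw, ?_⟩
    simp only [Net.cuts, ← Multiset.coe_add]
    exact .add (rel_cutEq_refl _) hd
  isTree w ds h := h.isTree (by simp [Net.trees])

theorem IsHole.cut (ts : List (Tree k Var)) (t : Tree k Var) (cs : List (Cut k Var)) :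
    IsHole (fun w ds => .mk ts (cs ++ ds ++ [(w, t)]))
      (Multiset.ofList (ts.flatMap Tree.vars) + Multiset.ofList t.vars +
        Multiset.ofList (cs.flatMap Cut.vars)) where
  vars w ds := by
    simp only [Net.coe_vars_mk, List.flatMap_append, List.flatMap_cons, ← Multiset.coe_add,
      List.flatMap_nil, Cut.vars, Multiset.coe_nil, add_zero]
    abel
  rename σ hσ w ds := by
    simp only [Multiset.mem_add, Multiset.mem_coe] at hσ
    rw [Net.rename_mk, List.map_append, List.map_append, List.map_cons, List.map_nil, Cut.rename,
      Tree.map_rename_eq_self ts fun x hx => hσ x (.inl (.inl hx)),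
      Tree.rename_eq_self t fun x hx => hσ x (.inl (.inr hx)),
      Cut.map_rename_eq_self cs fun x hx => hσ x (.inr hx)]
  structEq w w' ds ds' hw hd := by
    refine ⟨forall₂_treeEq_refl ts, ?_⟩
    simp only [Net.cuts, ← Multiset.coe_add]
    exact .add (.add (rel_cutEq_refl _) hd) (.cons (.inl ⟨hw, .refl _⟩) .zero)
  isTree w ds h := h.isTree_left (c := (w, t)) (by simp [Net.cuts])

/-- The tree `t` can be replaced, in the net described by `G`, by any tree of the same type. -/
def Replaceable (G : Tree k Var → List (Cut k Var) → Net k Var) (t : Tree k Var)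
    (Γ : List (Formula Atom)) : Prop :=
  ∃ (A : Formula Atom) (S : Multiset (Tree k Var × Formula Atom)) (C : Multiset (Cut k Var)),
    Seq (fun _ _ => True) none ({(t, A)} + S) C ∧
    ∀ w ds, Seq (fun _ _ => True) none ({(w, A)} + S) (Multiset.ofList ds + C) →
      (G w ds).HasType Γ

theorem Ported.vars_net (e : Ported k Var) : Multiset.ofList e.net.vars =
    Multiset.ofList (e.before.flatMap Tree.vars) + Multiset.ofList e.port.vars +
      Multiset.ofList (e.after.flatMap Tree.vars) + Multiset.ofList e.main.vars +
      Multiset.ofList (e.cuts.flatMap Cut.vars) := by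
  simp only [Ported.net, Net.coe_vars_mk, List.flatMap_append, List.flatMap_cons, List.flatMap_nil,
    ← Multiset.coe_add, Multiset.coe_nil, add_zero]
  abel

theorem Ported.of_structEq_net {σ : Var → Var} {a b : Ported k Var}
    (h₁ : a.before.length = b.before.length) (h₂ : a.after.length = b.after.length)
    (h : (a.net.rename σ).StructEq b.net) :
    List.Forall₂ TreeEq (a.before.map (Tree.rename σ)) b.before ∧
      TreeEq (a.port.rename σ) b.port ∧
      List.Forall₂ TreeEq (a.after.map (Tree.rename σ)) b.after ∧
      TreeEq (a.main.rename σ) b.main ∧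
      Multiset.Rel CutEq (Multiset.ofList (a.cuts.map (Cut.rename σ))) (Multiset.ofList b.cuts) := by
  obtain ⟨ht, hc⟩ := h
  simp only [Ported.net, Net.rename_mk, Net.trees, Net.cuts, List.map_append, List.map_cons,
    List.map_nil] at ht hc
  obtain ⟨h3, h4⟩ := (forall₂_append_left_iff (by simp [h₁, h₂])).1 ht
  obtain ⟨h5, h6⟩ := (forall₂_append_left_iff (by simp [h₁])).1 h3
  cases h4 with | cons h4 _ =>
  cases h6 with | cons h6 h7 =>
  exact ⟨h5, h6, h7, h4, hc⟩

/-- The content of a box in which an argument is absorbed. -/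
theorem isNetSum_absorb [Infinite Var] {Γ Γ' : List (Formula Atom)} {m n : ℕ}
    (L : List (k × Ported k Var)) (ms : List (Tree k Var)) (w : Tree k Var)
    (hP : IsNetSum Γ (L.map fun a => (a.1, a.2.net)))
    (hl : ∀ a ∈ L, a.2.before.length = m) (hr : ∀ a ∈ L, a.2.after.length = n)
    (hty : ∀ e : Ported k Var, e.before.length = m → e.after.length = n → e.net.HasType Γ →
      (Net.mk (e.before ++ ms ++ e.after ++ [e.main]) (e.cuts ++ [(e.port, w)])).HasType Γ')
    (hs : ∀ a ∈ L, (Net.mk (a.2.before ++ ms ++ a.2.after ++ [a.2.main])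
      (a.2.cuts ++ [(a.2.port, w)])).IsSimple) :
    IsNetSum Γ' (L.map fun a => (a.1, .mk (a.2.before ++ ms ++ a.2.after ++ [a.2.main])
      (a.2.cuts ++ [(a.2.port, w)]))) := by
  intro d hd
  obtain ⟨e, he, rfl, hv⟩ := FSum.exists_of_value_map_ne_zero L Ported.net
    (fun e => .mk (e.before ++ ms ++ e.after ++ [e.main]) (e.cuts ++ [(e.port, w)])) (by
      intro a ha b hb hab
      have vars : ∀ e : Ported k Var, Multiset.ofList (Net.mk (e.before ++ ms ++ e.after ++
          [e.main]) (e.cuts ++ [(e.port, w)])).vars = Multiset.ofList e.net.vars +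
          Multiset.ofList (ms.flatMap Tree.vars ++ w.vars) := fun e => by
        simp only [Ported.vars_net, Net.coe_vars_mk, List.flatMap_append, List.flatMap_cons,
          List.flatMap_nil, ← Multiset.coe_add, Multiset.coe_nil, add_zero, Cut.vars]
        abel
      refine NetEq.of_context _ hab (vars _) (vars _) (hs a ha).nodup (hs b hb).nodup ?_
      intro σ hσ h
      obtain ⟨h1, h2, h3, h4, h5⟩ := Ported.of_structEq_net (by rw [hl a ha, hl b hb])
        (by rw [hr a ha, hr b hb]) h
      have hms : ms.map (Tree.rename σ) = ms :=
        Tree.map_rename_eq_self _ fun x hx => hσ x (by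
          simp only [Multiset.mem_coe, List.mem_append]; tauto)
      have hw : w.rename σ = w :=
        Tree.rename_eq_self _ fun x hx => hσ x (by
          simp only [Multiset.mem_coe, List.mem_append]; tauto)
      simp only [Net.rename_mk, List.map_append, List.map_cons, List.map_nil, hms, Cut.rename, hw]
      refine ⟨List.rel_append (List.rel_append (List.rel_append h1 (forall₂_treeEq_refl ms)) h3)
        (.cons h4 .nil), ?_⟩
      simp only [Net.cuts, ← Multiset.coe_add]
      exact .add h5 (.cons (.inl ⟨h2, .refl _⟩) .zero)) hd
  exact (hty e.2 (hl e he) (hr e he) (hP _ hv).hasType).isNetClass (hs e he).nodup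

/-- Absorption of an argument by a box, in a context. -/
theorem isNetSum_of_absorb [Infinite Var] {G : Tree k Var → List (Cut k Var) → Net k Var}
    {M : Multiset Var} (hG : IsHole G M) {Γ : List (Formula Atom)} {ls us rs ms : List (Tree k Var)}
    {t w : Tree k Var} {m : ℕ} {L : List (k × Ported k Var)}
    (hl : ∀ a ∈ L, a.2.before.length = ls.length) (hr : ∀ a ∈ L, a.2.after.length = rs.length)
    (hm : m = ls.length + us.length + rs.length)
    (hty : Replaceable G (.prom (ls.length + rs.length + 1) (L.map fun a => (a.1, a.2.net))
      (ls ++ t :: rs)) Γ)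
    (ht : ∀ (A : Formula Atom) S C, Seq (fun _ _ => True) none ({(t, .bang A)} + S) C →
      ∃ (As : List (Formula Atom)) (S' : Multiset (Tree k Var × Formula Atom))
        (C' : Multiset (Cut k Var)), us.length = As.length ∧ ms.length = As.length ∧
        Seq (fun _ _ => True) (some (us.zip (As.map .bang))) S' C' ∧
        Frame (fun _ _ => True) S' C' none S C ∧
        Seq (fun _ _ => True) none ({(w, .bang A)} +
          Multiset.ofList (ms.zip (As.map fun A => A.orth.quest))) 0)
    (hR : (G (.prom m (L.map fun a => (a.1, .mk (a.2.before ++ ms ++ a.2.after ++ [a.2.main])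
      (a.2.cuts ++ [(a.2.port, w)]))) (ls ++ us ++ rs)) []).IsSimple) :
    IsNetSum Γ [(1, G (.prom m (L.map fun a => (a.1, .mk (a.2.before ++ ms ++ a.2.after ++
      [a.2.main]) (a.2.cuts ++ [(a.2.port, w)]))) (ls ++ us ++ rs)) [])] := by
  refine isNetSum_of_forall fun a ha => ?_
  obtain rfl := List.mem_singleton.1 ha
  refine ⟨?_, hR.nodup⟩
  obtain ⟨A, S, C, h1, h2⟩ := hty
  obtain ⟨Θ, Θ', hΘ, h3, h4⟩ := h1.absorb rfl ht
  refine h2 _ _ ((h4 _ m hm (isNetSum_absorb L ms w hΘ hl hr h3 fun a ha => ?_)).cast rfl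
    (zero_add _).symm)
  exact (hG.isTree _ _ hR).isSimple_of_prom (List.mem_map_of_mem ha)

/-- Unlike in the other commutative rules, the content is opened and the reduct is a sum indexed by
its summands. Classes with nonzero coefficient must again be traced back to the content. -/
theorem isNetSum_of_coder [Infinite Var] {G : Tree k Var → List (Cut k Var) → Net k Var}
    {M : Multiset Var} (hG : IsHole G M) {Γ : List (Formula Atom)} {ls rs : List (Tree k Var)}
    {u : Tree k Var} {L : List (k × Ported k Var)} {xs ys : List Var} {P : FSum k Var}
    (hP : P = L.map fun a => (a.1, a.2.net))
    (hx : xs.length = ls.length) (hy : ys.length = rs.length)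
    (hl : ∀ a ∈ L, a.2.before.length = ls.length) (hr : ∀ a ∈ L, a.2.after.length = rs.length)
    (hty : Replaceable G (.prom (ls.length + rs.length + 1) P (ls ++ .coder u :: rs)) Γ)
    {w : Ported k Var → Tree k Var} {ds : Ported k Var → List (Cut k Var)}
    (hw : w = fun e => .cocontr
      (.prom (ls.length + rs.length + 1) P (xs.map .var ++ .coweak :: ys.map .var)) (.coder e.main))
    (hds : ds = fun e => e.cuts ++ [(e.port, .coder u)]
      ++ List.zip (List.zipWith (fun x s => .contr (.covar x) s) xs e.before) ls
      ++ List.zip (List.zipWith (fun x s => .contr (.covar x) s) ys e.after) rs)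
    (hR : ∀ a ∈ L, (G (w a.2) (ds a.2)).IsSimple) :
    IsNetSum Γ (L.map fun a => (a.1, G (w a.2) (ds a.2))) := by
  obtain ⟨A, S, C, h1, h2⟩ := hty
  obtain ⟨Θ, hΘ, h3⟩ := h1.red_prom_coder rfl hx hy
  subst hP
  intro d hd
  obtain ⟨e, he, rfl, hv⟩ := FSum.exists_of_value_map_ne_zero L Ported.net
    (fun e => G (w e) (ds e)) (by
      intro a ha b hb hab
      -- Occurrences in the contractions, needed to separate the variables of a summand from those
      -- common to all reducts.
      have flat : ∀ {xs : List Var} {ss : List (Tree k Var)}, xs.length = ss.length →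
          Multiset.ofList ((List.zipWith (fun x s => Tree.contr (.covar x) s) xs ss).flatMap
            Tree.vars) = Multiset.ofList (xs.map CoInvol.co) +
            Multiset.ofList (ss.flatMap Tree.vars) := by
        intro xs ss h
        induction xs generalizing ss with
        | nil => simp [List.length_eq_zero_iff.1 h.symm]
        | cons x xs ih =>
          match ss, h with
          | s :: ss, h =>
            have := ih (ss := ss) (by simpa using h)
            simp only [List.zipWith_cons_cons, List.flatMap_cons, List.map_cons, Tree.vars_node,
              Tree.vars_var, List.flatMap_nil, ← Multiset.coe_add, this, ← Multiset.cons_coe,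
              ← Multiset.singleton_add, Multiset.coe_nil, add_zero]
            abel
      have vars : ∀ a ∈ L, Multiset.ofList (G (w a.2) (ds a.2)).vars =
          Multiset.ofList a.2.net.vars + (M + Multiset.ofList (xs ++ ys ++ u.vars ++
            xs.map CoInvol.co ++ ys.map CoInvol.co ++ ls.flatMap Tree.vars ++
            rs.flatMap Tree.vars)) := fun e he => by
        have hlen : ∀ {xs : List Var} {ss ls : List (Tree k Var)}, xs.length = ls.length →
            ss.length = ls.length → (List.zipWith (fun x s => Tree.contr (.covar x) s) xs
              ss).length = ls.length := fun h h' => by simp [h, h']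
        have hvar : ∀ xs : List Var, (xs.map (Tree.var (k := k))).flatMap Tree.vars = xs := by
          intro xs
          simp [List.flatMap_map]
        simp only [hG.vars, hw, hds, Ported.vars_net, List.flatMap_append, List.flatMap_cons,
          List.flatMap_nil, ← Multiset.coe_add, Multiset.coe_nil, add_zero, Cut.vars,
          coe_flatMap_vars_zip (hlen hx (hl e he)), coe_flatMap_vars_zip (hlen hy (hr e he)),
          flat (hx.trans (hl e he).symm), flat (hy.trans (hr e he).symm), Tree.vars_node, hvar]
        abel
      refine NetEq.of_context _ hab (vars a ha) (vars b hb) (hR a ha).nodup (hR b hb).nodup ?_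
      intro σ hσ h
      simp only [Multiset.mem_add, Multiset.mem_coe, List.mem_append] at hσ
      obtain ⟨h1, h2, h3, h4, h5⟩ := Ported.of_structEq_net (by rw [hl a ha, hl b hb])
        (by rw [hr a ha, hr b hb]) h
      have hls : ls.map (Tree.rename σ) = ls :=
        Tree.map_rename_eq_self _ fun x hx => hσ x (by tauto)
      have hrs : rs.map (Tree.rename σ) = rs :=
        Tree.map_rename_eq_self _ fun x hx => hσ x (by tauto)
      have hu : u.rename σ = u := Tree.rename_eq_self _ fun x hx => hσ x (by tauto)
      have hvar : ∀ xs : List Var, (∀ x ∈ xs, σ x = x) →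
          (xs.map (Tree.var (k := k))).map (Tree.rename σ) = xs.map .var := by
        intro xs h
        rw [List.map_map]
        exact List.map_congr_left fun x hx => by simp [h x hx]
      have hcontr : ∀ {xs : List Var} {ss ss' : List (Tree k Var)},
          (∀ x ∈ xs.map CoInvol.co, σ x = x) → List.Forall₂ TreeEq (ss.map (Tree.rename σ)) ss' →
          List.Forall₂ TreeEq ((List.zipWith (fun x s => Tree.contr (.covar x) s) xs ss).map
            (Tree.rename σ)) (List.zipWith (fun x s => Tree.contr (.covar x) s) xs ss') := by
        intro xs ss ss' hx h
        induction xs generalizing ss ss' with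
        | nil => simp
        | cons x xs ih =>
          match ss, ss', h with
          | [], [], h => simp
          | s :: ss, s' :: ss', .cons h h' =>
            refine .cons ?_ (ih (fun x h => hx x (by simp [h])) h')
            simp only [Tree.rename_node, List.map_cons, List.map_nil, Tree.rename_var,
              hx _ (List.mem_cons_self ..)]
            exact TreeEq.node _ (.cons (.refl _) (.cons h .nil))
      rw [hG.rename σ fun x hx => hσ x (.inl hx)]
      refine hG.structEq _ _ _ _ ?_ ?_
      · simp only [hw, Tree.rename_node, List.map_cons, List.map_nil, List.map_append,
          hvar xs fun x hx => hσ x (by tauto), hvar ys fun x hx => hσ x (by tauto)]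
        -- Renaming does not enter box labels, so the copy of the box is the same in both reducts.
        exact TreeEq.node _ (.cons (.refl _) (.cons (TreeEq.node _ (.cons h4 .nil)) .nil))
      · simp only [hds, List.map_append, Cut.map_rename_zip, ← Multiset.coe_add, hls, hrs]
        refine .add (.add (.add h5 (.cons (.inl ⟨h2, ?_⟩) .zero))
          (rel_cutEq_zip (hcontr (fun x hx => hσ x (by tauto)) h1) (forall₂_treeEq_refl ls)))
          (rel_cutEq_zip (hcontr (fun x hx => hσ x (by tauto)) h3) (forall₂_treeEq_refl rs))
        simpa [Cut.rename, hu] using TreeEq.refl _) hd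
  refine Net.HasType.isNetClass ?_ (hR e he).nodup
  refine h2 _ _ ?_
  rw [hw, hds]
  exact h3 e.2 (hl e he) (hr e he) (hΘ _ hv).hasType

/-- Commutative reduction of a tree in a context preserves types. -/
theorem TreeRedCom.isNetSum [Infinite Var] {t : Tree k Var}
    {P : List (k × Tree k Var × List (Cut k Var))} (h : TreeRedCom t P)
    {Γ : List (Formula Atom)} {G : Tree k Var → List (Cut k Var) → Net k Var} {M : Multiset Var}
    (hG : IsHole G M) (hty : Replaceable G t Γ) (hR : ∀ a ∈ P, (G a.2.1 a.2.2).IsSimple) :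
    IsNetSum Γ (P.map fun a => (a.1, G a.2.1 a.2.2)) := by
  have hT : ∀ (x : Var) (A : Formula Atom), (fun _ _ => True : Var → Formula Atom → Prop) x A :=
    fun _ _ => trivial
  induction h generalizing G M with
  | node φ us vs t P _ ih =>
    rw [List.map_map]
    refine ih (hG.node φ us vs) ?_ fun a ha => hR _ (List.mem_map_of_mem ha)
    obtain ⟨A, S, C, h1, h2⟩ := hty
    obtain ⟨B, S₁, C₁, h3, h4⟩ := h1.exists_argument
    exact ⟨B, S₁, C₁, h3, fun w ds hw => h2 _ _ (h4 w _ hw)⟩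
  | prom_prom L Q ls us rs xs hx hl hr =>
    refine isNetSum_of_absorb (t := .prom us.length Q us) hG hl hr rfl hty (fun A S C h => ?_)
      (hR _ (List.mem_singleton_self _))
    obtain ⟨As, B, S₁, C₁, e, hAs, -, hQ, h1, hf⟩ := h.inv_prom
    cases e
    refine ⟨As, S₁, C₁, hAs.symm, by simp [hx, hAs], h1, hf, ?_⟩
    -- The tree moved inside is a copy of the inner box, fed by axioms.
    exact Seq.prom hQ hAs (by simp [hx]) (Seq.ax_list hT (hx.trans hAs.symm))
  | prom_coweak L ls rs hl hr =>
    have := isNetSum_of_absorb (us := []) (ms := []) (t := .coweak) (w := .coweak)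
      (m := ls.length + rs.length) hG hl hr (by simp) hty (fun A S C h => by
        obtain ⟨X, -, hf⟩ := h.inv_coweak
        exact ⟨[], 0, 0, rfl, rfl, .nil, hf, (Seq.coweak A).cast (by simp) rfl⟩)
    simp only [List.append_nil] at this
    exact this (hR _ (List.mem_singleton_self _))
  | prom_cocontr L ls rs u₁ u₂ x y hl hr =>
    refine isNetSum_of_absorb (us := [u₁, u₂]) (ms := [.covar x, .covar y])
      (t := .cocontr u₁ u₂) (w := .cocontr (.var x) (.var y)) hG hl hr
      (by simp only [List.length_cons, List.length_nil]; omega) hty (fun A S C h => ?_)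
      (hR _ (List.mem_singleton_self _))
    obtain ⟨X, S₁, S₂, C₁, C₂, e, h1, h2, hf⟩ := h.inv_cocontr
    cases e
    refine ⟨[A, A], S₁ + S₂, C₁ + C₂, rfl, rfl,
      (h1.cons (h2.cons .nil)).cast (by abel) (by abel), hf, ?_⟩
    exact Seq.cocontr (.ax x (.bang A) trivial) (.ax y (.bang A) trivial)
  | prom_coder L ls rs u xs ys hx hy hl hr =>
    rw [List.map_map]
    exact isNetSum_of_coder hG rfl hx hy hl hr hty rfl rfl fun a ha =>
      hR _ (List.mem_map_of_mem ha)

/-- Commutative reduction preserves types. -/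
theorem NetRedCom.isNetSum [Infinite Var] {q : Net k Var} {R : FSum k Var}
    {Γ : List (Formula Atom)} (h : NetRedCom q R) (hq : q.HasType Γ)
    (hR : ∀ a ∈ R, a.2.IsSimple) : IsNetSum Γ R := by
  cases h with
  | tree us vs t cs P h =>
    refine h.isNetSum (IsHole.tree us vs cs) ?_ fun a ha => hR _ (List.mem_map_of_mem ha)
    obtain ⟨L, h1, rfl, h3⟩ := hq
    obtain ⟨L₁, L₂, rfl, rfl, e⟩ := List.map_eq_append_iff.1 h1
    obtain ⟨⟨t, A⟩, L₂, rfl, rfl, rfl⟩ := List.map_eq_cons_iff.1 e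
    have cons : ∀ w : Tree k Var, Multiset.ofList (L₁ ++ (w, A) :: L₂) =
        {(w, A)} + (Multiset.ofList L₁ + Multiset.ofList L₂) := fun w => by
      rw [← Multiset.coe_add, ← Multiset.cons_coe, ← Multiset.singleton_add]
      abel
    refine ⟨A, _, _, h3.cast (cons t) rfl, fun w ds hw => ?_⟩
    refine ⟨L₁ ++ (w, A) :: L₂, by simp [Net.trees], by simp, hw.cast (cons w).symm ?_⟩
    rw [add_comm]
    rfl
  | cut ts t t' cs P h =>
    refine h.isNetSum (IsHole.cut ts t' cs) ?_ fun a ha => hR _ (List.mem_map_of_mem ha)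
    obtain ⟨L, h1, h2, h3⟩ := hq
    -- The premise of `t` is the part that is replaced. The cut with `t'` is then made again, and
    -- the cuts created by the reduction travel through the frame.
    obtain ⟨A, S₁, S₂, C₁, C₂, h4, h5, hf⟩ := Seq.exists_cut (C₀ := Multiset.ofList cs) h3 rfl
    refine ⟨A, S₁, C₁, h4, fun w ds hw => ⟨L, h1, h2, ?_⟩⟩
    have h6 := hf 0 ({(w, t')} + Multiset.ofList ds)
      ((Seq.cut hw h5).cast (by abel) (by abel))
    refine h6.cast (by abel) ?_
    simp only [Net.cuts, ← Multiset.coe_add, Multiset.coe_singleton]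
    abel

end CommutativeReduction

-- Transfer to the quotients, and subject reduction.

section SubjectReduction

variable {k : Type u} {Var : Type v} {Atom : Type w} [CoInvol Var] [CoInvol Atom] [CommSemiring k]

/-- The class of a simple proof-structure among all nets. -/
def Simple.toClass (p : Simple k Var) : NetClass k Var :=
  Quotient.liftOn p (fun q => q.1.toClass) fun _ _ h => Net.toClass_eq.2 h

theorem Simple.toClass_injective :
    Function.Injective (Simple.toClass : Simple k Var → NetClass k Var) := by
  intro p q
  refine Quotient.inductionOn₂ p q fun p q h => ?_
  exact Quotient.sound (Net.toClass_eq.1 h)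

/-- `denote` is taken over classes of simple nets and `FSum.value` over classes of all nets. The
former classes embed in the latter, so the coefficients agree. -/
theorem value_eq_mapDomain_denote (L : List (k × RawSimple k Var)) :
    FSum.value (L.map fun a => (a.1, a.2.1)) = (denote L).mapDomain Simple.toClass := by
  induction L with
  | nil => simp [denote]
  | cons a L ih =>
    rw [List.map_cons, FSum.value_cons, ih]
    simp only [denote, List.map_cons, List.sum_cons, Finsupp.mapDomain_add,
      Finsupp.mapDomain_single]
    rfl

/-- The canonical expansion over the support has only nonzero coefficients, so summands that cancel
never have to be typed. -/
theorem isProofNetSum_of_support {Φ : TypingContext Var Atom} {P : ProofStructure k Var}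
    {Γ : List (Formula Atom)} (h : ∀ p ∈ P.support, IsProofNet Φ p Γ) : IsProofNetSum Φ P Γ := by
  let e := P.support.equivFin
  refine ⟨P.support.card, fun i => P (e.symm i), fun i => e.symm i, fun i => h _ (e.symm i).2, ?_⟩
  rw [Equiv.sum_comp e.symm fun p : P.support => Finsupp.single (p : Simple k Var) (P p),
    Finset.sum_coe_sort P.support fun p => Finsupp.single p (P p)]
  exact P.sum_single.symm

end SubjectReduction

end DiLL

theorem mainTheorem8 {k : Type*} {Var : Type*} {Atom : Type*} [CommSemiring k]
    [DiLL.CoInvol Var] [Countable Var] [Infinite Var] [DiLL.CoInvol Atom]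
    (Φ : DiLL.TypingContext Var Atom) (Γ : List (DiLL.Formula Atom))
    (p : DiLL.Simple k Var) (P : DiLL.ProofStructure k Var)
    (hp : DiLL.IsProofNet Φ p Γ) (hred : DiLL.Reduces p P) :
    ∃ Φ' : DiLL.TypingContext Var Atom, Φ'.Extends Φ ∧ DiLL.IsProofNetSum Φ' P Γ := by
  obtain ⟨r, rfl, hr⟩ := hp
  obtain ⟨q, L, hqr, rfl, hred⟩ := hred
  -- The derivable representative and the one that reduces may differ; typability passes from one to
  -- the other.
  have hq : q.1.HasType Γ := hr.hasType.1.of_netEq (Quotient.exact hqr.symm)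
  have hL : ∀ a ∈ L.map fun a => (a.1, a.2.1), a.2.IsSimple := fun a ha => by
    obtain ⟨b, -, rfl⟩ := List.mem_map.1 ha
    exact b.2.2
  have hsum : DiLL.IsNetSum Γ (L.map fun a => (a.1, a.2.1)) :=
    hred.elim (fun h => h.isNetSum hq q.2 hL) fun h => h.isNetSum hq hL
  -- One extension of `Φ` serves all the finitely many classes in the support.
  obtain ⟨Φ', hΦ, hc⟩ := DiLL.exists_context_of_classes
    ((DiLL.denote L).support.toList.map DiLL.Simple.toClass) (Γ := Γ) (fun c hc => by
      obtain ⟨d, hd, rfl⟩ := List.mem_map.1 hc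
      refine hsum _ ?_
      rw [DiLL.value_eq_mapDomain_denote, Finsupp.mapDomain_apply DiLL.Simple.toClass_injective]
      exact Finsupp.mem_support_iff.1 (Finset.mem_toList.1 hd)) Φ
  refine ⟨Φ', hΦ, DiLL.isProofNetSum_of_support fun d hd => ?_⟩
  obtain ⟨s, hs, hl⟩ := hc _ (List.mem_map_of_mem (Finset.mem_toList.2 hd))
  -- Derivable nets are simple, so `s` is a legitimate representative of the class.
  exact ⟨⟨s, hl.hasType.2.2⟩, DiLL.Simple.toClass_injective hs, hl⟩
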